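/- Let $\hbar>0$, and let $x$ and $\mathsf p=-i\hbar\frac{d}{dx}$ be the (self-adjoint, unbounded) position and momentum operators on $L^2(\mathbb R)=L^2(\mathbb R;\mathbb C)$, with domains $\{f\in L^2: xf\in L^2\}$ and $\{f\in L^2: f'\in L^2\}$ ($f'$ being the weak derivative). Let $\rho$ be a density operator on $L^2(\mathbb R)$, that is, a positive compact operator with $\operatorname{Tr}\rho=1$. For $K\in\{x,\mathsf p\}$ let $$I_K(\rho)=\tfrac12\operatorname{Tr}\big(|[K,\sqrt\rho]|^2\big)\in[0,\infty]$$ be the Wigner--Yanase skew information, where $|B|^2=B^*B$, the commutator is understood in the sense of sesquilinear forms on the domain of $K$, and $I_K(\rho)=\infty$ if it is not a bounded operator. Let $$J_K(\rho)=\operatorname{Tr}\big(|L|^2\rho\big)=\operatorname{Tr}\big((L\sqrt\rho)^*(L\sqrt\rho)\big)\in[0,\infty]$$ be the symmetric logarithmic derivative (SLD) Fisher information, where $L$ is a symmetric, possibly unbounded, operator, defined on the range of $\sqrt\rho$, with $L\sqrt\rho$ bounded, such that $$\tfrac12\,(L\rho+\rho L)=\tfrac1i\,[K,\rho],$$ and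 $J_K(\rho)=\infty$ if there is no such $L$. For $p\in[1,\infty)$ let $\|\rho\|_p=(\operatorname{Tr}|\rho|^p)^{1/p}$ be the Schatten norm. Then for every $p\in(1,\infty)$, with $p'$ defined by $\frac1p+\frac1{p'}=1$, $$\frac14\sqrt{J_x(\rho)\,J_{\mathsf p}(\rho)}\;\ge\;\sqrt{I_x(\rho)\,I_{\mathsf p}(\rho)}\;\ge\;\frac{\hbar}{8\pi\,C_{1/p'}^{2p'}}\,\|\rho\|_p^{p'},$$ where, for $0<s<1$, $$C_s=\frac1{(8\pi)^{s/2}}+\frac{\pi^{(1-s)/2}}{2^s\,\sin(\pi s)^{1/2}\,\Gamma(s)\,\sqrt s}.$$ -/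

import Mathlib

open MeasureTheory
open scoped ENNReal ContDiff InnerProductSpace

noncomputable section

section Abstract

variable {H : Type*} [NormedAddCommGroup H] [InnerProductSpace ℂ H] [CompleteSpace H]

/-- The trace `Tr A = ∑ₙ ⟨eₙ, A eₙ⟩ ∈ [0, ∞]` of a positive bounded operator `A`, computed in an
orthonormal (Hilbert) basis. It does not depend on the basis when `A ≥ 0`, which is the only case
in which it is used below. -/
def opTrace (A : H →L[ℂ] H) : ℝ≥0∞ :=
  ∑' e : (exists_hilbertBasis ℂ H).choose, ENNReal.ofReal (⟪(e : H), A e⟫_ℂ).re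

/-- A density operator: a positive compact operator of trace one. -/
structure IsDensityOperator (ρ : H →L[ℂ] H) : Prop where
  isPositive : ρ.IsPositive
  isCompact : IsCompactOperator ρ
  trace_eq_one : opTrace ρ = 1

/-- The Schatten norm `‖A‖_p = (Tr |A|^p)^{1/p}`, for `1 ≤ p < ∞`. -/
def schattenNorm (p : ℝ) (A : H →L[ℂ] H) : ℝ≥0∞ :=
  opTrace (CFC.abs A ^ p) ^ (1 / p)

/-- `B` is the bounded operator `[K, A] = K A - A K`, where `K` is a (possibly unbounded)
self-adjoint operator and `A` is a bounded operator: the commutator is taken in the sense of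
sesquilinear forms on the domain of `K`. There is at most one such `B` when `K` is densely
defined. -/
def IsCommutator (K : H →ₗ.[ℂ] H) (A B : H →L[ℂ] H) : Prop :=
  ∀ φ ψ : K.domain,
    ⟪(φ : H), B ψ⟫_ℂ = ⟪K φ, A ψ⟫_ℂ - ⟪(φ : H), A (K ψ)⟫_ℂ

/-- The Wigner--Yanase skew information `I_K(ρ) = ½ Tr |[K, √ρ]|²`, with value `∞` if the
commutator is not a bounded operator. Here `|B|² = B* B`. -/
def skewInformation (K : H →ₗ.[ℂ] H) (ρ : H →L[ℂ] H) : ℝ≥0∞ :=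
  ⨅ (B : H →L[ℂ] H) (_ : IsCommutator K (CFC.sqrt ρ) B),
    2⁻¹ * opTrace (ContinuousLinearMap.adjoint B ∘L B)

/-- `L` is a symmetric logarithmic derivative, that is, a (possibly unbounded) symmetric operator,
defined at least on the range of `√ρ`, such that `L √ρ` is a bounded operator, here called `X`,
and `½ (L ρ + ρ L) = (1/i) [K, ρ]`.
Since `L` is symmetric, the bounded extension of `ρ L` is the adjoint of `L ρ = X √ρ`. -/
structure IsSLD (K : H →ₗ.[ℂ] H) (ρ : H →L[ℂ] H) (L : H →ₗ.[ℂ] H) (X : H →L[ℂ] H) : Prop where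
  symmetric : ∀ φ ψ : L.domain, ⟪L φ, (ψ : H)⟫_ℂ = ⟪(φ : H), L ψ⟫_ℂ
  mem_domain : ∀ φ : H, CFC.sqrt ρ φ ∈ L.domain
  apply_eq : ∀ φ : H, X φ = L ⟨CFC.sqrt ρ φ, mem_domain φ⟩
  equation : ∃ C : H →L[ℂ] H, IsCommutator K ρ C ∧
    (1 / 2 : ℂ) • (X ∘L CFC.sqrt ρ + ContinuousLinearMap.adjoint (X ∘L CFC.sqrt ρ))
      = (1 / Complex.I) • C

/-- The symmetric logarithmic derivative Fisher information
`J_K(ρ) = Tr (|L|² ρ) = Tr ((L √ρ)* (L √ρ))`, where `L` is a symmetric logarithmic derivative; its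
value is `∞` if there is none. All symmetric logarithmic derivatives have the same `L √ρ`, so the
infimum only serves to pick this common value. -/
def sldInformation (K : H →ₗ.[ℂ] H) (ρ : H →L[ℂ] H) : ℝ≥0∞ :=
  ⨅ (L : H →ₗ.[ℂ] H) (X : H →L[ℂ] H) (_ : IsSLD K ρ L X),
    opTrace (ContinuousLinearMap.adjoint X ∘L X)

end Abstract

/-- The Hilbert space `L²(ℝ)` of complex-valued square-integrable functions. -/
abbrev L2R : Type := Lp ℂ 2 (volume : Measure ℝ)

/-- The position operator: multiplication by `x`, on the domain of all `f ∈ L²` with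
`x f ∈ L²`. -/
def positionOp : L2R →ₗ.[ℂ] L2R where
  domain :=
    { carrier := {f | MemLp (fun x : ℝ => (x : ℂ) * f x) 2 volume}
      add_mem' := by
        intro f g hf hg
        refine (MemLp.add hf hg).ae_eq ?_
        filter_upwards [Lp.coeFn_add f g] with x hx
        simp only [Pi.add_apply, hx]
        ring
      zero_mem' := by
        refine (MemLp.zero : MemLp (fun _ : ℝ => (0 : ℂ)) 2 volume).ae_eq ?_
        filter_upwards [Lp.coeFn_zero ℂ 2 (volume : Measure ℝ)] with x hx
        rw [hx, Pi.zero_apply, mul_zero]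
      smul_mem' := by
        intro c f hf
        refine (MemLp.const_smul hf c).ae_eq ?_
        filter_upwards [Lp.coeFn_smul c f] with x hx
        simp only [Pi.smul_apply, hx, smul_eq_mul]
        ring }
  toFun :=
    { toFun := fun f => MemLp.toLp (fun x : ℝ => (x : ℂ) * (f : L2R) x) f.2
      map_add' := by
        intro f g
        rw [← MemLp.toLp_add]
        refine MemLp.toLp_congr _ _ ?_
        filter_upwards [Lp.coeFn_add (f : L2R) (g : L2R)] with x hx
        simp only [Submodule.coe_add, Pi.add_apply, hx]
        ring
      map_smul' := by
        intro c f
        rw [RingHom.id_apply, ← MemLp.toLp_const_smul]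
        refine MemLp.toLp_congr _ _ ?_
        filter_upwards [Lp.coeFn_smul c (f : L2R)] with x hx
        simp only [Submodule.coe_smul, Pi.smul_apply, hx, smul_eq_mul]
        ring }

/-- `g ∈ L²` is the weak derivative of `f ∈ L²`. -/
def IsWeakDeriv (f g : L2R) : Prop :=
  ∀ φ : ℝ → ℝ, ContDiff ℝ ∞ φ → HasCompactSupport φ →
    ∫ x, deriv φ x • f x = -∫ x, φ x • g x

theorem integrable_testFunction_smul (f : L2R) {φ : ℝ → ℝ} (hφ : Continuous φ)
    (hc : HasCompactSupport φ) : Integrable (fun x => φ x • f x) :=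
  ((Lp.memLp f).locallyIntegrable (by norm_num)).integrable_smul_left_of_hasCompactSupport hφ hc

theorem IsWeakDeriv.add {f₁ f₂ g₁ g₂ : L2R} (h₁ : IsWeakDeriv f₁ g₁) (h₂ : IsWeakDeriv f₂ g₂) :
    IsWeakDeriv (f₁ + f₂) (g₁ + g₂) := by
  intro φ hφ hc
  have hd : Continuous (deriv φ) := hφ.continuous_deriv (by simp)
  have e₁ : ∫ x, deriv φ x • (f₁ + f₂ : L2R) x
      = ∫ x, (deriv φ x • f₁ x + deriv φ x • f₂ x) := by
    refine integral_congr_ae ?_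
    filter_upwards [Lp.coeFn_add f₁ f₂] with x hx
    rw [hx, Pi.add_apply, smul_add]
  have e₂ : ∫ x, φ x • (g₁ + g₂ : L2R) x = ∫ x, (φ x • g₁ x + φ x • g₂ x) := by
    refine integral_congr_ae ?_
    filter_upwards [Lp.coeFn_add g₁ g₂] with x hx
    rw [hx, Pi.add_apply, smul_add]
  rw [e₁, e₂, integral_add (integrable_testFunction_smul f₁ hd hc.deriv)
      (integrable_testFunction_smul f₂ hd hc.deriv),
    integral_add (integrable_testFunction_smul g₁ hφ.continuous hc)
      (integrable_testFunction_smul g₂ hφ.continuous hc), h₁ φ hφ hc, h₂ φ hφ hc]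
  ring

theorem IsWeakDeriv.smul {f g : L2R} (c : ℂ) (h : IsWeakDeriv f g) :
    IsWeakDeriv (c • f) (c • g) := by
  intro φ hφ hc
  have e₁ : ∫ x, deriv φ x • (c • f : L2R) x = ∫ x, c • (deriv φ x • f x) := by
    refine integral_congr_ae ?_
    filter_upwards [Lp.coeFn_smul c f] with x hx
    rw [hx, Pi.smul_apply, smul_comm]
  have e₂ : ∫ x, φ x • (c • g : L2R) x = ∫ x, c • (φ x • g x) := by
    refine integral_congr_ae ?_
    filter_upwards [Lp.coeFn_smul c g] with x hx
    rw [hx, Pi.smul_apply, smul_comm]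
  rw [e₁, e₂, integral_smul, integral_smul, h φ hφ hc, smul_neg]

theorem IsWeakDeriv.unique {f g₁ g₂ : L2R} (h₁ : IsWeakDeriv f g₁) (h₂ : IsWeakDeriv f g₂) :
    g₁ = g₂ := by
  refine Lp.ext ?_
  refine ae_eq_of_integral_contDiff_smul_eq ((Lp.memLp g₁).locallyIntegrable (by norm_num))
    ((Lp.memLp g₂).locallyIntegrable (by norm_num)) ?_
  intro φ hφ hc
  exact neg_injective ((h₁ φ hφ hc).symm.trans (h₂ φ hφ hc))

/-- The momentum operator `-i ℏ d/dx`, on the domain of all `f ∈ L²` with weak derivative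
in `L²`. -/
def momentumOp (ℏ : ℝ) : L2R →ₗ.[ℂ] L2R where
  domain :=
    { carrier := {f | ∃ g, IsWeakDeriv f g}
      add_mem' := by
        rintro f₁ f₂ ⟨g₁, h₁⟩ ⟨g₂, h₂⟩
        exact ⟨g₁ + g₂, h₁.add h₂⟩
      zero_mem' := by
        refine ⟨0, fun φ _ _ => ?_⟩
        have h : ∀ u : ℝ → ℝ, ∫ x, u x • (0 : L2R) x = 0 := by
          intro u
          refine integral_eq_zero_of_ae ?_
          filter_upwards [Lp.coeFn_zero ℂ 2 (volume : Measure ℝ)] with x hx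
          simp only [hx, Pi.zero_apply, smul_zero]
        rw [h, h, neg_zero]
      smul_mem' := by
        rintro c f ⟨g, h⟩
        exact ⟨c • g, h.smul c⟩ }
  toFun :=
    { toFun := fun f => (-Complex.I * (ℏ : ℂ)) • f.2.choose
      map_add' := by
        intro f g
        rw [← smul_add]
        congr 1
        exact (f + g).2.choose_spec.unique (f.2.choose_spec.add g.2.choose_spec)
      map_smul' := by
        intro c f
        rw [RingHom.id_apply, smul_comm c]
        congr 1
        exact (c • f).2.choose_spec.unique (f.2.choose_spec.smul c) }

/-- The constant
`C_s = (8π)^{-s/2} + π^{(1-s)/2} / (2^s sin(πs)^{1/2} Γ(s) √s)`, for `0 < s < 1`. -/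
def sobolevConst (s : ℝ) : ℝ :=
  1 / (8 * Real.pi) ^ (s / 2) +
    Real.pi ^ ((1 - s) / 2) /
      (2 ^ s * Real.sin (Real.pi * s) ^ (1 / 2 : ℝ) * Real.Gamma s * Real.sqrt s)

end

/-! Write `ρ b_i = l_i² b_i` in an orthonormal eigenbasis, so that `√ρ b_i = l_i b_i` and `∑ l_i² =
1`.

The SLD bound holds separately for each `K`, in the form `I_K ≤ J_K / 4`. With `X = L√ρ` and `C =
[K, ρ]`, the SLD equation reads `½ (l_k X_jk + l_j conj X_kj) = C_jk / i` in matrix entries.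
Formally `C = √ρ B + B √ρ` for `B = [K, √ρ]`, hence `B_jk = C_jk / (l_j + l_k)` and `|B_jk|² ≤ ¼
(|X_jk|² + |X_kj|²)`; summation gives the claim (`skewInformation_le_sldInformation`). Eigenvectors
need not lie in the domain of `K`, so the matrix must be shown to represent the commutator form.
This is done by approximating `√ρ` by polynomials in `ρ`, whose commutators with `K` follow from the
Leibniz rule and have divided differences as matrix multipliers (`exists_isCommutator_sqrt`).

The Schatten bound lives on phase space. Let `u = ∑ l_j A_j`, where `A_j` is the Fourier-Wigner
function of `b_j`, in the variables `(ξ, v)`. The `A_j` are orthonormal in `L²(ℝ²)` and bounded by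
1. The kernel of `[x, √ρ]` is `x - y` times that of `√ρ`, so Plancherel gives `∫ v² |u|² ≤ 2 I_x`.
The Fourier transform turns momentum into `2πℏ` times position and rotates phase space by a quarter
turn, so `(2πℏ)² ∫ ξ² |u|² ≤ 2 I_p` (`exists_hasSum_ambiguityLp`). Let `w = 1 + (αξ)² + (βv)²` and
`f = ∑ c_j A_j`, a finite sum. Cauchy-Schwarz gives `|⟨f, u⟩|² ≤ ∫ |f|²/w · ∫ w |u|²`. Interpolating
between orthonormality and the sup bound (`integral_sq_mul_exp_le_of_orthonormal`) gives `∫ |f|²/w ≤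
(∫ w^(-1/s))^s (∑ c_j^(2/(1+s)))^(1+s)`. The dual choice of `c_j` and the best `α, β` bound `∑
l_j^(2/(1-s)) = Tr ρ^p`, where `s = 1/p'` (`sum_rpow_le_of_second_moments`).

This yields `√(I_x I_p) ≥ (ℏ/2) (1-s)^(1/s) ‖ρ‖_p^(1/s)`, which implies the stated bound because
`(1-s)^(-1/s) ≤ 4π C_s^(2/s)` (`rpow_neg_inv_le_sobolevConst`). -/

/-! ### Traces, eigenbases and functional calculus on eigenvectors. -/

section HilbertSpace

universe u

variable {H : Type u} [NormedAddCommGroup H] [InnerProductSpace ℂ H]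

theorem HilbertBasis.tsum_enorm_inner_sq {ι : Type*} (b : HilbertBasis ι ℂ H) (x : H) :
    ∑' i, ‖⟪b i, x⟫_ℂ‖ₑ ^ 2 = ‖x‖ₑ ^ 2 := by
  have h2 : HasSum (fun i => ‖⟪b i, x⟫_ℂ‖ ^ 2) (‖x‖ ^ 2) := by
    have h3 := Complex.hasSum_re (b.hasSum_inner_mul_inner x x)
    have e : (⟪x, x⟫_ℂ).re = ‖x‖ ^ 2 := by simpa using inner_self_eq_norm_sq (𝕜 := ℂ) x
    rw [e] at h3
    refine h3.congr_fun fun i => ?_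
    rw [← inner_conj_symm x, Complex.conj_mul', ← Complex.ofReal_pow, Complex.ofReal_re]
  have h4 := congrArg ENNReal.ofReal h2.tsum_eq
  rw [ENNReal.ofReal_tsum_of_nonneg (fun i => by positivity) h2.summable] at h4
  simpa only [ENNReal.ofReal_pow (norm_nonneg _), ofReal_norm] using h4

theorem aeval_apply_of_eigenvector {a : H →L[ℂ] H} {x : H} {μ : ℝ} (h : a x = (μ : ℂ) • x)
    (q : Polynomial ℝ) : Polynomial.aeval a q x = ((q.eval μ : ℝ) : ℂ) • x := by
  induction q using Polynomial.induction_on' with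
  | add p q hp hq => simp [hp, hq, add_smul]
  | monomial n c =>
    have : ∀ n : ℕ, (a ^ n) x = ((μ ^ n : ℝ) : ℂ) • x := by
      intro n
      induction n with
      | zero => simp
      | succ n ih =>
        rw [pow_succ', mul_apply_eq_comp, ih, map_smul, h, smul_smul, pow_succ]
        push_cast; rfl
    simp [Polynomial.aeval_monomial, this, mul_smul, Algebra.algebraMap_eq_smul_one]

variable [CompleteSpace H]

/-- Parseval in `b`, then, after exchanging the sums, Parseval in `e` for the adjoint. This makes
the Hilbert-Schmidt norm, and hence every trace used here, independent of the basis. -/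
theorem tsum_enorm_apply_sq_eq {ι κ : Type*} (b : HilbertBasis ι ℂ H) (e : HilbertBasis κ ℂ H)
    (T : H →L[ℂ] H) :
    ∑' k, ‖T (e k)‖ₑ ^ 2 = ∑' j, ∑' k, ‖⟪b j, T (b k)⟫_ℂ‖ₑ ^ 2 := by
  calc ∑' k, ‖T (e k)‖ₑ ^ 2 = ∑' k, ∑' j, ‖⟪b j, T (e k)⟫_ℂ‖ₑ ^ 2 := by
        simp only [b.tsum_enorm_inner_sq]
    _ = ∑' j, ∑' k, ‖⟪b j, T (e k)⟫_ℂ‖ₑ ^ 2 := ENNReal.tsum_comm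
    _ = ∑' j, ‖ContinuousLinearMap.adjoint T (b j)‖ₑ ^ 2 := by
        refine tsum_congr fun j => ?_
        rw [← e.tsum_enorm_inner_sq]
        refine tsum_congr fun k => ?_
        rw [← ContinuousLinearMap.adjoint_inner_left, ← inner_conj_symm, RCLike.enorm_conj]
    _ = _ := by
        refine tsum_congr fun j => ?_
        rw [← b.tsum_enorm_inner_sq]
        refine tsum_congr fun k => ?_
        rw [← inner_conj_symm, RCLike.enorm_conj, ContinuousLinearMap.adjoint_inner_left]

theorem opTrace_adjoint_comp_eq {ι : Type*} (b : HilbertBasis ι ℂ H) (T : H →L[ℂ] H) :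
    opTrace (ContinuousLinearMap.adjoint T ∘L T) = ∑' j, ∑' k, ‖⟪b j, T (b k)⟫_ℂ‖ₑ ^ 2 := by
  obtain ⟨e, he⟩ := (exists_hilbertBasis ℂ H).choose_spec
  rw [← tsum_enorm_apply_sq_eq b e T, opTrace]
  refine tsum_congr fun k => ?_
  rw [he, ContinuousLinearMap.comp_apply, ContinuousLinearMap.adjoint_inner_right]
  have : (⟪T k, T k⟫_ℂ).re = ‖T k‖ ^ 2 := by
    simpa using inner_self_eq_norm_sq (𝕜 := ℂ) (T k)
  rw [this, ENNReal.ofReal_pow (norm_nonneg _), ofReal_norm]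

theorem opTrace_adjoint_comp_eq_tsum_apply {ι : Type*} (b : HilbertBasis ι ℂ H) (T : H →L[ℂ] H) :
    opTrace (ContinuousLinearMap.adjoint T ∘L T) = ∑' k, ‖T (b k)‖ₑ ^ 2 := by
  rw [opTrace_adjoint_comp_eq b, tsum_enorm_apply_sq_eq b b]

/-- Orthonormal bases of all eigenspaces, the kernel included, are put together; by the spectral
theorem for compact symmetric operators nothing is orthogonal to all of them. -/
theorem exists_hilbertBasis_eigenvectors {ρ : H →L[ℂ] H} (hρ : ρ.IsPositive)
    (hc : IsCompactOperator ρ) :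
    ∃ (ι : Type u) (b : HilbertBasis ι ℂ H) (μ : ι → ℝ), (∀ i, 0 ≤ μ i) ∧
      ∀ i, ρ (b i) = (μ i : ℂ) • b i := by
  have hs : (ρ : H →ₗ[ℂ] H).IsSymmetric := hρ.isSymmetric
  let V : ℂ → Submodule ℂ H := fun μ => Module.End.eigenspace (ρ : H →ₗ[ℂ] H) μ
  have hcl : ∀ μ, IsClosed (V μ : Set H) := by
    intro μ
    have : (V μ : Set H) = {x | ρ x = μ • x} := by
      ext x; simp [V]
    rw [this]
    exact isClosed_eq ρ.continuous (continuous_const_smul μ)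
  have hcs : ∀ μ, CompleteSpace (V μ) := fun μ => (hcl μ).completeSpace_coe
  choose w b hb using fun μ => exists_hilbertBasis ℂ (V μ)
  let v : (Σ μ, w μ) → H := fun a => ((a.2 : V a.1) : H)
  have hv : Orthonormal ℂ v := by
    have := hs.orthogonalFamily_eigenspaces.orthonormal_sigma_orthonormal
      (α := fun μ => w μ) (v_family := fun μ (a : w μ) => (a : V μ)) (fun μ => by
        have := (b μ).orthonormal
        rwa [hb μ] at this)
    exact this
  have hort : (Submodule.span ℂ (Set.range v))ᗮ = ⊥ := by
    rw [eq_bot_iff, ← ContinuousLinearMap.orthogonalComplement_iSup_eigenspaces_eq_bot hc hs]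
    intro x hx
    rw [Submodule.mem_orthogonal] at hx
    rw [← Submodule.iInf_orthogonal, Submodule.mem_iInf]
    intro μ y hy
    have h0 := (b μ).hasSum_repr ⟨y, hy⟩
    have h1 := (h0.mapL (V μ).subtypeL).mapL (innerSL ℂ x)
    have h2 : ∀ i, (innerSL ℂ x) ((V μ).subtypeL ((b μ).repr ⟨y, hy⟩ i • (b μ) i)) = 0 := by
      intro i
      rw [map_smul, map_smul, innerSL_apply_apply, ← inner_conj_symm, hb μ]
      rw [show ⟪(V μ).subtypeL (i : V μ), x⟫_ℂ = 0 from
        hx _ (Submodule.subset_span ⟨⟨μ, i⟩, rfl⟩)]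
      simp
    simp only [h2] at h1
    have h3 := h1.unique hasSum_zero
    simpa [inner_eq_zero_symm] using h3
  have heig : ∀ a, ρ (v a) = a.1 • v a := fun a => Module.End.mem_eigenspace_iff.1 (a.2 : V a.1).2
  have hre : ∀ a : Σ μ, w μ, 0 ≤ a.1.re ∧ a.1.im = 0 := by
    intro a
    have h1 := RCLike.nonneg_iff.1 (hρ.inner_nonneg_right (v a))
    rw [heig, inner_smul_right, inner_self_eq_norm_sq_to_K, hv.1 a] at h1
    simpa using h1
  refine ⟨(Σ μ, w μ), HilbertBasis.mkOfOrthogonalEqBot hv hort, fun a => a.1.re, fun a => ?_, fun a => ?_⟩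
  · exact (hre a).1
  · rw [HilbertBasis.coe_mkOfOrthogonalEqBot, heig]
    congr 1
    exact Complex.ext (by simp) (by simpa using (hre a).2)

theorem cfc_apply_of_eigenvector {a : H →L[ℂ] H} (ha : IsSelfAdjoint a) {x : H} {μ : ℝ}
    (h : a x = (μ : ℂ) • x) {f : ℝ → ℝ} (hf : Continuous f) :
    cfc f a x = ((f μ : ℝ) : ℂ) • x := by
  obtain ⟨M, hM⟩ := ((spectrum.isCompact (𝕜 := ℝ) a).isBounded.union
    (Bornology.isBounded_singleton (x := μ))).subset_closedBall 0
  rw [Real.closedBall_eq_Icc] at hM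
  refine eq_of_forall_dist_le fun ε hε => ?_
  have hδ : 0 < ε / (2 * ‖x‖ + 1) := by positivity
  obtain ⟨q, hq⟩ := exists_polynomial_near_of_continuousOn (0 - M) (0 + M) f hf.continuousOn _ hδ
  have h1 : ‖cfc f a - Polynomial.aeval a q‖ ≤ ε / (2 * ‖x‖ + 1) := by
    rw [← cfc_polynomial q a, ← cfc_sub ..]
    refine norm_cfc_le hδ.le fun y hy => ?_
    rw [Real.norm_eq_abs, abs_sub_comm]
    exact (hq y (hM (Or.inl hy))).le
  have h2 : ‖(cfc f a - Polynomial.aeval a q) x‖ ≤ ε / (2 * ‖x‖ + 1) * ‖x‖ :=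
    ContinuousLinearMap.le_of_opNorm_le _ h1 x
  have h3 : ‖((q.eval μ - f μ : ℝ) : ℂ) • x‖ ≤ ε / (2 * ‖x‖ + 1) * ‖x‖ := by
    rw [norm_smul, Complex.norm_real, Real.norm_eq_abs]
    gcongr
    exact (hq μ (hM (Or.inr rfl))).le
  have h4 : cfc f a x - ((f μ : ℝ) : ℂ) • x
      = (cfc f a - Polynomial.aeval a q) x + ((q.eval μ - f μ : ℝ) : ℂ) • x := by
    rw [_root_.sub_apply, aeval_apply_of_eigenvector h]
    push_cast
    module
  rw [dist_eq_norm, h4]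
  calc _ ≤ ε / (2 * ‖x‖ + 1) * ‖x‖ + ε / (2 * ‖x‖ + 1) * ‖x‖ := (norm_add_le _ _).trans (by gcongr)
    _ = ε * ((2 * ‖x‖) / (2 * ‖x‖ + 1)) := by ring
    _ ≤ ε * 1 := by
        gcongr
        rw [div_le_one (by positivity)]
        linarith
    _ = ε := mul_one ε

theorem rpow_apply_of_eigenvector {a : H →L[ℂ] H} (ha : 0 ≤ a) {x : H} {μ : ℝ}
    (h : a x = (μ : ℂ) • x) {y : ℝ} (hy : 0 ≤ y) :
    (a ^ y) x = ((μ ^ y : ℝ) : ℂ) • x := by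
  rw [CFC.rpow_eq_cfc_real ha]
  exact cfc_apply_of_eigenvector (IsSelfAdjoint.of_nonneg ha) h (Real.continuous_rpow_const hy)

end HilbertSpace

/-! ### Polynomial approximation of the square root and its divided differences. -/

section SquareRootIteration

/-- Visser's iteration `q ↦ q + (x - q²) / 2`, which increases from `0` to `√x` on `[0, 1]`. -/
noncomputable def visser (x : ℝ) : ℕ → ℝ
  | 0 => 0
  | n + 1 => visser x n + (x - visser x n ^ 2) / 2

/-- The divided differences of `visser` with respect to `x`. -/
noncomputable def visserDiff (x y : ℝ) : ℕ → ℝ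
  | 0 => 0
  | n + 1 => visserDiff x y n + (1 - (visser x n + visser y n) * visserDiff x y n) / 2

theorem visser_mem {l : ℝ} (h0 : 0 ≤ l) (h1 : l ≤ 1) (n : ℕ) :
    0 ≤ visser (l ^ 2) n ∧ visser (l ^ 2) n ≤ l := by
  induction n with
  | zero => simpa [visser] using h0
  | succ n ih => 
    simp only [visser]
    constructor <;> nlinarith

theorem visser_le_succ {l : ℝ} (h0 : 0 ≤ l) (h1 : l ≤ 1) (n : ℕ) :
    visser (l ^ 2) n ≤ visser (l ^ 2) (n + 1) := by
  have := visser_mem h0 h1 n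
  simp only [visser]
  nlinarith

theorem le_visser_succ {l : ℝ} (h0 : 0 ≤ l) (h1 : l ≤ 1) (n : ℕ) :
    l ^ 2 / 2 ≤ visser (l ^ 2) (n + 1) := by
  induction n with
  | zero => simp [visser]
  | succ n ih => exact ih.trans (visser_le_succ h0 h1 _)

theorem tendsto_zero_of_le_mul_add {a ε : ℕ → ℝ} {r : ℝ} (hr0 : 0 ≤ r) (hr1 : r < 1)
    (h : ∀ n, a (n + 1) ≤ r * a n + ε n) (ha : ∀ n, 0 ≤ a n)
    (hε : Filter.Tendsto ε Filter.atTop (nhds 0)) : Filter.Tendsto a Filter.atTop (nhds 0) := by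
  rw [Metric.tendsto_atTop]
  intro η hη
  obtain ⟨N, hN⟩ := Metric.tendsto_atTop.1 hε ((1 - r) * (η / 2)) (by nlinarith)
  have h1 : ∀ m, a (N + m) ≤ r ^ m * a N + η / 2 := by
    intro m
    induction m with
    | zero => simp; linarith
    | succ m ih =>
      have h2 := hN (N + m) (by omega)
      rw [Real.dist_0_eq_abs] at h2
      have h3 := h (N + m)
      have h4 := (abs_lt.1 h2).2
      have h5 := mul_le_mul_of_nonneg_left ih hr0
      rw [← add_assoc, pow_succ]
      nlinarith
  have h2 : Filter.Tendsto (fun m => r ^ m * a N) Filter.atTop (nhds 0) := by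
    simpa using (tendsto_pow_atTop_nhds_zero_of_lt_one hr0 hr1).mul_const (a N)
  obtain ⟨M, hM⟩ := Metric.tendsto_atTop.1 h2 (η / 2) (by linarith)
  refine ⟨N + M, fun n hn => ?_⟩
  obtain ⟨m, rfl⟩ := Nat.exists_eq_add_of_le (show N ≤ n by omega)
  have h3 := hM m (by omega)
  rw [Real.dist_0_eq_abs] at h3 ⊢
  rw [abs_of_nonneg (ha _)]
  have := h1 m
  have := (abs_lt.1 h3).2
  linarith

theorem tendsto_visser {l : ℝ} (h0 : 0 ≤ l) (h1 : l ≤ 1) :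
    Filter.Tendsto (visser (l ^ 2)) Filter.atTop (nhds l) := by
  rcases h0.eq_or_lt with rfl | hl
  · have : ∀ n, visser (0 ^ 2) n = 0 := fun n =>
      le_antisymm (visser_mem le_rfl zero_le_one n).2 (visser_mem le_rfl zero_le_one n).1
    simpa using tendsto_const_nhds.congr fun n => (this n).symm
  -- The error satisfies `l - q_{n+1} = (l - q_n) (1 - (l + q_n)/2)`, a contraction by at least `1 -
  -- l/2`.
  · have := tendsto_zero_of_le_mul_add (a := fun n => l - visser (l ^ 2) n) (ε := fun _ => 0)
      (r := 1 - l / 2) (by linarith) (by linarith) (fun n => by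
        have := visser_mem h0 h1 n
        simp only [visser]
        nlinarith) (fun n => by linarith [(visser_mem h0 h1 n).2]) tendsto_const_nhds
    simpa using tendsto_const_nhds.sub this (a := l)

/-- Uniform bounds that later provide the dominating function. They follow from `l² d_n ≤ q_n(l²) ≤
l`; the first inequality propagates because `q_{n+1} - l² d_{n+1} = (q_n - l² d_n)(1 - (q_n +
q_n')/2) + q_n q_n'/2`, where `q_n' = q_n(m²)`. -/
theorem visserDiff_mem {l m : ℝ} (h0 : 0 ≤ l) (h1 : l ≤ 1) (k0 : 0 ≤ m) (k1 : m ≤ 1) (n : ℕ) :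
    0 ≤ visserDiff (l ^ 2) (m ^ 2) n ∧ l * visserDiff (l ^ 2) (m ^ 2) n ≤ 1
      ∧ m * visserDiff (l ^ 2) (m ^ 2) n ≤ 1 := by
  have hpos : ∀ n, 0 ≤ visserDiff (l ^ 2) (m ^ 2) n := by
    intro n
    induction n with
    | zero => simp [visserDiff]
    | succ n ih =>
      have h2 := visser_mem h0 h1 n
      have h3 := visser_mem k0 k1 n
      simp only [visserDiff]
      nlinarith
  have hl : ∀ n, l ^ 2 * visserDiff (l ^ 2) (m ^ 2) n ≤ visser (l ^ 2) n := by
    intro n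
    induction n with
    | zero => simp [visserDiff, visser]
    | succ n ih =>
      have h2 := visser_mem h0 h1 n
      have h3 := visser_mem k0 k1 n
      simp only [visserDiff, visser]
      nlinarith [mul_nonneg (sub_nonneg.2 ih) (show 0 ≤ 2 - (visser (l ^ 2) n + visser (m ^ 2) n) by
        linarith), mul_nonneg h2.1 h3.1]
  have hm : ∀ n, m ^ 2 * visserDiff (l ^ 2) (m ^ 2) n ≤ visser (m ^ 2) n := by
    intro n
    induction n with
    | zero => simp [visserDiff, visser]
    | succ n ih =>
      have h2 := visser_mem h0 h1 n
      have h3 := visser_mem k0 k1 n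
      simp only [visserDiff, visser]
      nlinarith [mul_nonneg (sub_nonneg.2 ih) (show 0 ≤ 2 - (visser (l ^ 2) n + visser (m ^ 2) n) by
        linarith), mul_nonneg h2.1 h3.1]
  refine ⟨hpos n, ?_, ?_⟩
  · rcases h0.eq_or_lt with rfl | hl0
    · simp
    · have := (hl n).trans (visser_mem h0 h1 n).2
      nlinarith
  · rcases k0.eq_or_lt with rfl | hl0
    · simp
    · have := (hm n).trans (visser_mem k0 k1 n).2
      nlinarith

/-- The limit is the divided difference `(l - m)/(l² - m²)` of the square root. Working with the
recursion instead of the quotient covers the diagonal `l = m` too. -/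
theorem tendsto_visserDiff {l m : ℝ} (h0 : 0 ≤ l) (h1 : l ≤ 1) (k0 : 0 ≤ m) (k1 : m ≤ 1)
    (hlm : 0 < l + m) :
    Filter.Tendsto (visserDiff (l ^ 2) (m ^ 2)) Filter.atTop (nhds (1 / (l + m))) := by
  have hsq : 0 < l ^ 2 + m ^ 2 := by
    rcases h0.eq_or_lt with rfl | hl
    · have : 0 < m := by linarith
      positivity
    · positivity
  have ht : Filter.Tendsto (fun n => (l + m - (visser (l ^ 2) (n + 1) + visser (m ^ 2) (n + 1)))
      / (2 * (l + m))) Filter.atTop (nhds 0) := by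
    have := ((tendsto_visser h0 h1).add (tendsto_visser k0 k1)).comp (Filter.tendsto_add_atTop_nat 1)
    have := ((tendsto_const_nhds (x := l + m)).sub this).div_const (2 * (l + m))
    simpa using this
  have key := tendsto_zero_of_le_mul_add
    (a := fun n => |1 / (l + m) - visserDiff (l ^ 2) (m ^ 2) (n + 1)|)
    (r := 1 - (l ^ 2 + m ^ 2) / 4) (by nlinarith) (by linarith) (fun n => by
      have h2 := visser_mem h0 h1 (n + 1)
      have h3 := visser_mem k0 k1 (n + 1)
      have h4 := le_visser_succ h0 h1 n
      have h5 := le_visser_succ k0 k1 n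
      rw [visserDiff]
      generalize visserDiff (l ^ 2) (m ^ 2) (n + 1) = d at *
      generalize visser (l ^ 2) (n + 1) = q at *
      generalize visser (m ^ 2) (n + 1) = q' at *
      -- The new error is the old one times a factor at most `1 - (l² + m²)/4`, since `q_{n+1}(l²) ≥
      -- l²/2`, minus a term tending to zero.
      have e : 1 / (l + m) - (d + (1 - (q + q') * d) / 2)
        = (1 / (l + m) - d) * (1 - (q + q') / 2) - (l + m - (q + q')) / (2 * (l + m)) := by
        field_simp
        ring
      rw [e]
      have h6 : 0 ≤ (l + m - (q + q')) / (2 * (l + m)) := div_nonneg (by linarith) (by linarith)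
      refine (abs_sub _ _).trans ?_
      rw [abs_mul, abs_of_nonneg h6, abs_of_nonneg (show 0 ≤ 1 - (q + q') / 2 by linarith)]
      have := abs_nonneg (1 / (l + m) - d)
      nlinarith) (fun n => abs_nonneg _) ht
  have h2 := (tendsto_zero_iff_abs_tendsto_zero _).2 key
  have h3 := (tendsto_const_nhds (x := 1 / (l + m))).sub h2
  rw [← Filter.tendsto_add_atTop_iff_nat 1]
  simpa using h3

end SquareRootIteration

/-! ### Square-summable matrices and Hilbert-Schmidt operators. -/

section HilbertSchmidt

variable {H : Type*} [NormedAddCommGroup H] [InnerProductSpace ℂ H]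

theorem tsum_enorm_sq_ne_top_iff {ι E : Type*} [NormedAddCommGroup E] {f : ι → E} :
    ∑' i, ‖f i‖ₑ ^ 2 ≠ ⊤ ↔ Summable fun i => ‖f i‖ ^ 2 := by
  have h : ∀ i, ‖f i‖ₑ ^ 2 = ((‖f i‖₊ ^ 2 : NNReal) : ℝ≥0∞) := fun i => by
    rw [ENNReal.coe_pow]; rfl
  simp only [h, ENNReal.tsum_coe_ne_top_iff_summable, ← NNReal.summable_coe, NNReal.coe_pow,
    coe_nnnorm]

theorem HilbertBasis.summable_norm_inner_sq {ι : Type*} (b : HilbertBasis ι ℂ H) (x : H) :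
    Summable fun i => ‖⟪b i, x⟫_ℂ‖ ^ 2 := by
  rw [← tsum_enorm_sq_ne_top_iff, b.tsum_enorm_inner_sq]
  exact ENNReal.pow_ne_top enorm_ne_top

theorem HilbertBasis.summable_inner_mul_inner_sq {ι : Type*} (b : HilbertBasis ι ℂ H) (x y : H) :
    Summable fun p : ι × ι => ‖⟪x, b p.1⟫_ℂ * ⟪b p.2, y⟫_ℂ‖ ^ 2 := by
  have := (b.summable_norm_inner_sq x).mul_of_nonneg (b.summable_norm_inner_sq y)
    (fun i => by positivity) (fun i => by positivity)
  refine this.congr fun p => ?_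
  rw [norm_mul, mul_pow, norm_inner_symm]

theorem HilbertBasis.summable_matrix_mul {ι : Type*} (b : HilbertBasis ι ℂ H) {m : ι × ι → ℂ}
    (hm : Summable fun p => ‖m p‖ ^ 2) (x y : H) :
    Summable fun p : ι × ι => ‖⟪x, b p.1⟫_ℂ * ⟪b p.2, y⟫_ℂ‖ * ‖m p‖ := by
  refine Summable.of_nonneg_of_le (fun p => by positivity) (fun p => ?_)
    ((b.summable_inner_mul_inner_sq x y).add hm)
  nlinarith [sq_nonneg (‖⟪x, b p.1⟫_ℂ * ⟪b p.2, y⟫_ℂ‖ - ‖m p‖),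
    norm_nonneg (⟪x, b p.1⟫_ℂ * ⟪b p.2, y⟫_ℂ), norm_nonneg (m p)]

theorem HilbertBasis.exists_inner_eq {ι : Type*} (b : HilbertBasis ι ℂ H) {c : ι → ℂ}
    (hc : Summable fun i => ‖c i‖ ^ 2) : ∃ x, ∀ i, ⟪b i, x⟫_ℂ = c i := by
  have hmem : Memℓp c 2 := by
    refine memℓp_gen ?_
    simpa using hc
  refine ⟨b.repr.symm ⟨c, hmem⟩, fun i => ?_⟩
  rw [← b.repr_apply_apply, LinearIsometryEquiv.apply_symm_apply]

theorem HilbertBasis.ext_inner {ι : Type*} (b : HilbertBasis ι ℂ H) {x y : H}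
    (h : ∀ i, ⟪b i, x⟫_ℂ = ⟪b i, y⟫_ℂ) : x = y := by
  refine b.repr.injective (Subtype.ext (funext fun i => ?_))
  simpa only [b.repr_apply_apply] using h i

theorem HilbertBasis.tsum_norm_inner_sq {ι : Type*} (b : HilbertBasis ι ℂ H) (x : H) :
    ∑' i, ‖⟪b i, x⟫_ℂ‖ ^ 2 = ‖x‖ ^ 2 := by
  have h := congrArg ENNReal.toReal (b.tsum_enorm_inner_sq x)
  rw [ENNReal.tsum_toReal_eq fun i => ENNReal.pow_ne_top enorm_ne_top] at h
  simpa using h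

/-- The operator has coordinates `⟨r_j, x⟩`, where `r_j` carries the conjugated `j`-th row;
Cauchy-Schwarz bounds it by the Hilbert-Schmidt norm. -/
theorem HilbertBasis.exists_matrix_eq {ι : Type*} (b : HilbertBasis ι ℂ H) {m : ι × ι → ℂ}
    (hm : Summable fun p => ‖m p‖ ^ 2) :
    ∃ T : H →L[ℂ] H, ∀ j k, ⟪b j, T (b k)⟫_ℂ = m (j, k) := by
  have hrow : ∀ j, Summable fun k => ‖(starRingEnd ℂ) (m (j, k))‖ ^ 2 := fun j => by
    simpa using hm.prod_factor j
  choose r hr using fun j => b.exists_inner_eq (hrow j)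
  have hr2 : Summable fun j => ‖r j‖ ^ 2 := by
    refine hm.prod.congr fun j => ?_
    rw [← b.tsum_norm_inner_sq (r j)]
    simp [hr]
  have hle : ∀ x j, ‖⟪r j, x⟫_ℂ‖ ^ 2 ≤ ‖r j‖ ^ 2 * ‖x‖ ^ 2 := fun x j => by
    rw [← mul_pow]
    gcongr
    exact norm_inner_le_norm _ _
  have hsum : ∀ x, Summable fun j => ‖⟪r j, x⟫_ℂ‖ ^ 2 := fun x =>
    Summable.of_nonneg_of_le (fun j => by positivity) (hle x) (hr2.mul_right _)
  choose T hT using fun x => b.exists_inner_eq (hsum x)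
  refine ⟨LinearMap.mkContinuous
    { toFun := T
      map_add' := fun x y => b.ext_inner fun i => by simp [hT]
      map_smul' := fun a x => b.ext_inner fun i => by simp [hT] }
    (Real.sqrt (∑' j, ‖r j‖ ^ 2)) fun x => ?_, fun j k => ?_⟩
  · refine le_of_sq_le_sq ?_ (by positivity)
    rw [mul_pow, Real.sq_sqrt (tsum_nonneg fun j => by positivity)]
    change ‖T x‖ ^ 2 ≤ _
    rw [← b.tsum_norm_inner_sq (T x), ← tsum_mul_right]
    simp only [hT]
    exact (hsum x).tsum_le_tsum (hle x) (hr2.mul_right _)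
  · change ⟪b j, T (b k)⟫_ℂ = _
    rw [hT, ← inner_conj_symm, hr, Complex.conj_conj]

variable [CompleteSpace H]

theorem HilbertBasis.tsum_matrix_eq_inner {ι : Type*} (b : HilbertBasis ι ℂ H) (T : H →L[ℂ] H)
    (hm : Summable fun p : ι × ι => ‖⟪b p.1, T (b p.2)⟫_ℂ‖ ^ 2) (x y : H) :
    HasSum (fun p : ι × ι => ⟪x, b p.1⟫_ℂ * ⟪b p.2, y⟫_ℂ * ⟪b p.1, T (b p.2)⟫_ℂ) ⟪x, T y⟫_ℂ := by
  have hs : Summable fun p : ι × ι => ⟪x, b p.1⟫_ℂ * ⟪b p.2, y⟫_ℂ * ⟪b p.1, T (b p.2)⟫_ℂ := by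
    refine Summable.of_norm ?_
    simpa only [norm_mul] using b.summable_matrix_mul hm x y
  have h1 : ∀ j, HasSum (fun k => ⟪x, b j⟫_ℂ * ⟪b k, y⟫_ℂ * ⟪b j, T (b k)⟫_ℂ)
      (⟪x, b j⟫_ℂ * ⟪b j, T y⟫_ℂ) := by
    intro j
    have := (b.hasSum_inner_mul_inner (ContinuousLinearMap.adjoint T (b j)) y).mul_left ⟪x, b j⟫_ℂ
    simp only [ContinuousLinearMap.adjoint_inner_left] at this
    refine this.congr_fun fun k => ?_
    ring
  have h2 := hs.hasSum.prod_fiberwise h1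
  have h3 := hs.hasSum
  rwa [h2.unique (b.hasSum_inner_mul_inner x (T y))] at h3

end HilbertSchmidt

/-! ### From a bounded commutator with `ρ` to one with `√ρ`. -/

section Commutator

variable {H : Type*} [NormedAddCommGroup H] [InnerProductSpace ℂ H]

/-- `K` extends its adjoint: every vector on which `⟨K ·, u⟩` is represented by `g` lies in the
domain of `K` and is sent to `g`. -/
def ExtendsAdjoint (K : H →ₗ.[ℂ] H) : Prop :=
  ∀ u g : H, (∀ φ : K.domain, ⟪K φ, u⟫_ℂ = ⟪(φ : H), g⟫_ℂ) → ∃ h : u ∈ K.domain, K ⟨u, h⟩ = g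

/-- A bounded commutator forces `A` to preserve the domain of `K`: the form identity says that `A ψ`
lies in the domain of the adjoint, which `K` extends. -/
theorem IsCommutator.exists_apply_eq {K : H →ₗ.[ℂ] H} (hK : ExtendsAdjoint K) {A B : H →L[ℂ] H}
    (h : IsCommutator K A B) (ψ : K.domain) :
    ∃ hA : A ψ ∈ K.domain, K ⟨A ψ, hA⟩ = B ψ + A (K ψ) :=
  hK _ _ fun φ => by rw [inner_add_right, h φ ψ]; ring

/-- The Leibniz rule. Since `A` preserves the domain of `K`, the form identity may be applied with
`A ψ` in place of `ψ`. -/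
theorem IsCommutator.mul_self {K : H →ₗ.[ℂ] H} (hK : ExtendsAdjoint K) {A B : H →L[ℂ] H}
    (h : IsCommutator K A B) : IsCommutator K (A * A) (A * B + B * A) := by
  intro φ ψ
  obtain ⟨hA, hKA⟩ := h.exists_apply_eq hK ψ
  have h1 := h φ ⟨A ψ, hA⟩
  rw [hKA, map_add, inner_add_right] at h1
  simp only [_root_.add_apply, mul_apply_eq_comp, inner_add_right]
  change ⟪(φ : H), B (A ψ)⟫_ℂ = _ at h1
  rw [h1]
  ring

theorem IsCommutator.add {K : H →ₗ.[ℂ] H} {A₁ A₂ B₁ B₂ : H →L[ℂ] H} (h₁ : IsCommutator K A₁ B₁)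
    (h₂ : IsCommutator K A₂ B₂) : IsCommutator K (A₁ + A₂) (B₁ + B₂) := by
  intro φ ψ
  simp only [_root_.add_apply, inner_add_right, h₁ φ ψ, h₂ φ ψ]
  ring

theorem IsCommutator.smul {K : H →ₗ.[ℂ] H} {A B : H →L[ℂ] H} (h : IsCommutator K A B) (c : ℂ) :
    IsCommutator K (c • A) (c • B) := by
  intro φ ψ
  simp only [_root_.smul_apply, inner_smul_right, h φ ψ]
  ring

theorem IsCommutator.zero (K : H →ₗ.[ℂ] H) : IsCommutator K 0 0 := by
  intro φ ψ
  simp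

/-- The operators `visser ρ n`. -/
noncomputable def visserOp (ρ : H →L[ℂ] H) : ℕ → H →L[ℂ] H
  | 0 => 0
  | n + 1 => visserOp ρ n + ((1 / 2 : ℂ) • ρ + (-1 / 2 : ℂ) • (visserOp ρ n * visserOp ρ n))

/-- The commutators with `visserOp ρ n`, when `C` is the commutator with `ρ`. -/
noncomputable def visserCommutator (ρ C : H →L[ℂ] H) : ℕ → H →L[ℂ] H
  | 0 => 0
  | n + 1 => visserCommutator ρ C n + ((1 / 2 : ℂ) • C + (-1 / 2 : ℂ) •
      (visserOp ρ n * visserCommutator ρ C n + visserCommutator ρ C n * visserOp ρ n))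

theorem IsCommutator.visser {K : H →ₗ.[ℂ] H} (hK : ExtendsAdjoint K) {ρ C : H →L[ℂ] H}
    (h : IsCommutator K ρ C) (n : ℕ) :
    IsCommutator K (visserOp ρ n) (visserCommutator ρ C n) := by
  induction n with
  | zero => exact IsCommutator.zero K
  | succ n ih => exact ih.add ((h.smul _).add ((ih.mul_self hK).smul _))

theorem visserOp_apply {ρ : H →L[ℂ] H} {x : H} {μ : ℝ} (h : ρ x = (μ : ℂ) • x) (n : ℕ) :
    visserOp ρ n x = (visser μ n : ℂ) • x := by
  induction n with
  | zero => simp [visserOp, _root_.visser]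
  | succ n ih =>
    simp only [visserOp, _root_.visser, _root_.add_apply, _root_.smul_apply, mul_apply_eq_comp, ih,
      map_smul, h]
    push_cast
    module

theorem inner_visserOp_apply {ρ : H →L[ℂ] H} (hρ : ∀ x y, ⟪ρ x, y⟫_ℂ = ⟪x, ρ y⟫_ℂ) (n : ℕ) (x y : H) :
    ⟪visserOp ρ n x, y⟫_ℂ = ⟪x, visserOp ρ n y⟫_ℂ := by
  induction n generalizing x y with
  | zero => simp [visserOp]
  | succ n ih =>
    simp [visserOp, ih, hρ]
    ring

/-- Between eigenvectors, the factors `visserOp ρ n` in the Leibniz rule become scalars, and the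
recursion becomes that of the divided differences. -/
theorem inner_visserCommutator {ρ C : H →L[ℂ] H} (hρ : ∀ x y, ⟪ρ x, y⟫_ℂ = ⟪x, ρ y⟫_ℂ)
    {x y : H} {μ ν : ℝ} (hx : ρ x = (μ : ℂ) • x) (hy : ρ y = (ν : ℂ) • y) (n : ℕ) :
    ⟪x, visserCommutator ρ C n y⟫_ℂ = visserDiff μ ν n * ⟪x, C y⟫_ℂ := by
  induction n with
  | zero => simp [visserCommutator, visserDiff]
  | succ n ih =>
    simp only [visserCommutator, visserDiff, _root_.add_apply, _root_.smul_apply, mul_apply_eq_comp,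
      inner_add_right, inner_smul_right, visserOp_apply hy, map_smul,
      ← inner_visserOp_apply hρ n x, visserOp_apply hx, inner_smul_left, ih, Complex.conj_ofReal]
    push_cast
    ring

variable [CompleteSpace H]

/-- In the identity for `[K, q_n(ρ)]` both sides pass to the limit. The matrix of the left side is
`d_n(l_j², l_k²) (l_j + l_k) M_jk`, which tends to `M_jk` and is at most `2 |M_jk|`. The condition
on `M` at `l_j + l_k = 0` settles the entries where `C` carries no information. -/
theorem exists_isCommutator_sqrt {ι : Type*} (b : HilbertBasis ι ℂ H) {K : H →ₗ.[ℂ] H}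
    (hK : ExtendsAdjoint K) {ρ A C : H →L[ℂ] H} (hρ : ∀ x y, ⟪ρ x, y⟫_ℂ = ⟪x, ρ y⟫_ℂ)
    (hA : ∀ x y, ⟪A x, y⟫_ℂ = ⟪x, A y⟫_ℂ) {l : ι → ℝ} (h0 : ∀ i, 0 ≤ l i) (h1 : ∀ i, l i ≤ 1)
    (hl : ∀ i, ρ (b i) = ((l i ^ 2 : ℝ) : ℂ) • b i) (hAl : ∀ i, A (b i) = (l i : ℂ) • b i)
    (hC : IsCommutator K ρ C) {M : ι × ι → ℂ} (hM : Summable fun p => ‖M p‖ ^ 2)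
    (hCM : ∀ j k, ⟪b j, C (b k)⟫_ℂ = (l j + l k : ℝ) * M (j, k))
    (hM0 : ∀ j k, l j + l k = 0 → M (j, k) = 0) :
    ∃ B : H →L[ℂ] H, IsCommutator K A B ∧ ∀ j k, ⟪b j, B (b k)⟫_ℂ = M (j, k) := by
  obtain ⟨B, hB⟩ := b.exists_matrix_eq hM
  refine ⟨B, fun φ ψ => ?_, hB⟩
  have hD : ∀ n j k, ⟪b j, visserCommutator ρ C n (b k)⟫_ℂ
      = (visserDiff (l j ^ 2) (l k ^ 2) n * (l j + l k) : ℝ) * M (j, k) := fun n j k => by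
    rw [inner_visserCommutator hρ (hl j) (hl k), hCM]
    push_cast
    ring
  have hbd : ∀ n j k, ‖⟪b j, visserCommutator ρ C n (b k)⟫_ℂ‖ ≤ 2 * ‖M (j, k)‖ := fun n j k => by
    obtain ⟨e1, e2, e3⟩ := visserDiff_mem (h0 j) (h1 j) (h0 k) (h1 k) n
    rw [hD, norm_mul, Complex.norm_real, Real.norm_eq_abs, abs_of_nonneg
      (mul_nonneg e1 (add_nonneg (h0 j) (h0 k)))]
    gcongr
    linarith
  have hsum : ∀ n, Summable fun p : ι × ι => ‖⟪b p.1, visserCommutator ρ C n (b p.2)⟫_ℂ‖ ^ 2 := by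
    intro n
    refine Summable.of_nonneg_of_le (fun p => by positivity) (fun p => ?_) (hM.mul_left 4)
    have := pow_le_pow_left₀ (norm_nonneg _) (hbd n p.1 p.2) 2
    linarith
  have hlim1 : Filter.Tendsto (fun n => ⟪(φ : H), visserCommutator ρ C n ψ⟫_ℂ) Filter.atTop
      (nhds ⟪(φ : H), B ψ⟫_ℂ) := by
    have e1 := fun n => (b.tsum_matrix_eq_inner _ (hsum n) (φ : H) ψ).tsum_eq
    have e2 := (b.tsum_matrix_eq_inner B (by simpa only [hB] using hM) (φ : H) ψ).tsum_eq
    rw [← e2]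
    simp only [← e1]
    -- Dominated convergence for the double series `∑ ⟨φ, b_j⟩ ⟨b_k, ψ⟩ M_jk`, absolutely summable
    -- as a product of square-summable families.
    refine tendsto_tsum_of_dominated_convergence
      ((b.summable_matrix_mul hM (φ : H) ψ).mul_left 2) (fun p => ?_)
      (Filter.Eventually.of_forall fun n p => ?_)
    · refine Filter.Tendsto.const_mul _ ?_
      simp only [hD, hB]
      rcases (add_nonneg (h0 p.1) (h0 p.2)).eq_or_lt with h | h
      · rw [hM0 _ _ h.symm]; simp
      · have := (tendsto_visserDiff (h0 p.1) (h1 p.1) (h0 p.2) (h1 p.2) h).mul_const (l p.1 + l p.2)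
        rw [one_div, inv_mul_cancel₀ h.ne'] at this
        simpa using ((Complex.continuous_ofReal.tendsto _).comp this).mul_const (M (p.1, p.2))
    · rw [norm_mul]
      calc _ ≤ ‖⟪(φ : H), b p.1⟫_ℂ * ⟪b p.2, (ψ : H)⟫_ℂ‖ * (2 * ‖M p‖) := by
            gcongr
            exact hbd n p.1 p.2
        _ = _ := by ring
  have hlim2 : ∀ x y : H, Filter.Tendsto (fun n => ⟪x, visserOp ρ n y⟫_ℂ) Filter.atTop
      (nhds ⟪x, A y⟫_ℂ) := by
    intro x y
    have e1 := fun n => (b.hasSum_inner_mul_inner x (visserOp ρ n y)).tsum_eq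
    have e2 := (b.hasSum_inner_mul_inner x (A y)).tsum_eq
    rw [← e2]
    simp only [← e1]
    simp only [← hA, ← inner_visserOp_apply hρ, hAl, visserOp_apply (hl _), inner_smul_left,
      Complex.conj_ofReal]
    refine tendsto_tsum_of_dominated_convergence (b.summable_inner_mul_inner x y).norm
      (fun i => ?_) (Filter.Eventually.of_forall fun n i => ?_)
    · exact (((Complex.continuous_ofReal.tendsto _).comp
        (tendsto_visser (h0 i) (h1 i))).mul_const _).const_mul _
    · obtain ⟨e1, e2⟩ := visser_mem (h0 i) (h1 i) n
      rw [norm_mul, norm_mul, norm_mul, Complex.norm_real, Real.norm_eq_abs, abs_of_nonneg e1]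
      gcongr
      exact mul_le_of_le_one_left (norm_nonneg _) (e2.trans (h1 i))
  refine tendsto_nhds_unique hlim1 ?_
  simp only [fun n => hC.visser hK n φ ψ]
  exact (hlim2 _ _).sub (hlim2 _ _)

end Commutator

/-! ### Skew information is at most a quarter of the SLD information. -/

section Information

universe u

variable {H : Type u} [NormedAddCommGroup H] [InnerProductSpace ℂ H] [CompleteSpace H]

theorem inner_sqrt_apply (ρ : H →L[ℂ] H) (x y : H) :
    ⟪CFC.sqrt ρ x, y⟫_ℂ = ⟪x, CFC.sqrt ρ y⟫_ℂ := by
  conv_rhs => rw [← (IsSelfAdjoint.of_nonneg (CFC.sqrt_nonneg ρ)).adjoint_eq]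
  rw [ContinuousLinearMap.adjoint_inner_right]

theorem IsDensityOperator.exists_eigenbasis {ρ : H →L[ℂ] H} (hρ : IsDensityOperator ρ) :
    ∃ (ι : Type u) (b : HilbertBasis ι ℂ H) (l : ι → ℝ), (∀ i, 0 ≤ l i) ∧
      ∑' i, ‖l i‖ₑ ^ 2 = 1 ∧ (∀ i, ρ (b i) = ((l i ^ 2 : ℝ) : ℂ) • b i) ∧
      ∀ i, CFC.sqrt ρ (b i) = (l i : ℂ) • b i := by
  have h0 : 0 ≤ ρ := (ContinuousLinearMap.nonneg_iff_isPositive ρ).2 hρ.isPositive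
  obtain ⟨ι, b, μ, hμ, hb⟩ := exists_hilbertBasis_eigenvectors hρ.isPositive hρ.isCompact
  have hs : ∀ i, CFC.sqrt ρ (b i) = ((Real.sqrt (μ i) : ℝ) : ℂ) • b i := fun i => by
    rw [CFC.sqrt_eq_rpow, rpow_apply_of_eigenvector h0 (hb i) (by norm_num), Real.sqrt_eq_rpow]
  refine ⟨ι, b, fun i => Real.sqrt (μ i), fun i => Real.sqrt_nonneg _, ?_, fun i => ?_, hs⟩
  · have hadj : ContinuousLinearMap.adjoint (CFC.sqrt ρ) = CFC.sqrt ρ :=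
      (IsSelfAdjoint.of_nonneg (CFC.sqrt_nonneg ρ)).adjoint_eq
    have h1 := opTrace_adjoint_comp_eq_tsum_apply b (CFC.sqrt ρ)
    rw [hadj, show CFC.sqrt ρ ∘L CFC.sqrt ρ = ρ from CFC.sqrt_mul_sqrt_self ρ h0,
      hρ.trace_eq_one] at h1
    rw [h1]
    refine tsum_congr fun i => ?_
    rw [hs, enorm_smul, ← ofReal_norm (b i), b.orthonormal.1 i, ENNReal.ofReal_one, mul_one,
      ← ofReal_norm, ← ofReal_norm, Complex.norm_real]
  · rw [Real.sq_sqrt (hμ i), hb]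

theorem le_one_of_tsum_sq_eq_one {ι : Type*} {l : ι → ℝ} (h : ∑' i, ‖l i‖ₑ ^ 2 = 1) (i : ι) :
    l i ≤ 1 := by
  have h1 : ‖l i‖ₑ ^ 2 ≤ 1 := h ▸ ENNReal.le_tsum i
  have h2 : ‖l i‖ₑ ≤ 1 := by
    by_contra! h3
    exact absurd h1 (not_le.2 (one_lt_pow₀ h3 two_ne_zero))
  rw [← ofReal_norm, ENNReal.ofReal_le_one] at h2
  exact (le_abs_self _).trans h2

/-- Cauchy-Schwarz with `s² + t² ≤ (s + t)²`. For `s = t = 0` the quotient is zero by convention. -/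
theorem enorm_sq_le_of_eq_div {x y : ℂ} {s t : ℝ} (hs : 0 ≤ s) (ht : 0 ≤ t) {c : ℂ}
    (hc : (1 / 2 : ℂ) * (t * x + s * y) = (1 / Complex.I) * c) :
    ‖c / (s + t : ℝ)‖ ^ 2 ≤ 4⁻¹ * (‖x‖ ^ 2 + ‖y‖ ^ 2) := by
  have h1 : ‖c‖ ≤ 2⁻¹ * (t * ‖x‖ + s * ‖y‖) := by
    have h2 := congrArg norm hc
    rw [norm_mul, norm_mul] at h2
    have h3 : ‖(t * x + s * y : ℂ)‖ ≤ t * ‖x‖ + s * ‖y‖ := by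
      refine (norm_add_le _ _).trans (le_of_eq ?_)
      simp [abs_of_nonneg hs, abs_of_nonneg ht]
    have h4 : ‖c‖ = 2⁻¹ * ‖(t * x + s * y : ℂ)‖ := by simpa using h2.symm
    rw [h4]
    gcongr
  rw [norm_div, Complex.norm_real, Real.norm_eq_abs, div_pow, sq_abs]
  rcases (add_nonneg hs ht).eq_or_lt with h | h
  · rw [← h]
    simp only [ne_eq, OfNat.ofNat_ne_zero, not_false_eq_true, zero_pow, div_zero]
    positivity
  · rw [div_le_iff₀ (by positivity)]
    have h5 := pow_le_pow_left₀ (norm_nonneg _) h1 2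
    have h6 : (t * ‖x‖ + s * ‖y‖) ^ 2 ≤ (s + t) ^ 2 * (‖x‖ ^ 2 + ‖y‖ ^ 2) := by
      have : 0 ≤ s * t * (‖x‖ ^ 2 + ‖y‖ ^ 2) := by positivity
      nlinarith [sq_nonneg (t * ‖y‖ - s * ‖x‖)]
    nlinarith

theorem skewInformation_le_sldInformation {K : H →ₗ.[ℂ] H} (hK : ExtendsAdjoint K)
    {ρ : H →L[ℂ] H} (hρ : IsDensityOperator ρ) :
    skewInformation K ρ ≤ 4⁻¹ * sldInformation K ρ := by
  have h4 : (4⁻¹ : ℝ≥0∞) ≠ ⊤ := by simp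
  rw [sldInformation]
  simp only [ENNReal.mul_iInf_of_ne (show (4⁻¹ : ℝ≥0∞) ≠ 0 by simp) h4]
  refine le_iInf fun L => le_iInf fun X => le_iInf fun hX => ?_
  obtain ⟨ι, b, l, h0, h1, hl, hA⟩ := hρ.exists_eigenbasis
  set A := CFC.sqrt ρ with hAdef
  rw [opTrace_adjoint_comp_eq b X]
  by_cases htop : ∑' j, ∑' k, ‖⟪b j, X (b k)⟫_ℂ‖ₑ ^ 2 = ⊤
  · rw [htop, ENNReal.mul_top (by simp)]
    exact le_top
  have hsumX : Summable fun p : ι × ι => ‖⟪b p.1, X (b p.2)⟫_ℂ‖ ^ 2 := by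
    rw [← tsum_enorm_sq_ne_top_iff, ENNReal.tsum_prod (f := fun j k => ‖⟪b j, X (b k)⟫_ℂ‖ₑ ^ 2)]
    exact htop
  obtain ⟨C, hC, heq⟩ := hX.equation
  have hAsymm : ∀ x y, ⟪A x, y⟫_ℂ = ⟪x, A y⟫_ℂ := inner_sqrt_apply ρ
  have hmat : ∀ j k, (1 / 2 : ℂ) * (l k * ⟪b j, X (b k)⟫_ℂ + l j * (starRingEnd ℂ) ⟪b k, X (b j)⟫_ℂ)
      = (1 / Complex.I) * ⟪b j, C (b k)⟫_ℂ := fun j k => by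
    have := congrArg (fun T : H →L[ℂ] H => ⟪b j, T (b k)⟫_ℂ) heq
    simp only [_root_.smul_apply, _root_.add_apply, inner_smul_right, inner_add_right,
      ContinuousLinearMap.adjoint_inner_right, ContinuousLinearMap.comp_apply, ← hAdef, hA,
      map_smul, inner_smul_left, Complex.conj_ofReal] at this
    rw [inner_conj_symm]
    exact this
  -- The candidate for the matrix of `[K, √ρ]`, obtained by solving `√ρ B + B √ρ = C` entrywise.
  -- Where `l_j = l_k = 0`, `C_jk` vanishes by the SLD equation and the convention for division sets
  -- `M_jk = 0`.
  set M : ι × ι → ℂ := fun p => ⟪b p.1, C (b p.2)⟫_ℂ / (l p.1 + l p.2 : ℝ) with hM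
  have hMle : ∀ j k, ‖M (j, k)‖ ^ 2
      ≤ 4⁻¹ * (‖⟪b j, X (b k)⟫_ℂ‖ ^ 2 + ‖⟪b k, X (b j)⟫_ℂ‖ ^ 2) := fun j k => by
    have := enorm_sq_le_of_eq_div (h0 j) (h0 k) (hmat j k)
    rwa [RCLike.norm_conj] at this
  have hMsum : Summable fun p => ‖M p‖ ^ 2 :=
    Summable.of_nonneg_of_le (fun p => by positivity) (fun p => hMle p.1 p.2)
      ((hsumX.add ((Equiv.prodComm ι ι).summable_iff.2 hsumX)).mul_left _)
  obtain ⟨B, hB, hBM⟩ := exists_isCommutator_sqrt b hK (A := A) (C := C)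
    (fun x y => hρ.isPositive.isSymmetric x y) hAsymm h0 (le_one_of_tsum_sq_eq_one h1) hl hA hC
    hMsum (fun j k => by
      rcases eq_or_ne (l j + l k) 0 with h | h
      · have hj : l j = 0 := by linarith [h0 j, h0 k]
        have hk : l k = 0 := by linarith [h0 j, h0 k]
        have := hmat j k
        simp only [hj, hk] at this ⊢
        simpa using this
      · rw [hM]
        field_simp
        rw [mul_div_cancel_right₀]
        exact_mod_cast h) (fun j k h => by rw [hM]; simp only [h]; simp)
  refine (iInf₂_le B hB).trans ?_
  rw [opTrace_adjoint_comp_eq b B]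
  simp only [hBM]
  have hle : ∀ j k, ‖M (j, k)‖ₑ ^ 2
      ≤ 4⁻¹ * (‖⟪b j, X (b k)⟫_ℂ‖ₑ ^ 2 + ‖⟪b k, X (b j)⟫_ℂ‖ₑ ^ 2) := fun j k => by
    have := ENNReal.ofReal_le_ofReal (hMle j k)
    rw [ENNReal.ofReal_mul (by norm_num), ENNReal.ofReal_add (by positivity) (by positivity)] at this
    simp only [ENNReal.ofReal_pow (norm_nonneg _), ofReal_norm] at this
    rwa [ENNReal.ofReal_inv_of_pos (by norm_num), ENNReal.ofReal_ofNat] at this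
  calc 2⁻¹ * ∑' j, ∑' k, ‖M (j, k)‖ₑ ^ 2
      ≤ 2⁻¹ * ∑' j, ∑' k, 4⁻¹ * (‖⟪b j, X (b k)⟫_ℂ‖ₑ ^ 2 + ‖⟪b k, X (b j)⟫_ℂ‖ₑ ^ 2) := by
        gcongr with j k
        exact hle j k
    _ = 2⁻¹ * (4⁻¹ * (∑' j, ∑' k, ‖⟪b j, X (b k)⟫_ℂ‖ₑ ^ 2
          + ∑' j, ∑' k, ‖⟪b j, X (b k)⟫_ℂ‖ₑ ^ 2)) := by
        simp only [ENNReal.tsum_mul_left, ENNReal.tsum_add]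
        rw [ENNReal.tsum_comm (f := fun j k => ‖⟪b k, X (b j)⟫_ℂ‖ₑ ^ 2)]
    _ = _ := by
        rw [← two_mul, mul_left_comm 4⁻¹, ← mul_assoc, ENNReal.inv_mul_cancel (by simp) (by simp),
          one_mul]

end Information

/-! ### Complex interpolation for bounded orthonormal systems. -/

section Interpolation

open Complex.HadamardThreeLines

variable {Ω : Type*} [MeasurableSpace Ω] {μ : Measure Ω}

theorem norm_cexp_mul_ofReal_le_one {z : ℂ} {x : ℝ} (hz : 0 ≤ z.re) (hx : x ≤ 0) :
    ‖Complex.exp (z * x)‖ ≤ 1 := by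
  rw [Complex.norm_exp, Complex.re_mul_ofReal, Real.exp_le_one_iff]
  exact mul_nonpos_of_nonneg_of_nonpos hz hx

theorem diffContOnCl_integral_mul_cexp {g : Ω → ℂ} (hg : Integrable g μ) {L : Ω → ℝ}
    (hL : Measurable L) (hL0 : ∀ x, L x ≤ 0) :
    DiffContOnCl ℂ (fun z : ℂ => ∫ x, g x * Complex.exp (z * L x) ∂μ) (verticalStrip 0 1) := by
  have hmeas : ∀ z : ℂ, AEStronglyMeasurable (fun x => g x * Complex.exp (z * L x)) μ := fun z =>
    hg.1.mul (Measurable.aestronglyMeasurable (by fun_prop))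
  have hbd : ∀ z : ℂ, 0 ≤ z.re → ∀ x, ‖g x * Complex.exp (z * L x)‖ ≤ ‖g x‖ := fun z hz x => by
    rw [norm_mul]
    exact mul_le_of_le_one_right (norm_nonneg _) (norm_cexp_mul_ofReal_le_one hz (hL0 x))
  constructor
  · intro z hz
    refine DifferentiableAt.differentiableWithinAt ?_
    have hz0 : 0 < z.re := hz.1
    -- On this half-plane `|L| exp(Re w · L) ≤ 2 / Re z`, because `t e^{-t} ≤ 1`; this allows
    -- differentiation under the integral although `L` may be unbounded below.
    have hs : {w : ℂ | z.re / 2 < w.re} ∈ nhds z :=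
      (isOpen_lt continuous_const Complex.continuous_re).mem_nhds (by simpa using hz0)
    refine (hasDerivAt_integral_of_dominated_loc_of_deriv_le (μ := μ)
      (F' := fun w x => g x * (L x * Complex.exp (w * L x)))
      (bound := fun x => ‖g x‖ * (2 / z.re)) hs
      (Filter.Eventually.of_forall hmeas) ?_ ?_ (ae_of_all _ fun x w hw => ?_)
      (hg.norm.mul_const _) (ae_of_all _ fun x w hw => ?_)).2.differentiableAt
    · exact hg.mono (hmeas z) (ae_of_all _ (hbd z hz0.le))
    · exact hg.1.mul (Measurable.aestronglyMeasurable (by fun_prop))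
    · rw [norm_mul, norm_mul, Complex.norm_exp, Complex.re_mul_ofReal, Complex.norm_real,
        Real.norm_eq_abs, abs_of_nonpos (hL0 x)]
      gcongr
      have hw' : z.re / 2 < w.re := hw
      have h1 : Real.exp (w.re * L x) ≤ Real.exp (z.re / 2 * L x) := by
        rw [Real.exp_le_exp]
        nlinarith [hL0 x]
      have h2 := Real.mul_exp_neg_le_exp_neg_one (-(z.re / 2 * L x))
      have h3 : Real.exp (-1) ≤ 1 := by simp
      rw [neg_neg] at h2
      rw [le_div_iff₀ hz0]
      nlinarith [mul_le_mul_of_nonneg_left h1 (neg_nonneg.2 (hL0 x))]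
    · have h1 : HasDerivAt (fun w : ℂ => w * (L x : ℂ)) (L x) w := by
        simpa using (hasDerivAt_id w).mul_const (L x : ℂ)
      simpa [mul_comm] using (h1.cexp).const_mul (g x)
  · have hcl : closure (verticalStrip 0 1) ⊆ {z : ℂ | 0 ≤ z.re} :=
      closure_minimal (fun z hz => hz.1.le) (isClosed_le continuous_const Complex.continuous_re)
    refine ContinuousOn.mono ?_ hcl
    refine continuousOn_of_dominated (bound := fun x => ‖g x‖) (fun z _ => hmeas z)
      (fun z hz => ae_of_all _ (hbd z hz)) hg.norm (ae_of_all _ fun x => ?_)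
    fun_prop

/-- Hölder-type interpolation for a bounded orthonormal system: the weighted dual form of
F. Riesz's extension of the Hausdorff-Young inequality. -/
theorem integral_sq_mul_exp_le_of_orthonormal {ι : Type*} {F : Finset ι} {φ : ι → Ω → ℂ}
    (hφ : ∀ j, AEStronglyMeasurable (φ j) μ) (hφ1 : ∀ j x, ‖φ j x‖ ≤ 1)
    (hφF : ∀ c : ι → ℂ, ∫⁻ x, ‖∑ j ∈ F, c j * φ j x‖ₑ ^ 2 ∂μ = ∑ j ∈ F, ‖c j‖ₑ ^ 2)
    {L : Ω → ℝ} (hL : Measurable L) (hL0 : ∀ x, L x ≤ 0)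
    (hLi : Integrable (fun x => Real.exp (L x)) μ) {s : ℝ} (hs0 : 0 < s) (hs1 : s < 1)
    {c : ι → ℝ} (hc : ∀ j ∈ F, 0 < c j) :
    ∫ x, ‖∑ j ∈ F, (c j : ℂ) * φ j x‖ ^ 2 * Real.exp (s * L x) ∂μ
      ≤ (∫ x, Real.exp (L x) ∂μ) ^ s * (∑ j ∈ F, c j ^ (2 / (1 + s))) ^ (1 + s) := by
  classical
  set r := 2 / (1 + s) with hr
  have hr0 : 0 < r := by positivity
  -- The analytic family `c_j^{r(1+z)/2}`: its modulus is `c_j^{r/2}` on `Re z = 0`, `c_j^r` on `Re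
  -- z = 1`, and it equals `c_j` at `z = s`.
  set e : ι → ℂ → ℂ := fun j z => Complex.exp ((r / 2 * (1 + z)) * Real.log (c j)) with he
  have hLp : ∀ d : ι → ℂ, MemLp (fun x => ∑ j ∈ F, d j * φ j x) 2 μ := fun d => by
    refine ⟨by fun_prop, ?_⟩
    rw [eLpNorm_lt_top_iff_lintegral_rpow_enorm_lt_top two_ne_zero ENNReal.ofNat_ne_top]
    simp only [ENNReal.toReal_ofNat, ENNReal.rpow_ofNat, hφF]
    exact ENNReal.sum_lt_top.2 fun j _ => ENNReal.pow_lt_top enorm_lt_top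
  have hint : ∀ d : ι → ℂ, ∫ x, ‖∑ j ∈ F, d j * φ j x‖ ^ 2 ∂μ = ∑ j ∈ F, ‖d j‖ ^ 2 := fun d => by
    rw [integral_eq_lintegral_of_nonneg_ae (ae_of_all _ fun x => by positivity)
      (show AEStronglyMeasurable (fun x => ‖∑ j ∈ F, d j * φ j x‖ ^ 2) μ from
        (hLp d).1.norm.pow 2)]
    simp only [ENNReal.ofReal_pow (norm_nonneg _), ofReal_norm, hφF]
    rw [ENNReal.toReal_sum fun j _ => ENNReal.pow_ne_top enorm_ne_top]
    simp
  have hLp' : ∀ j ∈ F, MemLp (φ j) 2 μ := fun j hj => by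
    have := hLp (Pi.single j 1)
    refine this.ae_eq (ae_of_all _ fun x => ?_)
    simp [Pi.single_apply, hj]
  have hconj : ∀ z x, (starRingEnd ℂ) (∑ k ∈ F, (starRingEnd ℂ) (e k z) * φ k x)
      = ∑ k ∈ F, e k z * (starRingEnd ℂ) (φ k x) := fun z x => by simp
  -- An analytic extension of the quadratic expression: only `φ_k` is conjugated, not `e_k`. On `Re
  -- z = 0` orthonormality gives `|Q| ≤ ∑ c_j^r`; on `Re z = 1` the bound `|φ_j| ≤ 1` gives `|Q| ≤
  -- (∑ c_j^r)² ∫ e^L`.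
  set Q : ℂ → ℂ := fun z => ∑ j ∈ F, ∑ k ∈ F, e j z * e k z *
    ∫ x, φ j x * (starRingEnd ℂ) (φ k x) * Complex.exp (z * L x) ∂μ with hQ
  have hgint : ∀ j ∈ F, ∀ k ∈ F, Integrable (fun x => φ j x * (starRingEnd ℂ) (φ k x)) μ :=
    fun j hj k hk => (hLp' j hj).integrable_mul (hLp' k hk).star
  have hQint : ∀ z : ℂ, 0 ≤ z.re → Q z = ∫ x, (∑ j ∈ F, e j z * φ j x) *
      (starRingEnd ℂ) (∑ k ∈ F, (starRingEnd ℂ) (e k z) * φ k x) * Complex.exp (z * L x) ∂μ := by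
    intro z hz
    have hi : ∀ j ∈ F, ∀ k ∈ F, Integrable (fun x => e j z * e k z *
        (φ j x * (starRingEnd ℂ) (φ k x) * Complex.exp (z * L x))) μ := fun j hj k hk => by
      refine Integrable.const_mul ?_ _
      refine (hgint j hj k hk).mono
        ((hgint j hj k hk).1.mul (Measurable.aestronglyMeasurable (by fun_prop)))
        (ae_of_all _ fun x => ?_)
      rw [norm_mul]
      exact mul_le_of_le_one_right (norm_nonneg _) (norm_cexp_mul_ofReal_le_one hz (hL0 x))
    simp only [hQ, ← integral_const_mul]
    rw [show (fun x => (∑ j ∈ F, e j z * φ j x) *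
      (starRingEnd ℂ) (∑ k ∈ F, (starRingEnd ℂ) (e k z) * φ k x) * Complex.exp (z * L x))
      = fun x => ∑ j ∈ F, ∑ k ∈ F, e j z * e k z *
        (φ j x * (starRingEnd ℂ) (φ k x) * Complex.exp (z * L x)) from funext fun x => by
        rw [hconj, Finset.sum_mul_sum, Finset.sum_mul]
        refine Finset.sum_congr rfl fun j _ => ?_
        rw [Finset.sum_mul]
        refine Finset.sum_congr rfl fun k _ => ?_
        ring]
    rw [integral_finsetSum _ fun j hj => integrable_finsetSum _ fun k hk => hi j hj k hk]
    refine Finset.sum_congr rfl fun j hj => ?_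
    rw [integral_finsetSum _ fun k hk => hi j hj k hk]
  have hnorm : ∀ j ∈ F, ∀ z, ‖e j z‖ = c j ^ (r / 2 * (1 + z.re)) := fun j hj z => by
    rw [he, Complex.norm_exp, Real.rpow_def_of_pos (hc j hj)]
    congr 1
    rw [Complex.re_mul_ofReal, mul_comm]
    congr 1
    rw [show (r / 2 : ℂ) = ((r / 2 : ℝ) : ℂ) by push_cast; rfl, Complex.re_ofReal_mul]
    simp
  have hbound : ∀ z : ℂ, 0 ≤ z.re → ‖Q z‖ ≤ ∑ j ∈ F, ‖e j z‖ ^ 2 := by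
    intro z hz
    rw [hQint z hz]
    have h1 := hint fun j => e j z
    have h2 := hint fun j => (starRingEnd ℂ) (e j z)
    simp only [RCLike.norm_conj] at h2
    calc _ ≤ ∫ x, (2⁻¹ * ‖∑ j ∈ F, e j z * φ j x‖ ^ 2
            + 2⁻¹ * ‖∑ k ∈ F, (starRingEnd ℂ) (e k z) * φ k x‖ ^ 2) ∂μ := by
          refine norm_integral_le_of_norm_le ?_ (ae_of_all _ fun x => ?_)
          · exact ((hLp _).integrable_norm_pow two_ne_zero |>.const_mul _).add
              ((hLp _).integrable_norm_pow two_ne_zero |>.const_mul _)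
          · rw [norm_mul, norm_mul, RCLike.norm_conj]
            refine (mul_le_of_le_one_right (by positivity)
              (norm_cexp_mul_ofReal_le_one hz (hL0 x))).trans ?_
            nlinarith [sq_nonneg (‖∑ j ∈ F, e j z * φ j x‖
              - ‖∑ k ∈ F, (starRingEnd ℂ) (e k z) * φ k x‖)]
      _ = _ := by
          rw [integral_add ((hLp _).integrable_norm_pow two_ne_zero |>.const_mul _)
            ((hLp _).integrable_norm_pow two_ne_zero |>.const_mul _), integral_const_mul,
            integral_const_mul, h1, h2]
          ring
  have hbound0 : ∀ z : ℂ, z.re = 0 → ‖Q z‖ ≤ ∑ j ∈ F, c j ^ r := fun z hz => by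
    refine (hbound z hz.ge).trans (le_of_eq (Finset.sum_congr rfl fun j hj => ?_))
    rw [hnorm j hj, hz, ← Real.rpow_mul_natCast (hc j hj).le]
    congr 1
    push_cast
    ring
  have hbound1 : ∀ z : ℂ, z.re = 1 →
      ‖Q z‖ ≤ (∑ j ∈ F, c j ^ r) ^ 2 * ∫ x, Real.exp (L x) ∂μ := fun z hz => by
    rw [hQint z (by rw [hz]; norm_num), ← integral_const_mul]
    refine norm_integral_le_of_norm_le (hLi.const_mul _) (ae_of_all _ fun x => ?_)
    have hle : ∀ d : ι → ℂ, (∀ j, ‖d j‖ = ‖e j z‖) →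
        ‖∑ j ∈ F, d j * φ j x‖ ≤ ∑ j ∈ F, c j ^ r := fun d hd => by
      refine (norm_sum_le _ _).trans (Finset.sum_le_sum fun j hj => ?_)
      rw [norm_mul, hd, hnorm j hj, hz]
      refine (mul_le_of_le_one_right (by have := hc j hj; positivity) (hφ1 j x)).trans (le_of_eq ?_)
      congr 1
      ring
    rw [norm_mul, norm_mul, RCLike.norm_conj, Complex.norm_exp, Complex.re_mul_ofReal, hz, one_mul,
      sq]
    gcongr
    · exact Finset.sum_nonneg fun j hj => by have := hc j hj; positivity
    · exact hle _ fun j => rfl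
    · exact hle _ fun j => RCLike.norm_conj _
  have hdiff : DiffContOnCl ℂ Q (verticalStrip 0 1) := by
    have hterm : ∀ j ∈ F, ∀ k ∈ F, DiffContOnCl ℂ (fun z => e j z * e k z *
        ∫ x, φ j x * (starRingEnd ℂ) (φ k x) * Complex.exp (z * L x) ∂μ) (verticalStrip 0 1) :=
      fun j hj k hk => by
        have h1 := diffContOnCl_integral_mul_cexp (hgint j hj k hk) hL hL0
        have h2 : DiffContOnCl ℂ (fun z => e j z * e k z) (verticalStrip 0 1) :=
          Differentiable.diffContOnCl (by simp only [he]; fun_prop)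
        exact h2.smul h1
    rw [hQ]
    constructor
    · exact DifferentiableOn.fun_sum fun j hj => DifferentiableOn.fun_sum fun k hk =>
        (hterm j hj k hk).1
    · exact continuousOn_finsetSum _ fun j hj => continuousOn_finsetSum _ fun k hk =>
        (hterm j hj k hk).2
  have hBdd : BddAbove ((norm ∘ Q) '' verticalClosedStrip 0 1) := by
    refine ⟨∑ j ∈ F, (Real.exp (r * |Real.log (c j)|)) ^ 2, ?_⟩
    rintro _ ⟨z, hz, rfl⟩
    refine (hbound z hz.1).trans (Finset.sum_le_sum fun j hj => ?_)
    rw [hnorm j hj, Real.rpow_def_of_pos (hc j hj)]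
    refine pow_le_pow_left₀ (Real.exp_pos _).le (Real.exp_le_exp.2 ?_) 2
    have h1 : r / 2 * (1 + z.re) ≤ r := by nlinarith [hz.2]
    have h2 : 0 ≤ r / 2 * (1 + z.re) := by have := hz.1; positivity
    nlinarith [le_abs_self (Real.log (c j)), abs_nonneg (Real.log (c j))]
  -- The three lines theorem at `z = s`; the powers of `∑ c_j^r` combine to `(1 - s) + 2s = 1 + s`.
  have key := norm_le_interp_of_mem_verticalClosedStrip₀₁' Q (z := (s : ℂ))
    (by simp [verticalClosedStrip, hs0.le, hs1.le]) hdiff hBdd (fun z hz => hbound0 z hz)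
    (fun z hz => hbound1 z hz)
  have hes : ∀ j ∈ F, e j s = c j := fun j hj => by
    have h1 : r / 2 * (1 + s) = 1 := by rw [hr]; field_simp
    simp only [he]
    rw [show (r / 2 * (1 + s) : ℂ) = ((r / 2 * (1 + s) : ℝ) : ℂ) by push_cast; rfl, h1,
      Complex.ofReal_one, one_mul, ← Complex.ofReal_exp, Real.exp_log (hc j hj)]
  have hQs : Q s = ((∫ x, ‖∑ j ∈ F, (c j : ℂ) * φ j x‖ ^ 2 * Real.exp (s * L x) ∂μ : ℝ) : ℂ) := by
    rw [hQint s (by simpa using hs0.le), ← integral_complex_ofReal]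
    refine integral_congr_ae (ae_of_all _ fun x => ?_)
    have e1 : ∑ j ∈ F, e j s * φ j x = ∑ j ∈ F, (c j : ℂ) * φ j x :=
      Finset.sum_congr rfl fun j hj => by rw [hes j hj]
    have e2 : ∑ j ∈ F, (starRingEnd ℂ) (e j s) * φ j x = ∑ j ∈ F, (c j : ℂ) * φ j x :=
      Finset.sum_congr rfl fun j hj => by rw [hes j hj, Complex.conj_ofReal]
    simp only [e1, e2, Complex.mul_conj']
    push_cast
    rfl
  rw [hQs, Complex.norm_real, Complex.ofReal_re] at key
  refine (le_abs_self _).trans (key.trans (le_of_eq ?_))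
  have hS : 0 ≤ ∑ j ∈ F, c j ^ r := Finset.sum_nonneg fun j hj => by have := hc j hj; positivity
  have hI : 0 ≤ ∫ x, Real.exp (L x) ∂μ := integral_nonneg fun x => by positivity
  rcases hS.eq_or_lt with h | h
  · rw [← h]
    rw [Real.zero_rpow (by linarith), Real.zero_rpow (by linarith)]
    ring
  · rw [Real.mul_rpow (by positivity) hI, ← Real.rpow_natCast_mul hS, mul_comm (_ ^ s), ← mul_assoc,
      ← Real.rpow_add h]
    congr 2
    push_cast
    ring

end Interpolation

/-! ### The weight integral and the comparison of constants. -/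

section Constants

theorem lintegral_comp_mul_left_of_pos {a : ℝ} (ha : 0 < a) (f : ℝ → ℝ≥0∞) :
    ∫⁻ x, f (a * x) = ENNReal.ofReal a⁻¹ * ∫⁻ x, f x := by
  have h := (Homeomorph.mulLeft₀ a ha.ne').measurableEmbedding.lintegral_map f (μ := volume)
  rw [Homeomorph.coe_mulLeft₀, Real.map_volume_mul_left ha.ne', abs_of_pos (inv_pos.2 ha),
    lintegral_smul_measure] at h
  exact h.symm

theorem lintegral_Ioi_mul_rpow {q : ℝ} (hq : 1 < q) :
    ∫⁻ r in Set.Ioi (0 : ℝ), ENNReal.ofReal (r * (1 + r ^ 2) ^ (-q))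
      = ENNReal.ofReal (1 / (2 * (q - 1))) := by
  have hder : ∀ r ∈ Set.Ici (0 : ℝ), HasDerivAt (fun r : ℝ => -(1 + r ^ 2) ^ (1 - q) / (2 * (q - 1)))
      (r * (1 + r ^ 2) ^ (-q)) r := fun r _ => by
    have h1 : HasDerivAt (fun r : ℝ => 1 + r ^ 2) (2 * r) r := by
      simpa using (hasDerivAt_pow 2 r).const_add 1
    have h2 := ((h1.rpow_const (p := 1 - q) (Or.inl (by positivity))).neg).div_const (2 * (q - 1))
    refine HasDerivAt.congr_deriv h2 ?_
    rw [show 1 - q - 1 = -q by ring]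
    field_simp [show q - 1 ≠ 0 by linarith]
    ring
  have hlim : Filter.Tendsto (fun r : ℝ => -(1 + r ^ 2) ^ (1 - q) / (2 * (q - 1))) Filter.atTop
      (nhds 0) := by
    have h1 : Filter.Tendsto (fun r : ℝ => 1 + r ^ 2) Filter.atTop Filter.atTop :=
      Filter.tendsto_atTop_add_const_left _ _ (Filter.tendsto_pow_atTop two_ne_zero)
    have h2 := (tendsto_rpow_neg_atTop (show 0 < q - 1 by linarith)).comp h1
    have h3 := (h2.neg).div_const (2 * (q - 1))
    simpa [Function.comp_def] using h3
  have hnn : ∀ r ∈ Set.Ioi (0 : ℝ), 0 ≤ r * (1 + r ^ 2) ^ (-q) := fun r hr => by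
    have : (0 : ℝ) < r := hr
    positivity
  rw [← ofReal_integral_eq_lintegral_ofReal
    (integrableOn_Ioi_deriv_of_nonneg' hder hnn hlim)
    ((ae_restrict_iff' measurableSet_Ioi).2 (ae_of_all _ hnn)),
    integral_Ioi_of_hasDerivAt_of_nonneg' hder hnn hlim]
  congr 1
  have : q - 1 ≠ 0 := by linarith
  simp
  field_simp

theorem lintegral_one_add_sq_rpow {q : ℝ} (hq : 1 < q) :
    ∫⁻ p : ℝ × ℝ, ENNReal.ofReal ((1 + (p.1 ^ 2 + p.2 ^ 2)) ^ (-q))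
      = ENNReal.ofReal (Real.pi / (q - 1)) := by
  rw [← lintegral_comp_polarCoord_symm]
  have h1 : ∀ p : ℝ × ℝ, p ∈ polarCoord.target → ENNReal.ofReal p.1 •
      ENNReal.ofReal ((1 + ((polarCoord.symm p).1 ^ 2 + (polarCoord.symm p).2 ^ 2)) ^ (-q))
      = ENNReal.ofReal (p.1 * (1 + p.1 ^ 2) ^ (-q)) := fun p hp => by
    have hp1 : 0 < p.1 := hp.1
    rw [smul_eq_mul, ← ENNReal.ofReal_mul hp1.le, polarCoord_symm_apply]
    congr 4
    nlinarith [Real.sin_sq_add_cos_sq p.2]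
  rw [setLIntegral_congr_fun polarCoord.open_target.measurableSet h1, polarCoord_target,
    Measure.volume_eq_prod, ← Measure.prod_restrict,
    lintegral_prod _ (by fun_prop)]
  simp only [lintegral_const, Measure.restrict_apply MeasurableSet.univ, Set.univ_inter,
    Real.volume_Ioo]
  rw [lintegral_mul_const _ (by fun_prop), lintegral_Ioi_mul_rpow hq,
    ← ENNReal.ofReal_mul (by have : 0 < q - 1 := by linarith
                             positivity)]
  congr 1
  have : q - 1 ≠ 0 := by linarith
  field_simp
  ring

theorem lintegral_one_add_weighted_sq_rpow {q a b : ℝ} (hq : 1 < q) (ha : 0 < a) (hb : 0 < b) :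
    ∫⁻ p : ℝ × ℝ, ENNReal.ofReal ((1 + ((a * p.1) ^ 2 + (b * p.2) ^ 2)) ^ (-q))
      = ENNReal.ofReal (Real.pi / (a * b * (q - 1))) := by
  have hm : Measurable fun p : ℝ × ℝ => ENNReal.ofReal ((1 + (p.1 ^ 2 + p.2 ^ 2)) ^ (-q)) := by
    fun_prop
  have h0 := lintegral_one_add_sq_rpow hq
  rw [Measure.volume_eq_prod, lintegral_prod _ hm.aemeasurable] at h0
  rw [Measure.volume_eq_prod, lintegral_prod _ (by fun_prop)]
  have h1 : ∀ x : ℝ, ∫⁻ y : ℝ, ENNReal.ofReal ((1 + ((a * x) ^ 2 + (b * y) ^ 2)) ^ (-q))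
      = ENNReal.ofReal b⁻¹ * ∫⁻ y : ℝ, ENNReal.ofReal ((1 + ((a * x) ^ 2 + y ^ 2)) ^ (-q)) :=
    fun x => lintegral_comp_mul_left_of_pos hb
      fun y => ENNReal.ofReal ((1 + ((a * x) ^ 2 + y ^ 2)) ^ (-q))
  simp only [h1]
  rw [lintegral_const_mul' _ _ ENNReal.ofReal_ne_top, lintegral_comp_mul_left_of_pos ha
    fun x => ∫⁻ y : ℝ, ENNReal.ofReal ((1 + (x ^ 2 + y ^ 2)) ^ (-q)), h0,
    ← ENNReal.ofReal_mul (by positivity), ← ENNReal.ofReal_mul (by positivity)]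
  congr 1
  have : q - 1 ≠ 0 := by linarith
  field_simp

theorem Real.Gamma_one_add_le_one {s : ℝ} (h0 : 0 ≤ s) (h1 : s ≤ 1) : Real.Gamma (1 + s) ≤ 1 := by
  have := Real.convexOn_Gamma.2 (show (1 : ℝ) ∈ Set.Ioi 0 by simp) (show (2 : ℝ) ∈ Set.Ioi 0 by simp)
    (show 0 ≤ 1 - s by linarith) h0 (by ring)
  simp only [smul_eq_mul, Real.Gamma_one, Real.Gamma_two] at this
  rw [show (1 - s) * 1 + s * 2 = 1 + s by ring] at this
  linarith

/-- Two functional equations give `Γ(1-s) = Γ(3-s) / ((1-s)(2-s))`; then `Γ(3-s) ≥ 1` and `Γ(1+s) ≤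
1`. -/
theorem Real.inv_le_Gamma_div_Gamma {s : ℝ} (h0 : 0 < s) (h1 : s < 1) :
    1 / ((1 - s) * (2 - s)) ≤ Real.Gamma (1 - s) / Real.Gamma (1 + s) := by
  have e1 : Real.Gamma (2 - s) = (1 - s) * Real.Gamma (1 - s) := by
    rw [← Real.Gamma_add_one (by linarith)]; congr 1; ring
  have e2 : Real.Gamma (3 - s) = (2 - s) * Real.Gamma (2 - s) := by
    rw [← Real.Gamma_add_one (by linarith)]; congr 1; ring
  have e3 : 1 ≤ Real.Gamma (3 - s) := by
    rw [← Real.Gamma_two]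
    exact Real.Gamma_strictMonoOn_Ici.monotoneOn (by simp) (by simp; linarith) (by linarith)
  have e4 := Real.Gamma_one_add_le_one h0.le h1.le
  have e5 : 0 < Real.Gamma (1 + s) := Real.Gamma_pos_of_pos (by linarith)
  have : 0 < (1 - s) * (2 - s) := by nlinarith
  rw [div_le_div_iff₀ this e5]
  nlinarith

/-- The constant obtained by the interpolation argument is no worse than the stated one. -/
theorem rpow_neg_inv_le_sobolevConst {s : ℝ} (h0 : 0 < s) (h1 : s < 1) :
    (1 - s) ^ (-(1 / s)) ≤ 4 * Real.pi * sobolevConst s ^ (2 / s) := by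
  have hπ := Real.pi_pos
  have hsin : 0 < Real.sin (Real.pi * s) := Real.sin_pos_of_pos_of_lt_pi (by positivity) (by nlinarith)
  have hΓ : 0 < Real.Gamma s := Real.Gamma_pos_of_pos h0
  set S := Real.pi ^ ((1 - s) / 2) /
      (2 ^ s * Real.sin (Real.pi * s) ^ (1 / 2 : ℝ) * Real.Gamma s * Real.sqrt s) with hS
  have hS0 : 0 < S := by positivity
  set X := (4 * Real.pi) ^ (s / 2) * S with hX
  have hX0 : 0 < X := by positivity
  -- The reflection formula turns the second summand of `C_s`, after scaling by `(4π)^{s/2}`, into a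
  -- quotient of Gamma values.
  have hX2 : X ^ 2 = Real.Gamma (1 - s) / Real.Gamma (1 + s) := by
    have a1 : ((4 * Real.pi) ^ (s / 2)) ^ 2 = 2 ^ s * 2 ^ s * Real.pi ^ s := by
      rw [← Real.rpow_mul_natCast (by positivity), ← Real.mul_rpow (by positivity) (by positivity),
        ← Real.mul_rpow (by positivity) (by positivity)]
      norm_num
    have a2 : (Real.pi ^ ((1 - s) / 2)) ^ 2 * Real.pi ^ s = Real.pi := by
      rw [← Real.rpow_mul_natCast (by positivity), ← Real.rpow_add hπ]
      simp
    have a3 : (Real.sin (Real.pi * s) ^ (1 / 2 : ℝ)) ^ 2 = Real.sin (Real.pi * s) := by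
      rw [← Real.sqrt_eq_rpow, Real.sq_sqrt hsin.le]
    have a4 := Real.Gamma_mul_Gamma_one_sub s
    have a5 : Real.Gamma (1 + s) = s * Real.Gamma s := by
      rw [add_comm, Real.Gamma_add_one h0.ne']
    have a6 : Real.Gamma (1 - s) = Real.pi / (Real.sin (Real.pi * s) * Real.Gamma s) := by
      rw [eq_div_iff (by positivity)]
      rw [eq_div_iff hsin.ne'] at a4
      linarith
    rw [hX, hS, mul_pow, div_pow, a1, mul_pow, mul_pow, mul_pow, a3, Real.sq_sqrt h0.le, a5, a6]
    have a7 : (0 : ℝ) < 2 ^ s := by positivity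
    rw [div_div, ← mul_div_assoc, div_eq_div_iff (by positivity) (by positivity)]
    linear_combination (2 ^ s * 2 ^ s * (Real.sin (Real.pi * s) * Real.Gamma s * (s * Real.Gamma s))) * a2
  set u := Real.sqrt (1 - s) with hu
  have hu0 : 0 < u := Real.sqrt_pos.2 (by linarith)
  have hu2 : u ^ 2 = 1 - s := Real.sq_sqrt (by linarith)
  have hXge : 1 / (u * (1 + u ^ 2)) ≤ X := by
    refine le_of_sq_le_sq ?_ hX0.le
    rw [hX2]
    refine le_trans ?_ (Real.inv_le_Gamma_div_Gamma h0 h1)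
    rw [show (1 - s) * (2 - s) = u ^ 2 * (1 + u ^ 2) by rw [hu2]; ring, div_pow, one_pow, mul_pow]
    refine one_div_le_one_div_of_le (by positivity) ?_
    gcongr
    nlinarith [sq_nonneg u]
  have hY : 1 / 2 ≤ (4 * Real.pi) ^ (s / 2) * (1 / (8 * Real.pi) ^ (s / 2)) := by
    rw [mul_one_div, ← Real.div_rpow (by positivity) (by positivity),
      show 4 * Real.pi / (8 * Real.pi) = 1 / 2 by field_simp; norm_num]
    conv_lhs => rw [← Real.rpow_one (1 / 2 : ℝ)]
    exact Real.rpow_le_rpow_of_exponent_ge (by norm_num) (by norm_num) (by linarith)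
  -- With `u = √(1-s)` this reduces to `1/u ≤ 1/2 + 1/(u(1+u²))`, that is, to `u (u - 1)² ≥ 0`.
  have hmain : 1 / u ≤ (4 * Real.pi) ^ (s / 2) * sobolevConst s := by
    rw [sobolevConst, mul_add]
    refine le_trans ?_ (add_le_add hY hXge)
    rw [div_add_div _ _ (by positivity) (by positivity), div_le_div_iff₀ hu0 (by positivity)]
    nlinarith [mul_pos hu0 hu0, mul_nonneg (mul_pos hu0 hu0).le (sq_nonneg (u - 1))]
  have hC : 0 ≤ sobolevConst s := by
    rw [sobolevConst]
    positivity
  have h2 := Real.rpow_le_rpow (by positivity) hmain (show 0 ≤ 2 / s by positivity)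
  rw [Real.mul_rpow (by positivity) hC, ← Real.rpow_mul (by positivity)] at h2
  rw [show s / 2 * (2 / s) = 1 by field_simp, Real.rpow_one] at h2
  refine le_trans (le_of_eq ?_) h2
  rw [one_div u, ← Real.rpow_neg_one u, ← Real.rpow_mul hu0.le, hu, Real.sqrt_eq_rpow,
    ← Real.rpow_mul (by linarith)]
  congr 1
  field_simp

end Constants

/-! ### The `L²` Fourier transform as an integral, and Plancherel. -/

section Fourier

open scoped FourierTransform

theorem inner_L2R_eq_integral (f g : L2R) :
    ⟪f, g⟫_ℂ = ∫ x, (starRingEnd ℂ) (f x) * g x := by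
  rw [L2.inner_def]
  simp [mul_comm]

theorem enorm_Lp_two_sq {Ω : Type*} [MeasurableSpace Ω] {μ : Measure Ω} (f : Lp ℂ 2 μ) :
    ‖f‖ₑ ^ 2 = ∫⁻ x, ‖f x‖ₑ ^ 2 ∂μ := by
  have h := eLpNorm_nnreal_pow_eq_lintegral (f := f) (μ := μ) (p := 2) two_ne_zero
  rw [Lp.enorm_def]
  simpa using h

theorem Integrable.integral_fourier_mul_eq {f g : ℝ → ℂ} (hf : Integrable f) (hg : Integrable g) :
    ∫ x, 𝓕 f x * g x = ∫ x, f x * 𝓕 g x := by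
  have := VectorFourier.integral_fourierIntegral_smul_eq_flip (L := innerₗ ℝ)
    Real.continuous_fourierChar continuous_inner hf hg
  rw [flip_innerₗ] at this
  exact this

/-- On `L¹ ∩ L²` the `L²` Fourier transform is given by the Fourier integral. -/
theorem fourier_toLp_ae_eq {h : ℝ → ℂ} (h1 : Integrable h) (h2 : MemLp h 2) :
    (𝓕 (h2.toLp h) : L2R) =ᵐ[volume] 𝓕 h := by
  have hcont : Continuous (𝓕 h) := VectorFourier.fourierIntegral_continuous Real.continuous_fourierChar continuous_inner h1
  refine ae_eq_of_integral_contDiff_smul_eq ((Lp.memLp _).locallyIntegrable (by norm_num))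
    hcont.locallyIntegrable fun φ hφ hc => ?_
  have hc' : HasCompactSupport (fun x => (φ x : ℂ)) := hc.comp_left (g := Complex.ofReal) rfl
  have hφ' : ContDiff ℝ ∞ fun x => (φ x : ℂ) := Complex.ofRealCLM.contDiff.comp hφ
  set Φ : SchwartzMap ℝ ℂ := hc'.toSchwartzMap hφ' with hΦ
  have hΦx : ∀ x, Φ x = φ x := fun x => rfl
  have e1 : ∫ x, φ x • (𝓕 (h2.toLp h) : L2R) x = ⟪Φ.toLp 2 volume, 𝓕 (h2.toLp h)⟫_ℂ := by
    rw [inner_L2R_eq_integral]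
    refine integral_congr_ae ?_
    filter_upwards [Φ.coeFn_toLp 2 volume] with x hx
    rw [hx, hΦx, Complex.conj_ofReal, Complex.real_smul]
  have e2 : ⟪Φ.toLp 2 volume, 𝓕 (h2.toLp h)⟫_ℂ = ⟪(𝓕⁻ Φ).toLp 2 volume, h2.toLp h⟫_ℂ := by
    rw [← SchwartzMap.toLp_fourierInv_eq, ← Lp.inner_fourier_eq (𝓕⁻ _), FourierTransform.fourier_fourierInv_eq]
  rw [e1, e2, inner_L2R_eq_integral]
  have e3 : ∀ x, (starRingEnd ℂ) ((𝓕⁻ Φ) x) = 𝓕 (Φ : ℝ → ℂ) x := fun x => by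
    rw [SchwartzMap.fourierInv_coe, Real.fourierInv_eq_fourier_neg, Real.fourier_real_eq,
      Real.fourier_real_eq, ← integral_conj]
    congr 1
    ext y
    simp only [Circle.smul_def, smul_eq_mul, map_mul, hΦx, Complex.conj_ofReal,
      ← Circle.coe_inv_eq_conj, ← AddChar.map_neg_eq_inv, neg_neg, mul_neg]
  have e4 : ∫ x, (starRingEnd ℂ) (((𝓕⁻ Φ).toLp 2 volume : L2R) x) * (h2.toLp h : L2R) x
      = ∫ x, 𝓕 (Φ : ℝ → ℂ) x * h x := by
    refine integral_congr_ae ?_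
    filter_upwards [(𝓕⁻ Φ).coeFn_toLp 2 volume, h2.coeFn_toLp] with x hx hx'
    rw [hx, hx', e3]
  rw [e4, Integrable.integral_fourier_mul_eq Φ.integrable h1]
  rfl

theorem lintegral_enorm_fourier_sq {h : ℝ → ℂ} (h1 : Integrable h) (h2 : MemLp h 2) :
    ∫⁻ x, ‖𝓕 h x‖ₑ ^ 2 = ∫⁻ x, ‖h x‖ₑ ^ 2 := by
  have e1 := enorm_Lp_two_sq (𝓕 (h2.toLp h) : L2R)
  have e2 := enorm_Lp_two_sq (h2.toLp h)
  rw [← ofReal_norm, Lp.norm_fourier_eq, ofReal_norm, e2] at e1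
  rw [lintegral_congr_ae ((fourier_toLp_ae_eq h1 h2).mono fun x hx => by
    show ‖𝓕 h x‖ₑ ^ 2 = _
    rw [← hx]), ← e1]
  exact lintegral_congr_ae (h2.coeFn_toLp.mono fun x hx => by simp only [hx])

end Fourier

/-! ### Weyl operators and Fourier-Wigner functions. -/

section Weyl

open scoped FourierTransform

theorem memLp_weyl (ξ v : ℝ) (g : L2R) :
    MemLp (fun x : ℝ => (Real.fourierChar (x * ξ) : ℂ) * g (x - v)) 2 volume := by
  have h := (Lp.memLp g).comp_measurePreserving (measurePreserving_sub_right volume v)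
  refine h.of_le ?_ (ae_of_all _ fun x => by
    rw [norm_mul, Circle.norm_coe, one_mul]; rfl)
  exact (Continuous.aestronglyMeasurable (by fun_prop)).mul h.1

/-- The Weyl operator: translation by `v` followed by modulation with frequency `ξ`. -/
noncomputable def weyl (ξ v : ℝ) : L2R →ₗᵢ[ℂ] L2R where
  toFun g := (memLp_weyl ξ v g).toLp _
  map_add' f g := by
    rw [← MemLp.toLp_add]
    refine MemLp.toLp_congr _ _ ?_
    filter_upwards [(measurePreserving_sub_right volume v).quasiMeasurePreserving.ae
      (Lp.coeFn_add f g)] with x hx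
    simp only [Pi.add_apply, hx]
    ring
  map_smul' c g := by
    rw [RingHom.id_apply, ← MemLp.toLp_const_smul]
    refine MemLp.toLp_congr _ _ ?_
    filter_upwards [(measurePreserving_sub_right volume v).quasiMeasurePreserving.ae
      (Lp.coeFn_smul c g)] with x hx
    simp only [Pi.smul_apply, hx, smul_eq_mul]
    ring
  norm_map' g := by
    change ‖(memLp_weyl ξ v g).toLp _‖ = _
    rw [Lp.norm_toLp, Lp.norm_def]
    congr 1
    rw [← eLpNorm_comp_measurePreserving (Lp.memLp g).1 (measurePreserving_sub_right volume v)]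
    refine eLpNorm_congr_norm_ae (ae_of_all _ fun x => ?_)
    rw [norm_mul, Circle.norm_coe, one_mul]; rfl

theorem weyl_ae_eq (ξ v : ℝ) (g : L2R) :
    weyl ξ v g =ᵐ[volume] fun x : ℝ => (Real.fourierChar (x * ξ) : ℂ) * g (x - v) :=
  (memLp_weyl ξ v g).coeFn_toLp

/-- The Fourier transform exchanges translations and modulations, up to the phase from their
commutation. Both sides are continuous in `g`, so a computation on Schwartz functions suffices. -/
theorem weyl_fourier (ξ v : ℝ) (g : L2R) :
    weyl ξ v (𝓕 g) = (Real.fourierChar (ξ * v) : ℂ) • 𝓕 (weyl v (-ξ) g) := by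
  refine DenseRange.induction_on
    (p := fun g : L2R => weyl ξ v (𝓕 g) = (Real.fourierChar (ξ * v) : ℂ) • 𝓕 (weyl v (-ξ) g))
    (SchwartzMap.denseRange_toLpCLM (p := 2) ENNReal.ofNat_ne_top) g ?_ fun Φ => ?_
  · refine isClosed_eq ?_ ?_
    · exact (weyl ξ v).continuous.comp (Lp.fourierTransformₗᵢ ℝ ℂ).continuous
    · have hc : Continuous fun g : L2R => (𝓕 (weyl v (-ξ) g) : L2R) :=
        (Lp.fourierTransformₗᵢ ℝ ℂ).continuous.comp (weyl v (-ξ)).continuous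
      exact hc.const_smul (Real.fourierChar (ξ * v) : ℂ)
  · rw [SchwartzMap.toLpCLM_apply, SchwartzMap.toLp_fourier_eq]
    set h : ℝ → ℂ := fun x => (Real.fourierChar (x * v) : ℂ) * Φ (x - -ξ) with hh
    have h2 : MemLp h 2 := by
      refine (memLp_weyl v (-ξ) (Φ.toLp 2 volume)).ae_eq ?_
      filter_upwards [(measurePreserving_sub_right volume (-ξ)).quasiMeasurePreserving.ae
        (Φ.coeFn_toLp 2 volume)] with x hx
      rw [hx]
    have h1 : Integrable h := by
      have := Φ.integrable (μ := volume).comp_sub_right (-ξ)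
      refine this.mono h2.1 (ae_of_all _ fun x => ?_)
      rw [hh, norm_mul, Circle.norm_coe, one_mul]
    have e1 : weyl v (-ξ) (Φ.toLp 2 volume) = h2.toLp h := by
      refine Lp.ext ((weyl_ae_eq _ _ _).trans ?_)
      filter_upwards [(measurePreserving_sub_right volume (-ξ)).quasiMeasurePreserving.ae
        (Φ.coeFn_toLp 2 volume), h2.coeFn_toLp] with x hx hx'
      rw [hx, hx']
    rw [e1]
    refine Lp.ext ?_
    filter_upwards [weyl_ae_eq ξ v ((𝓕 Φ).toLp 2 volume), Lp.coeFn_smul (Real.fourierChar (ξ * v) : ℂ)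
      (𝓕 (h2.toLp h) : L2R), fourier_toLp_ae_eq h1 h2,
      (measurePreserving_sub_right volume v).quasiMeasurePreserving.ae
        ((𝓕 Φ).coeFn_toLp 2 volume)] with y hy1 hy2 hy3 hy4
    rw [hy1, hy2, Pi.smul_apply, hy3, hy4, SchwartzMap.fourier_coe, Real.fourier_real_eq,
      Real.fourier_real_eq, ← integral_sub_right_eq_self _ (-ξ), ← integral_const_mul, smul_eq_mul,
      ← integral_const_mul]
    refine integral_congr_ae (ae_of_all _ fun x => ?_)
    simp only [Circle.smul_def, smul_eq_mul, hh, ← mul_assoc, ← Circle.coe_mul,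
      ← AddChar.map_add_eq_mul]
    congr 3
    ring

/-- The Fourier-Wigner (cross-ambiguity) function of `f` and `g`. -/
noncomputable def ambiguity (f g : L2R) (p : ℝ × ℝ) : ℂ :=
  𝓕 (fun x : ℝ => f x * (starRingEnd ℂ) (g (x - p.2))) p.1

theorem ambiguity_eq_inner (f g : L2R) (p : ℝ × ℝ) :
    ambiguity f g p = ⟪weyl p.1 p.2 g, f⟫_ℂ := by
  rw [ambiguity, Real.fourier_real_eq, inner_L2R_eq_integral]
  refine integral_congr_ae ?_
  filter_upwards [weyl_ae_eq p.1 p.2 g] with x hx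
  rw [hx, map_mul, ← Circle.coe_inv_eq_conj, ← AddChar.map_neg_eq_inv, Circle.smul_def, smul_eq_mul]
  ring

theorem norm_ambiguity_le (f g : L2R) (p : ℝ × ℝ) : ‖ambiguity f g p‖ ≤ ‖f‖ * ‖g‖ := by
  rw [ambiguity_eq_inner, mul_comm]
  exact (norm_inner_le_norm _ _).trans (by rw [LinearIsometry.norm_map])

/-- A quarter turn of phase space, up to a phase: this transfers the position estimate to momentum.
-/
theorem ambiguity_fourier (f g : L2R) (p : ℝ × ℝ) :
    ambiguity (𝓕 f) (𝓕 g) p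
      = (Real.fourierChar (-(p.1 * p.2)) : ℂ) * ambiguity f g (p.2, -p.1) := by
  rw [ambiguity_eq_inner, ambiguity_eq_inner, weyl_fourier, inner_smul_left, Lp.inner_fourier_eq,
    ← Circle.coe_inv_eq_conj, ← AddChar.map_neg_eq_inv]

theorem stronglyMeasurable_ambiguity (f g : L2R) : StronglyMeasurable (ambiguity f g) := by
  have hm : StronglyMeasurable fun q : (ℝ × ℝ) × ℝ =>
      (Real.fourierChar (-(q.2 * q.1.1)) : ℂ) * (f q.2 * (starRingEnd ℂ) (g (q.2 - q.1.2))) := by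
    refine (Continuous.stronglyMeasurable (by fun_prop)).mul (StronglyMeasurable.mul ?_ ?_)
    · exact (Lp.stronglyMeasurable f).comp_measurable measurable_snd
    · exact Complex.continuous_conj.comp_stronglyMeasurable
        ((Lp.stronglyMeasurable g).comp_measurable (by fun_prop))
  have := hm.integral_prod_right' (ν := volume)
  refine (congrArg StronglyMeasurable (funext fun p => ?_)).mp this
  rw [ambiguity, Real.fourier_real_eq]
  rfl

end Weyl

/-! ### Integral kernels in the coordinates `(x, x - y)` and Plancherel in one variable. -/

section Correlation

open scoped FourierTransform

/-- The Hilbert space of square-integrable functions on phase space. -/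
abbrev L2R2 : Type := Lp ℂ 2 (volume : Measure (ℝ × ℝ))

/-- The integral kernel `f(x) conj (g(y))` of `|f⟩⟨g|`, in the coordinates `(x, x - y)`. -/
noncomputable def correlation (f g : L2R) (p : ℝ × ℝ) : ℂ :=
  f p.1 * (starRingEnd ℂ) (g (p.1 - p.2))

theorem stronglyMeasurable_correlation (f g : L2R) : StronglyMeasurable (correlation f g) :=
  ((Lp.stronglyMeasurable f).comp_measurable measurable_fst).mul
    (Complex.continuous_conj.comp_stronglyMeasurable
      ((Lp.stronglyMeasurable g).comp_measurable (by fun_prop)))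

theorem measurable_enorm_Lp_sq {Ω : Type*} [MeasurableSpace Ω] {μ : Measure Ω} (f : Lp ℂ 2 μ) :
    Measurable fun x => ‖f x‖ₑ ^ 2 :=
  (Lp.stronglyMeasurable f).enorm.pow_const 2

theorem lintegral_enorm_correlation_sq (f g : L2R) :
    ∫⁻ p, ‖correlation f g p‖ₑ ^ 2 = ‖f‖ₑ ^ 2 * ‖g‖ₑ ^ 2 := by
  rw [Measure.volume_eq_prod,
    lintegral_prod _ ((stronglyMeasurable_correlation f g).enorm.pow_const 2).aemeasurable]
  have h : ∀ x : ℝ, ∫⁻ v : ℝ, ‖correlation f g (x, v)‖ₑ ^ 2 = ‖f x‖ₑ ^ 2 * ‖g‖ₑ ^ 2 := fun x => by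
    simp only [correlation, enorm_mul, RCLike.enorm_conj, mul_pow]
    rw [lintegral_const_mul' _ _ (ENNReal.pow_ne_top enorm_ne_top),
      lintegral_sub_left_eq_self (fun y => ‖g y‖ₑ ^ 2) x, enorm_Lp_two_sq g]
  simp only [h]
  rw [lintegral_mul_const _ (measurable_enorm_Lp_sq f), enorm_Lp_two_sq f]

theorem memLp_two_of_lintegral_enorm_sq_ne_top {Ω : Type*} [MeasurableSpace Ω] {μ : Measure Ω}
    {f : Ω → ℂ} (hf : AEStronglyMeasurable f μ) (h : ∫⁻ x, ‖f x‖ₑ ^ 2 ∂μ ≠ ⊤) : MemLp f 2 μ := by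
  refine ⟨hf, ?_⟩
  rw [eLpNorm_lt_top_iff_lintegral_rpow_enorm_lt_top two_ne_zero ENNReal.ofNat_ne_top]
  simpa using h.lt_top

theorem memLp_correlation (f g : L2R) : MemLp (correlation f g) 2 volume :=
  memLp_two_of_lintegral_enorm_sq_ne_top (stronglyMeasurable_correlation f g).aestronglyMeasurable
    (by
      rw [lintegral_enorm_correlation_sq]
      exact ENNReal.mul_ne_top (ENNReal.pow_ne_top enorm_ne_top) (ENNReal.pow_ne_top enorm_ne_top))

/-- `correlation f g` as an element of `L²`. -/
noncomputable def correlationLp (f g : L2R) : L2R2 := (memLp_correlation f g).toLp _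

theorem correlationLp_ae_eq (f g : L2R) : correlationLp f g =ᵐ[volume] correlation f g :=
  (memLp_correlation f g).coeFn_toLp

theorem inner_Lp_two_eq_integral {Ω : Type*} [MeasurableSpace Ω] {μ : Measure Ω} (f g : Lp ℂ 2 μ) :
    ⟪f, g⟫_ℂ = ∫ x, (starRingEnd ℂ) (f x) * g x ∂μ := by
  rw [L2.inner_def]
  simp [mul_comm]

theorem integrable_conj_mul_Lp_two {Ω : Type*} [MeasurableSpace Ω] {μ : Measure Ω}
    (f g : Lp ℂ 2 μ) : Integrable (fun x => (starRingEnd ℂ) (f x) * g x) μ :=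
  (Lp.memLp f).star.integrable_mul (Lp.memLp g)

theorem inner_correlationLp (f₁ g₁ f₂ g₂ : L2R) :
    ⟪correlationLp f₁ g₁, correlationLp f₂ g₂⟫_ℂ = ⟪f₁, f₂⟫_ℂ * ⟪g₂, g₁⟫_ℂ := by
  have hae : (fun p => (starRingEnd ℂ) (correlationLp f₁ g₁ p) * correlationLp f₂ g₂ p)
      =ᵐ[volume] fun p : ℝ × ℝ => ((starRingEnd ℂ) (f₁ p.1) * f₂ p.1) *
        ((starRingEnd ℂ) (g₂ (p.1 - p.2)) * g₁ (p.1 - p.2)) := by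
    filter_upwards [correlationLp_ae_eq f₁ g₁, correlationLp_ae_eq f₂ g₂] with p h1 h2
    simp only [h1, h2, correlation, map_mul, Complex.conj_conj]
    ring
  have hint := (integrable_conj_mul_Lp_two (correlationLp f₁ g₁) (correlationLp f₂ g₂)).congr hae
  rw [inner_Lp_two_eq_integral, integral_congr_ae hae, Measure.volume_eq_prod, integral_prod]
  · have h : ∀ x : ℝ, ∫ v : ℝ, ((starRingEnd ℂ) (f₁ x) * f₂ x) *
        ((starRingEnd ℂ) (g₂ (x - v)) * g₁ (x - v))
        = ((starRingEnd ℂ) (f₁ x) * f₂ x) * ⟪g₂, g₁⟫_ℂ := fun x => by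
      rw [integral_const_mul, integral_sub_left_eq_self
        (fun y => (starRingEnd ℂ) (g₂ y) * g₁ y) volume x, inner_L2R_eq_integral]
    simp only [h]
    rw [integral_mul_const, inner_L2R_eq_integral f₁]
  · rwa [← Measure.volume_eq_prod]

theorem integrable_correlation_slice (f g : L2R) (v : ℝ) :
    Integrable fun x : ℝ => correlation f g (x, v) :=
  (Lp.memLp f).integrable_mul
    ((Lp.memLp g).comp_measurePreserving (measurePreserving_sub_right volume v)).star

variable {ι : Type*}

/-- Plancherel's theorem in the first variable, for sums of Fourier-Wigner functions. -/
theorem lintegral_weight_ambiguity {m : ℝ → ℝ≥0∞} (hm : Measurable m) (F : Finset ι)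
    (c : ι → ℂ) (f : ι → L2R) :
    ∫⁻ p : ℝ × ℝ, m p.2 * ‖∑ j ∈ F, c j * ambiguity (f j) (f j) p‖ₑ ^ 2
      = ∫⁻ p : ℝ × ℝ, m p.2 * ‖∑ j ∈ F, c j * correlation (f j) (f j) p‖ₑ ^ 2 := by
  have hsm1 : StronglyMeasurable fun p : ℝ × ℝ => ∑ j ∈ F, c j * ambiguity (f j) (f j) p :=
    Finset.stronglyMeasurable_fun_sum _ fun j _ => (stronglyMeasurable_ambiguity _ _).const_mul _
  have hsm2 : StronglyMeasurable fun p : ℝ × ℝ => ∑ j ∈ F, c j * correlation (f j) (f j) p :=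
    Finset.stronglyMeasurable_fun_sum _ fun j _ => (stronglyMeasurable_correlation _ _).const_mul _
  have hm1 : Measurable fun p : ℝ × ℝ => m p.2 * ‖∑ j ∈ F, c j * ambiguity (f j) (f j) p‖ₑ ^ 2 :=
    (hm.comp measurable_snd).mul (hsm1.enorm.pow_const 2)
  have hm2 : Measurable fun p : ℝ × ℝ => m p.2 * ‖∑ j ∈ F, c j * correlation (f j) (f j) p‖ₑ ^ 2 :=
    (hm.comp measurable_snd).mul (hsm2.enorm.pow_const 2)
  rw [Measure.volume_eq_prod, lintegral_prod_symm _ hm1.aemeasurable,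
    lintegral_prod_symm _ hm2.aemeasurable]
  have hLp : MemLp (fun p : ℝ × ℝ => ∑ j ∈ F, c j * correlation (f j) (f j) p) 2 volume :=
    memLp_finsetSum _ fun j _ => (memLp_correlation _ _).const_mul _
  -- Square-integrability on the plane makes almost every slice square-integrable; slices are
  -- integrable anyway, so Plancherel applies to almost all of them.
  have hfin : ∫⁻ v : ℝ, ∫⁻ x : ℝ, ‖∑ j ∈ F, c j * correlation (f j) (f j) (x, v)‖ₑ ^ 2 ≠ ⊤ := by
    have h1 := hLp.2
    rw [eLpNorm_lt_top_iff_lintegral_rpow_enorm_lt_top two_ne_zero ENNReal.ofNat_ne_top] at h1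
    simp only [ENNReal.toReal_ofNat, ENNReal.rpow_ofNat] at h1
    rw [Measure.volume_eq_prod,
      lintegral_prod_symm _ (hsm2.enorm.pow_const 2).aemeasurable] at h1
    exact h1.ne
  refine lintegral_congr_ae ?_
  filter_upwards [ae_lt_top (Measurable.lintegral_prod_left' (hsm2.enorm.pow_const 2)) hfin] with v hv
  have hv0 : Measurable fun x : ℝ => (x, v) := by fun_prop
  have hv1 : Measurable fun x : ℝ => ‖∑ j ∈ F, c j * ambiguity (f j) (f j) (x, v)‖ₑ ^ 2 :=
    (hsm1.enorm.pow_const 2).comp hv0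
  have hv2 : Measurable fun x : ℝ => ‖∑ j ∈ F, c j * correlation (f j) (f j) (x, v)‖ₑ ^ 2 :=
    (hsm2.enorm.pow_const 2).comp hv0
  rw [lintegral_const_mul _ hv1, lintegral_const_mul _ hv2]
  congr 1
  have h1 : Integrable fun x : ℝ => ∑ j ∈ F, c j * correlation (f j) (f j) (x, v) :=
    integrable_finsetSum _ fun j _ => (integrable_correlation_slice _ _ v).const_mul _
  rw [← lintegral_enorm_fourier_sq h1 (memLp_two_of_lintegral_enorm_sq_ne_top h1.1 hv.ne)]
  refine lintegral_congr fun ξ => ?_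
  congr 2
  rw [Real.fourier_real_eq]
  simp only [ambiguity, Real.fourier_real_eq, Circle.smul_def, smul_eq_mul, Finset.mul_sum,
    ← integral_const_mul]
  rw [integral_finsetSum]
  · refine Finset.sum_congr rfl fun j _ => integral_congr_ae (ae_of_all _ fun x => ?_)
    simp only [correlation]
    ring
  · intro j _
    have h2 := ((integrable_correlation_slice (f j) (f j) v).const_mul (c j))
    refine h2.mono ((Continuous.aestronglyMeasurable (by fun_prop)).mul h2.1)
      (ae_of_all _ fun x => ?_)
    rw [norm_mul, Circle.norm_coe, one_mul]

/-- Plancherel for the transformed functions, followed by the measure-preserving quarter turn, which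
moves the weight from `v` to `ξ`. -/
theorem lintegral_weight_correlation_fourier {m : ℝ → ℝ≥0∞} (hm : Measurable m) (F : Finset ι)
    (c : ι → ℂ) (f : ι → L2R) :
    ∫⁻ p : ℝ × ℝ, m p.2 * ‖∑ j ∈ F, c j * correlation (𝓕 (f j)) (𝓕 (f j)) p‖ₑ ^ 2
      = ∫⁻ p : ℝ × ℝ, m p.1 * ‖∑ j ∈ F, c j * ambiguity (f j) (f j) p‖ₑ ^ 2 := by
  rw [← lintegral_weight_ambiguity hm F c fun j => (𝓕 (f j) : L2R)]
  have hsm1 : StronglyMeasurable fun p : ℝ × ℝ => ∑ j ∈ F, c j * ambiguity (f j) (f j) p :=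
    Finset.stronglyMeasurable_fun_sum _ fun j _ => (stronglyMeasurable_ambiguity _ _).const_mul _
  have hmp : MeasurePreserving (fun p : ℝ × ℝ => (p.2, -p.1)) volume volume := by
    have h1 : MeasurePreserving (fun p : ℝ × ℝ => (-p.1, p.2)) volume volume :=
      (Measure.measurePreserving_neg volume).prod (MeasurePreserving.id volume)
    exact Measure.measurePreserving_swap.comp h1
  rw [← hmp.lintegral_comp (f := fun p : ℝ × ℝ =>
    m p.1 * ‖∑ j ∈ F, c j * ambiguity (f j) (f j) p‖ₑ ^ 2)
    ((hm.comp measurable_fst).mul (hsm1.enorm.pow_const 2))]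
  refine lintegral_congr fun p => ?_
  congr 2
  have hsum : ∑ j ∈ F, c j * ambiguity (𝓕 (f j)) (𝓕 (f j)) p
      = (Real.fourierChar (-(p.1 * p.2)) : ℂ) *
        ∑ j ∈ F, c j * ambiguity (f j) (f j) (p.2, -p.1) := by
    rw [Finset.mul_sum]
    refine Finset.sum_congr rfl fun j _ => ?_
    rw [ambiguity_fourier]
    ring
  rw [hsum, enorm_mul, ← ofReal_norm (Real.fourierChar (-(p.1 * p.2)) : ℂ), Circle.norm_coe,
    ENNReal.ofReal_one, one_mul]

theorem correlationLp_orthonormal (b : HilbertBasis ι ℂ L2R) :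
    Orthonormal ℂ fun p : ι × ι => correlationLp (b p.1) (b p.2) := by
  classical
  rw [orthonormal_iff_ite]
  rintro ⟨j, k⟩ ⟨j', k'⟩
  rw [inner_correlationLp, orthonormal_iff_ite.1 b.orthonormal, orthonormal_iff_ite.1 b.orthonormal]
  simp only [Prod.mk.injEq, ite_and]
  split_ifs <;> simp_all

theorem correlationLp_diag_orthonormal (b : HilbertBasis ι ℂ L2R) :
    Orthonormal ℂ fun j : ι => correlationLp (b j) (b j) :=
  (correlationLp_orthonormal b).comp (fun j => (j, j)) fun _ _ h => (Prod.mk.inj h).1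

end Correlation

/-! ### The position operator and the kernel of its commutators. -/

section Kernel

open scoped FourierTransform

theorem positionOp_ae_eq (f : positionOp.domain) :
    (positionOp f : L2R) =ᵐ[volume] fun x : ℝ => (x : ℂ) * (f : L2R) x :=
  MemLp.coeFn_toLp f.2

theorem mem_positionOp_domain {f : L2R} {n : ℝ} (h : ∀ᵐ x, n < |x| → f x = 0) :
    f ∈ positionOp.domain := by
  change MemLp (fun x : ℝ => (x : ℂ) * f x) 2 volume
  refine (Lp.memLp f).of_le_mul (c := |n|)
    ((Continuous.aestronglyMeasurable (by fun_prop)).mul (Lp.memLp f).1) ?_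
  filter_upwards [h] with x hx
  rw [norm_mul, Complex.norm_real, Real.norm_eq_abs]
  rcases le_or_gt |x| n with h1 | h1
  · exact mul_le_mul_of_nonneg_right (h1.trans (le_abs_self n)) (norm_nonneg _)
  · rw [hx h1]; simp

/-- Testing with the truncation `d` of `x u - g` to `[-n, n]`, which lies in the domain, gives `∫
|d|² = 0`. -/
theorem extendsAdjoint_positionOp : ExtendsAdjoint positionOp := by
  intro u g h
  have key : ∀ n : ℕ, ∀ᵐ x : ℝ, |x| ≤ n → (x : ℂ) * u x = g x := by
    intro n
    set d : ℝ → ℂ := (Set.Icc (-n : ℝ) n).indicator fun x => (x : ℂ) * u x - g x with hd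
    have hdL : MemLp d 2 volume := by
      rw [hd, memLp_indicator_iff_restrict measurableSet_Icc]
      refine MemLp.sub ?_ ((Lp.memLp g).restrict _)
      refine ((Lp.memLp u).restrict _).of_le_mul (c := n)
        ((Continuous.aestronglyMeasurable (by fun_prop)).mul ((Lp.memLp u).restrict _).1) ?_
      refine (ae_restrict_iff' measurableSet_Icc).2 (ae_of_all _ fun x hx => ?_)
      rw [norm_mul, Complex.norm_real, Real.norm_eq_abs]
      exact mul_le_mul_of_nonneg_right (abs_le.2 hx) (norm_nonneg _)
    have hdom : hdL.toLp d ∈ positionOp.domain := by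
      refine mem_positionOp_domain (n := n) ?_
      filter_upwards [hdL.coeFn_toLp] with x hx hn
      rw [hx, hd, Set.indicator_of_notMem]
      exact fun h => absurd (abs_le.2 h) (not_le.2 hn)
    have h1 := h ⟨_, hdom⟩
    rw [inner_L2R_eq_integral, inner_L2R_eq_integral, ← sub_eq_zero, ← integral_sub
      (integrable_conj_mul_Lp_two _ _) (integrable_conj_mul_Lp_two _ _)] at h1
    have h2 : (fun x => (starRingEnd ℂ) ((positionOp ⟨_, hdom⟩ : L2R) x) * u x
        - (starRingEnd ℂ) ((hdL.toLp d : L2R) x) * g x)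
        =ᵐ[volume] fun x => ((‖d x‖ ^ 2 : ℝ) : ℂ) := by
      filter_upwards [positionOp_ae_eq ⟨_, hdom⟩, hdL.coeFn_toLp] with x hx hx'
      rw [hx]
      simp only [hx', map_mul, Complex.conj_ofReal]
      by_cases hmem : x ∈ Set.Icc (-n : ℝ) n
      · have e : (x : ℂ) * u x - g x = d x := by rw [hd, Set.indicator_of_mem hmem]
        push_cast
        rw [← Complex.conj_mul', ← e]
        ring
      · have e : d x = 0 := by rw [hd, Set.indicator_of_notMem hmem]
        simp [e]
    rw [integral_congr_ae h2, integral_complex_ofReal, Complex.ofReal_eq_zero,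
      integral_eq_zero_iff_of_nonneg (fun x => by positivity)
        (hdL.integrable_norm_pow two_ne_zero)] at h1
    filter_upwards [h1] with x hx hn
    have h3 : d x = 0 := by simpa using hx
    have hmem : x ∈ Set.Icc (-n : ℝ) n := abs_le.1 hn
    rw [hd, Set.indicator_of_mem hmem] at h3
    exact sub_eq_zero.1 h3
  have hae : (fun x : ℝ => (x : ℂ) * u x) =ᵐ[volume] g := by
    filter_upwards [ae_all_iff.2 key] with x hx
    obtain ⟨n, hn⟩ := exists_nat_ge |x|
    exact hx n hn
  refine ⟨(Lp.memLp g).ae_eq hae.symm, Lp.ext ?_⟩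
  exact (positionOp_ae_eq _).trans hae

/-- Rectangles form a π-system generating the product σ-algebra, so on each square the vanishing of
integrals extends to all measurable sets. -/
theorem ae_eq_zero_of_setIntegral_rectangle_eq_zero {w : ℝ × ℝ → ℂ}
    (hw : ∀ n : ℕ, IntegrableOn w (Set.Icc (-n : ℝ) n ×ˢ Set.Icc (-n : ℝ) n))
    (h : ∀ (n : ℕ) (S T : Set ℝ), MeasurableSet S → MeasurableSet T → S ⊆ Set.Icc (-n : ℝ) n →
      T ⊆ Set.Icc (-n : ℝ) n → ∫ p in S ×ˢ T, w p = 0) : w =ᵐ[volume] 0 := by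
  have key : ∀ n : ℕ, ∀ᵐ p : ℝ × ℝ, p ∈ Set.Icc (-n : ℝ) n ×ˢ Set.Icc (-n : ℝ) n → w p = 0 := by
    intro n
    set R := Set.Icc (-n : ℝ) n ×ˢ Set.Icc (-n : ℝ) n with hR
    have hRm : MeasurableSet R := measurableSet_Icc.prod measurableSet_Icc
    rw [← ae_restrict_iff' hRm]
    refine Integrable.ae_eq_zero_of_forall_setIntegral_eq_zero (hw n) fun A hA hAf => ?_
    clear hAf
    rw [Measure.restrict_restrict hA]
    have huniv : ∫ p in R, w p = 0 :=
      h n _ _ measurableSet_Icc measurableSet_Icc subset_rfl subset_rfl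
    induction A, hA using MeasurableSpace.induction_on_inter generateFrom_prod.symm
      isPiSystem_prod with
    | empty => simp
    | basic A hA =>
      obtain ⟨S, hS, T, hT, rfl⟩ := hA
      rw [hR, Set.prod_inter_prod]
      exact h n _ _ (MeasurableSet.inter hS measurableSet_Icc) (MeasurableSet.inter hT measurableSet_Icc)
        Set.inter_subset_right Set.inter_subset_right
    | compl A hA ih =>
      have h1 := integral_add_compl hA (hw n).integrable
      rw [Measure.restrict_restrict hA, Measure.restrict_restrict hA.compl, ih, huniv,
        zero_add] at h1
      exact h1
    | iUnion A hdisj hA ih =>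
      have h1 := integral_iUnion hA hdisj (f := w) (μ := volume.restrict R) (hw n).integrableOn
      rw [Measure.restrict_restrict (MeasurableSet.iUnion hA)] at h1
      rw [h1]
      simp only [Measure.restrict_restrict (hA _), ih, tsum_zero]
  filter_upwards [ae_all_iff.2 key] with p hp
  obtain ⟨n, hn⟩ := exists_nat_ge (max |p.1| |p.2|)
  exact hp n ⟨abs_le.1 ((le_max_left _ _).trans hn), abs_le.1 ((le_max_right _ _).trans hn)⟩

theorem measurePreserving_fst_sub :
    MeasurePreserving (fun p : ℝ × ℝ => (p.1, p.1 - p.2)) volume volume := by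
  have h1 : MeasurePreserving (fun p : ℝ × ℝ => (p.1, p.2 - p.1)) volume volume :=
    measurePreserving_prod_sub volume volume
  have h2 : MeasurePreserving (fun p : ℝ × ℝ => (p.1, -p.2)) volume volume :=
    (MeasurePreserving.id volume).prod (Measure.measurePreserving_neg volume)
  convert h2.comp h1 using 1
  ext p <;> simp

theorem correlation_ae_eq {f g : L2R} {f' g' : ℝ → ℂ} (hf : f =ᵐ[volume] f')
    (hg : g =ᵐ[volume] g') :
    correlation f g =ᵐ[volume] fun p => f' p.1 * (starRingEnd ℂ) (g' (p.1 - p.2)) := by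
  have h1 : ∀ᵐ p : ℝ × ℝ, f p.1 = f' p.1 := Measure.quasiMeasurePreserving_fst.ae hf
  have h2 : ∀ᵐ p : ℝ × ℝ, g (p.1 - p.2) = g' (p.1 - p.2) :=
    measurePreserving_fst_sub.quasiMeasurePreserving.ae (Measure.quasiMeasurePreserving_snd.ae hg)
  filter_upwards [h1, h2] with p hp1 hp2
  rw [correlation, hp1, hp2]

variable {ι : Type*}

theorem inner_correlationLp_hasSum_diag (b : HilbertBasis ι ℂ L2R) {A : L2R →L[ℂ] L2R}
    (hA : ∀ x y, ⟪A x, y⟫_ℂ = ⟪x, A y⟫_ℂ) {l : ι → ℝ} (hl : ∀ i, A (b i) = (l i : ℂ) • b i)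
    {a : L2R2} (ha : HasSum (fun j => (l j : ℂ) • correlationLp (b j) (b j)) a) (f g : L2R) :
    ⟪correlationLp f g, a⟫_ℂ = ⟪f, A g⟫_ℂ := by
  have h1 := ha.mapL (innerSL ℂ (correlationLp f g))
  simp only [innerSL_apply_apply, inner_smul_right, inner_correlationLp] at h1
  refine h1.unique ?_
  refine (b.hasSum_inner_mul_inner f (A g)).congr_fun fun j => ?_
  rw [← hA, hl, inner_smul_left, Complex.conj_ofReal]
  ring

theorem inner_correlationLp_hasSum (b : HilbertBasis ι ℂ L2R) {B : L2R →L[ℂ] L2R}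
    (hB : Summable fun p : ι × ι => ‖⟪b p.1, B (b p.2)⟫_ℂ‖ ^ 2) {k : L2R2}
    (hk : HasSum (fun p : ι × ι => ⟪b p.1, B (b p.2)⟫_ℂ • correlationLp (b p.1) (b p.2)) k)
    (f g : L2R) : ⟪correlationLp f g, k⟫_ℂ = ⟪f, B g⟫_ℂ := by
  have h1 := hk.mapL (innerSL ℂ (correlationLp f g))
  simp only [innerSL_apply_apply, inner_smul_right, inner_correlationLp] at h1
  refine h1.unique ((b.tsum_matrix_eq_inner B hB f g).congr_fun fun p => ?_)
  ring

theorem Orthonormal.summable_smul {κ E : Type*} [NormedAddCommGroup E] [InnerProductSpace ℂ E]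
    [CompleteSpace E] {v : κ → E} (hv : Orthonormal ℂ v) {c : κ → ℂ}
    (hc : Summable fun i => ‖c i‖ ^ 2) : Summable fun i => c i • v i := by
  have := (hv.orthogonalFamily.summable_iff_norm_sq_summable c).2 hc
  simpa using this

theorem Orthonormal.enorm_sq_sum {κ E : Type*} [NormedAddCommGroup E] [InnerProductSpace ℂ E]
    {v : κ → E} (hv : Orthonormal ℂ v) (F : Finset κ) (c : κ → ℂ) :
    ‖∑ i ∈ F, c i • v i‖ₑ ^ 2 = ∑ i ∈ F, ‖c i‖ₑ ^ 2 := by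
  have h2 : ‖∑ i ∈ F, c i • v i‖ ^ 2 = ∑ i ∈ F, ‖c i‖ ^ 2 := by
    have := hv.inner_sum c c F
    simp only [Complex.conj_mul'] at this
    rw [← @inner_self_eq_norm_sq ℂ, this]
    norm_cast
  have h3 := congrArg ENNReal.ofReal h2
  rw [ENNReal.ofReal_sum_of_nonneg fun i _ => by positivity] at h3
  simpa only [ENNReal.ofReal_pow (norm_nonneg _), ofReal_norm] using h3

theorem Orthonormal.enorm_sq_of_hasSum {κ E : Type*} [NormedAddCommGroup E] [InnerProductSpace ℂ E]
    {v : κ → E} (hv : Orthonormal ℂ v) {c : κ → ℂ} {x : E}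
    (hx : HasSum (fun i => c i • v i) x) : ‖x‖ₑ ^ 2 = ∑' i, ‖c i‖ₑ ^ 2 := by
  have h2 := ((ENNReal.continuous_pow 2).tendsto _).comp ((continuous_enorm.tendsto x).comp hx)
  simp only [Function.comp_def, hv.enorm_sq_sum] at h2
  exact tendsto_nhds_unique h2 ENNReal.summable.hasSum

/-- The kernel of a bounded commutator with the position operator is `(x - y)` times the kernel
of the operator. -/
theorem lintegral_sq_mul_kernel_le (b : HilbertBasis ι ℂ L2R) {A B : L2R →L[ℂ] L2R}
    (hA : ∀ x y, ⟪A x, y⟫_ℂ = ⟪x, A y⟫_ℂ) {l : ι → ℝ} (hl : ∀ i, A (b i) = (l i : ℂ) • b i)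
    {a : L2R2} (ha : HasSum (fun j => (l j : ℂ) • correlationLp (b j) (b j)) a)
    (hAB : IsCommutator positionOp A B) :
    ∫⁻ p : ℝ × ℝ, ‖p.2‖ₑ ^ 2 * ‖a p‖ₑ ^ 2 ≤ opTrace (ContinuousLinearMap.adjoint B ∘L B) := by
  rw [opTrace_adjoint_comp_eq b,
    ← ENNReal.tsum_prod (f := fun j k => ‖⟪b j, B (b k)⟫_ℂ‖ₑ ^ 2)]
  by_cases htop : ∑' p : ι × ι, ‖⟪b p.1, B (b p.2)⟫_ℂ‖ₑ ^ 2 = ⊤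
  · rw [htop]; exact le_top
  have hB := tsum_enorm_sq_ne_top_iff.1 htop
  obtain ⟨k, hk⟩ := (correlationLp_orthonormal b).summable_smul hB
  rw [← (correlationLp_orthonormal b).enorm_sq_of_hasSum hk, enorm_Lp_two_sq]
  -- The defect between the kernel of `B` and `x - y` times the kernel of `A`. It is tested in the
  -- original coordinates `(x, y)`, where indicators of bounded sets give rectangles; the involution
  -- `(x, v) ↦ (x, x - v)` changes coordinates.
  set w : ℝ × ℝ → ℂ := fun p => k p - (p.2 : ℂ) * a p with hw
  have hwτ : (fun p : ℝ × ℝ => w (p.1, p.1 - p.2)) =ᵐ[volume] 0 := by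
    refine ae_eq_zero_of_setIntegral_rectangle_eq_zero (fun n => ?_) fun n S T hS hT hSn hTn => ?_
    · have hk2 := ((Lp.memLp k).comp_measurePreserving measurePreserving_fst_sub).restrict
        (Set.Icc (-n : ℝ) n ×ˢ Set.Icc (-n : ℝ) n)
      have ha2 := ((Lp.memLp a).comp_measurePreserving measurePreserving_fst_sub).restrict
        (Set.Icc (-n : ℝ) n ×ˢ Set.Icc (-n : ℝ) n)
      have hfin : IsFiniteMeasure ((volume : Measure (ℝ × ℝ)).restrict
          (Set.Icc (-n : ℝ) n ×ˢ Set.Icc (-n : ℝ) n)) :=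
        ⟨by
          rw [Measure.restrict_apply_univ]
          exact (isCompact_Icc.prod isCompact_Icc).measure_lt_top⟩
      refine (hk2.integrable (by norm_num)).sub ?_
      refine (ha2.integrable (by norm_num)).bdd_mul (c := 2 * n)
        (Continuous.aestronglyMeasurable (by fun_prop)) ?_
      refine (ae_restrict_iff' (measurableSet_Icc.prod measurableSet_Icc)).2
        (ae_of_all _ fun p hp => ?_)
      rw [Complex.norm_real, Real.norm_eq_abs]
      have h1 := abs_le.2 hp.1
      have h2 := abs_le.2 hp.2
      have := abs_sub p.1 p.2
      linarith
    · have hSf : volume S ≠ ⊤ := ((measure_mono hSn).trans_lt isCompact_Icc.measure_lt_top).ne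
      have hTf : volume T ≠ ⊤ := ((measure_mono hTn).trans_lt isCompact_Icc.measure_lt_top).ne
      set f : L2R := indicatorConstLp 2 hS hSf (1 : ℂ) with hf
      set g : L2R := indicatorConstLp 2 hT hTf (1 : ℂ) with hg
      have hfae : f =ᵐ[volume] S.indicator fun _ => (1 : ℂ) := indicatorConstLp_coeFn
      have hgae : g =ᵐ[volume] T.indicator fun _ => (1 : ℂ) := indicatorConstLp_coeFn
      have hfd : f ∈ positionOp.domain := mem_positionOp_domain (n := n) (hfae.mono fun x hx hn => by
        rw [hx, Set.indicator_of_notMem fun h => absurd (abs_le.2 (hSn h)) (not_le.2 hn)])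
      have hgd : g ∈ positionOp.domain := mem_positionOp_domain (n := n) (hgae.mono fun x hx hn => by
        rw [hx, Set.indicator_of_notMem fun h => absurd (abs_le.2 (hTn h)) (not_le.2 hn)])
      have h1 := hAB ⟨f, hfd⟩ ⟨g, hgd⟩
      rw [← inner_correlationLp_hasSum b hB hk, ← inner_correlationLp_hasSum_diag b hA hl ha,
        ← inner_correlationLp_hasSum_diag b hA hl ha, ← inner_sub_left, inner_Lp_two_eq_integral,
        inner_Lp_two_eq_integral, ← sub_eq_zero,
        ← integral_sub (integrable_conj_mul_Lp_two _ _) (integrable_conj_mul_Lp_two _ _)] at h1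
      have e : (fun p => (starRingEnd ℂ) (correlationLp f g p) * k p - (starRingEnd ℂ)
          ((correlationLp (positionOp ⟨f, hfd⟩) g - correlationLp f (positionOp ⟨g, hgd⟩) : L2R2) p)
            * a p)
          =ᵐ[volume] ((fun p : ℝ × ℝ => (p.1, p.1 - p.2)) ⁻¹' (S ×ˢ T)).indicator w := by
        filter_upwards [correlationLp_ae_eq f g, correlationLp_ae_eq (positionOp ⟨f, hfd⟩) g,
          correlationLp_ae_eq f (positionOp ⟨g, hgd⟩), correlation_ae_eq hfae hgae,
          correlation_ae_eq (positionOp_ae_eq ⟨f, hfd⟩) (Filter.EventuallyEq.refl _ g),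
          correlation_ae_eq (Filter.EventuallyEq.refl _ f) (positionOp_ae_eq ⟨g, hgd⟩),
          Lp.coeFn_sub (correlationLp (positionOp ⟨f, hfd⟩) g)
            (correlationLp f (positionOp ⟨g, hgd⟩))] with p h1 h2 h3 h4 h5 h6 h7
        have h8 : (correlationLp (positionOp ⟨f, hfd⟩) g
            - correlationLp f (positionOp ⟨g, hgd⟩) : L2R2) p = (p.2 : ℂ) * correlation f g p := by
          rw [h7, Pi.sub_apply, h2, h3, h5, h6, correlation]
          simp only [map_mul, Complex.conj_ofReal]
          push_cast
          ring
        rw [h8, h1, h4]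
        by_cases hp1 : p.1 ∈ S <;> by_cases hp2 : p.1 - p.2 ∈ T <;>
          simp [hp1, hp2, hw, Set.indicator]
      have hmeas : MeasurableSet ((fun p : ℝ × ℝ => (p.1, p.1 - p.2)) ⁻¹' (S ×ˢ T)) :=
        measurePreserving_fst_sub.measurable (hS.prod hT)
      rw [integral_congr_ae e, integral_indicator hmeas] at h1
      have hinv : Function.Involutive fun p : ℝ × ℝ => (p.1, p.1 - p.2) := fun p => by simp
      have hemb : MeasurableEmbedding fun p : ℝ × ℝ => (p.1, p.1 - p.2) :=
        (MeasurableEquiv.mk hinv.toPerm measurePreserving_fst_sub.measurable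
          measurePreserving_fst_sub.measurable).measurableEmbedding
      have h9 := measurePreserving_fst_sub.setIntegral_preimage_emb hemb
        (fun p => w (p.1, p.1 - p.2)) (S ×ˢ T)
      simp only [sub_sub_cancel, Prod.mk.eta] at h9
      rw [← h9, h1]
  have hw0 : w =ᵐ[volume] 0 := by
    have := measurePreserving_fst_sub.quasiMeasurePreserving.ae hwτ
    filter_upwards [this] with p hp
    simpa using hp
  refine le_of_eq (lintegral_congr_ae ?_)
  filter_upwards [hw0] with p hp
  have : k p = (p.2 : ℂ) * a p := by simpa [hw, sub_eq_zero] using hp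
  rw [this, enorm_mul, mul_pow, ← ofReal_norm (p.2 : ℂ), Complex.norm_real, ofReal_norm]

end Kernel

/-! ### Momentum as the Fourier conjugate of position. -/

section Momentum

open scoped FourierTransform

theorem IsWeakDeriv.momentumOp_apply {f g : L2R} (h : IsWeakDeriv f g) (ℏ : ℝ) :
    ∃ hf : f ∈ (momentumOp ℏ).domain, momentumOp ℏ ⟨f, hf⟩ = (-Complex.I * (ℏ : ℂ)) • g := by
  have h' : ∃ g, IsWeakDeriv f g := ⟨g, h⟩
  exact ⟨h', congrArg ((-Complex.I * (ℏ : ℂ)) • ·) (h'.choose_spec.unique h)⟩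

/-- A real test function, as a complex-valued Schwartz function. -/
noncomputable def testSchwartz {φ : ℝ → ℝ} (hφ : ContDiff ℝ ∞ φ) (hc : HasCompactSupport φ) :
    SchwartzMap ℝ ℂ :=
  HasCompactSupport.toSchwartzMap (f := fun x => (φ x : ℂ)) (hc.comp_left (g := Complex.ofReal) rfl)
    (Complex.ofRealCLM.contDiff.comp hφ)

theorem testSchwartz_apply {φ : ℝ → ℝ} (hφ : ContDiff ℝ ∞ φ) (hc : HasCompactSupport φ) (x : ℝ) :
    testSchwartz hφ hc x = φ x := rfl

theorem inner_testSchwartz {φ : ℝ → ℝ} (hφ : ContDiff ℝ ∞ φ) (hc : HasCompactSupport φ) (f : L2R) :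
    ⟪(testSchwartz hφ hc).toLp 2 volume, f⟫_ℂ = ∫ x, φ x • f x := by
  rw [inner_L2R_eq_integral]
  refine integral_congr_ae ?_
  filter_upwards [(testSchwartz hφ hc).coeFn_toLp 2 volume] with x hx
  rw [hx, testSchwartz_apply, Complex.conj_ofReal, Complex.real_smul]

theorem isWeakDeriv_testSchwartz {φ : ℝ → ℝ} (hφ : ContDiff ℝ ∞ φ) (hc : HasCompactSupport φ)
    (hφ' : ContDiff ℝ ∞ (deriv φ)) :
    IsWeakDeriv ((testSchwartz hφ hc).toLp 2 volume) ((testSchwartz hφ' hc.deriv).toLp 2 volume) := by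
  intro χ hχ hcχ
  have e1 : ∫ x, deriv χ x • ((testSchwartz hφ hc).toLp 2 volume : L2R) x
      = ((∫ x, φ x * deriv χ x : ℝ) : ℂ) := by
    rw [← integral_complex_ofReal]
    refine integral_congr_ae ?_
    filter_upwards [(testSchwartz hφ hc).coeFn_toLp 2 volume] with x hx
    rw [hx, testSchwartz_apply, Complex.real_smul]
    push_cast
    ring
  have e2 : ∫ x, χ x • ((testSchwartz hφ' hc.deriv).toLp 2 volume : L2R) x
      = ((∫ x, deriv φ x * χ x : ℝ) : ℂ) := by
    rw [← integral_complex_ofReal]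
    refine integral_congr_ae ?_
    filter_upwards [(testSchwartz hφ' hc.deriv).coeFn_toLp 2 volume] with x hx
    rw [hx, testSchwartz_apply, Complex.real_smul]
    push_cast
    ring
  rw [e1, e2, ← Complex.ofReal_neg]
  congr 1
  have hdχ : Continuous (deriv χ) := hχ.continuous_deriv (by simp)
  refine integral_mul_deriv_eq_deriv_mul_of_integrable
    (fun x _ => ((hφ.differentiable (by simp)) x).hasDerivAt)
    (fun x _ => ((hχ.differentiable (by simp)) x).hasDerivAt) ?_ ?_ ?_
  · exact (hφ.continuous.mul hdχ).integrable_of_hasCompactSupport hcχ.deriv.mul_left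
  · exact (hφ'.continuous.mul hχ.continuous).integrable_of_hasCompactSupport hcχ.mul_left
  · exact (hφ.continuous.mul hχ.continuous).integrable_of_hasCompactSupport hcχ.mul_left

theorem ContDiff.deriv_infty {φ : ℝ → ℝ} (hφ : ContDiff ℝ ∞ φ) : ContDiff ℝ ∞ (deriv φ) :=
  (contDiff_infty_iff_deriv.1 hφ).2

/-- Real test functions lie in the domain, and on them the adjoint relation is the definition of the
weak derivative. -/
theorem extendsAdjoint_momentumOp {ℏ : ℝ} (hℏ : ℏ ≠ 0) : ExtendsAdjoint (momentumOp ℏ) := by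
  intro u g h
  have hℏ' : (ℏ : ℂ) ≠ 0 := Complex.ofReal_ne_zero.2 hℏ
  have hw : IsWeakDeriv u ((Complex.I / ℏ) • g) := by
    intro φ hφ hc
    obtain ⟨hd, he⟩ := (isWeakDeriv_testSchwartz hφ hc hφ.deriv_infty).momentumOp_apply ℏ
    have h1 := h ⟨_, hd⟩
    rw [he, inner_smul_left, inner_testSchwartz, inner_testSchwartz] at h1
    rw [← inner_testSchwartz hφ hc, inner_smul_right, inner_testSchwartz, ← h1]
    simp only [map_mul, map_neg, Complex.conj_I, Complex.conj_ofReal]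
    field_simp
    rw [Complex.I_sq]
    ring
  obtain ⟨hd, he⟩ := hw.momentumOp_apply ℏ
  refine ⟨hd, he.trans ?_⟩
  rw [smul_smul]
  convert one_smul ℂ g
  field_simp
  rw [Complex.I_sq]
  ring

theorem isWeakDeriv_fourierInv (f : positionOp.domain) :
    IsWeakDeriv (𝓕⁻ (f : L2R)) ((2 * Real.pi * Complex.I) • 𝓕⁻ (positionOp f)) := by
  intro φ hφ hc
  have hφ' := hφ.deriv_infty
  have hinv : ∀ (Φ : SchwartzMap ℝ ℂ) (g : L2R),
      ⟪Φ.toLp 2 volume, 𝓕⁻ g⟫_ℂ = ⟪(𝓕 Φ).toLp 2 volume, g⟫_ℂ := fun Φ g => by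
    rw [← SchwartzMap.toLp_fourier_eq, ← Lp.inner_fourier_eq _ (𝓕⁻ g),
      FourierTransform.fourier_fourierInv_eq]
  rw [← inner_testSchwartz hφ hc, ← inner_testSchwartz hφ' hc.deriv, inner_smul_right, hinv, hinv,
    inner_L2R_eq_integral, inner_L2R_eq_integral, ← integral_const_mul, ← integral_neg]
  refine integral_congr_ae ?_
  have hF : ∀ ξ : ℝ, 𝓕 (testSchwartz hφ' hc.deriv) ξ
      = (2 * Real.pi * Complex.I * ξ) * 𝓕 (testSchwartz hφ hc) ξ := fun ξ => by
    have hder : (testSchwartz hφ' hc.deriv : ℝ → ℂ) = deriv (testSchwartz hφ hc : ℝ → ℂ) := by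
      ext x
      rw [testSchwartz_apply]
      exact ((hφ.differentiable (by simp) x).hasDerivAt.ofReal_comp).deriv.symm
    rw [SchwartzMap.fourier_coe, SchwartzMap.fourier_coe, hder,
      Real.fourier_deriv (testSchwartz hφ hc).integrable (testSchwartz hφ hc).differentiable]
    · simp
    · rw [← hder]; exact (testSchwartz hφ' hc.deriv).integrable
  filter_upwards [(𝓕 (testSchwartz hφ hc)).coeFn_toLp 2 volume,
    (𝓕 (testSchwartz hφ' hc.deriv)).coeFn_toLp 2 volume, positionOp_ae_eq f] with ξ h1 h2 h3
  rw [h1, h2, h3, hF]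
  simp only [map_mul, Complex.conj_I, Complex.conj_ofReal, map_ofNat]
  ring

/-- Conjugation of a bounded operator with the Fourier transform. -/
noncomputable def fourierConj (A : L2R →L[ℂ] L2R) : L2R →L[ℂ] L2R :=
  (Lp.fourierTransformₗᵢ ℝ ℂ).toContinuousLinearEquiv.toContinuousLinearMap ∘L A ∘L
    (Lp.fourierTransformₗᵢ ℝ ℂ).symm.toContinuousLinearEquiv.toContinuousLinearMap

theorem fourierConj_apply (A : L2R →L[ℂ] L2R) (f : L2R) : fourierConj A f = 𝓕 (A (𝓕⁻ f)) := rfl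

theorem inner_fourierConj_right (A : L2R →L[ℂ] L2R) (f g : L2R) :
    ⟪f, fourierConj A g⟫_ℂ = ⟪𝓕⁻ f, A (𝓕⁻ g)⟫_ℂ := by
  rw [fourierConj_apply, ← Lp.inner_fourier_eq (𝓕⁻ f), FourierTransform.fourier_fourierInv_eq]

theorem inner_fourierConj_left (A : L2R →L[ℂ] L2R) (f g : L2R) :
    ⟪fourierConj A f, g⟫_ℂ = ⟪A (𝓕⁻ f), 𝓕⁻ g⟫_ℂ := by
  rw [fourierConj_apply, ← Lp.inner_fourier_eq _ (𝓕⁻ g), FourierTransform.fourier_fourierInv_eq]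

/-- On inverse transforms of vectors in the domain of `x`, momentum acts as `2πℏ x`; the commutator
scales accordingly. -/
theorem IsCommutator.fourierConj {ℏ : ℝ} (hℏ : ℏ ≠ 0) {A B : L2R →L[ℂ] L2R}
    (h : IsCommutator (momentumOp ℏ) A B) :
    IsCommutator positionOp (fourierConj A) ((2 * Real.pi * ℏ : ℂ)⁻¹ • fourierConj B) := by
  intro φ ψ
  have hℏ' : (2 * Real.pi * ℏ : ℂ) ≠ 0 := by
    simp [hℏ, Real.pi_ne_zero]
  obtain ⟨h1, e1⟩ := (isWeakDeriv_fourierInv φ).momentumOp_apply ℏ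
  obtain ⟨h2, e2⟩ := (isWeakDeriv_fourierInv ψ).momentumOp_apply ℏ
  have h3 := h ⟨_, h1⟩ ⟨_, h2⟩
  have hc : -Complex.I * ℏ * (2 * Real.pi * Complex.I) = ((2 * Real.pi * ℏ : ℝ) : ℂ) := by
    push_cast
    linear_combination (-2 * Real.pi * ℏ : ℂ) * Complex.I_sq
  rw [e1, e2, smul_smul, smul_smul, hc, map_smul, inner_smul_left, inner_smul_right,
    Complex.conj_ofReal] at h3
  rw [smul_apply, inner_smul_right, inner_fourierConj_right,
    inner_fourierConj_right, inner_fourierConj_right, h3]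
  push_cast
  rw [← mul_sub, inv_mul_cancel_left₀ hℏ']

variable {ι : Type*}

/-- The image of a Hilbert basis under the Fourier transform. -/
noncomputable def HilbertBasis.fourier (b : HilbertBasis ι ℂ L2R) : HilbertBasis ι ℂ L2R :=
  HilbertBasis.ofRepr ((Lp.fourierTransformₗᵢ ℝ ℂ).symm.trans b.repr)

theorem HilbertBasis.fourier_apply (b : HilbertBasis ι ℂ L2R) (i : ι) :
    b.fourier i = 𝓕 (b i : L2R) := by
  classical
  rw [← HilbertBasis.repr_symm_single b.fourier, ← HilbertBasis.repr_symm_single b]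
  rfl

theorem lintegral_sq_mul_kernel_fourier_le {ℏ : ℝ} (hℏ : ℏ ≠ 0) (b : HilbertBasis ι ℂ L2R)
    {A B : L2R →L[ℂ] L2R} (hA : ∀ x y, ⟪A x, y⟫_ℂ = ⟪x, A y⟫_ℂ) {l : ι → ℝ}
    (hl : ∀ i, A (b i) = (l i : ℂ) • b i) {a : L2R2}
    (ha : HasSum (fun j => (l j : ℂ) • correlationLp (𝓕 (b j : L2R)) (𝓕 (b j : L2R))) a)
    (hAB : IsCommutator (momentumOp ℏ) A B) :
    ENNReal.ofReal ((2 * Real.pi * ℏ) ^ 2) * ∫⁻ p : ℝ × ℝ, ‖p.2‖ₑ ^ 2 * ‖a p‖ₑ ^ 2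
      ≤ opTrace (ContinuousLinearMap.adjoint B ∘L B) := by
  simp only [← HilbertBasis.fourier_apply] at ha
  have h1 := lintegral_sq_mul_kernel_le b.fourier (A := fourierConj A) (fun x y => by
      rw [inner_fourierConj_left, inner_fourierConj_right, hA]) (fun i => by
      rw [HilbertBasis.fourier_apply, fourierConj_apply, FourierTransform.fourierInv_fourier_eq, hl]
      exact map_smul (Lp.fourierTransformₗᵢ ℝ ℂ) _ _) ha (hAB.fourierConj hℏ)
  have h2 : ∀ j k, ‖⟪b.fourier j, ((2 * Real.pi * ℏ : ℂ)⁻¹ • fourierConj B) (b.fourier k)⟫_ℂ‖ₑ ^ 2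
      = (ENNReal.ofReal ((2 * Real.pi * ℏ) ^ 2))⁻¹ * ‖⟪b j, B (b k)⟫_ℂ‖ₑ ^ 2 := fun j k => by
    rw [smul_apply, inner_smul_right, inner_fourierConj_right,
      HilbertBasis.fourier_apply, HilbertBasis.fourier_apply,
      FourierTransform.fourierInv_fourier_eq, FourierTransform.fourierInv_fourier_eq, enorm_mul,
      mul_pow, ← ENNReal.ofReal_inv_of_pos (by positivity), ← ofReal_norm (_ : ℂ)⁻¹,
      ← ENNReal.ofReal_pow (norm_nonneg _)]
    congr 2
    have : (2 * Real.pi * ℏ : ℂ) = ((2 * Real.pi * ℏ : ℝ) : ℂ) := by push_cast; rfl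
    rw [norm_inv, this, Complex.norm_real, Real.norm_eq_abs, inv_pow, sq_abs]
  rw [opTrace_adjoint_comp_eq b.fourier] at h1
  simp only [h2, ENNReal.tsum_mul_left] at h1
  rw [← opTrace_adjoint_comp_eq b] at h1
  refine (mul_le_mul_right h1 _).trans_eq ?_
  rw [← mul_assoc, ENNReal.mul_inv_cancel (by simp [Real.pi_ne_zero, hℏ])
    ENNReal.ofReal_ne_top, one_mul]

end Momentum

/-! ### The Fourier-Wigner function of an operator and its second moments. -/

section PhaseSpace

open scoped FourierTransform

theorem tendsto_setLIntegral_enorm_sq {Ω κ : Type*} [MeasurableSpace Ω] {μ : Measure Ω}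
    {F : Filter κ} {u : κ → Lp ℂ 2 μ} {u₀ : Lp ℂ 2 μ} (hu : Filter.Tendsto u F (nhds u₀))
    (S : Set Ω) :
    Filter.Tendsto (fun i => ∫⁻ x in S, ‖u i x‖ₑ ^ 2 ∂μ) F (nhds (∫⁻ x in S, ‖u₀ x‖ₑ ^ 2 ∂μ)) := by
  have h : ∀ f : Lp ℂ 2 μ, ∫⁻ x in S, ‖f x‖ₑ ^ 2 ∂μ = ‖LpToLpRestrictCLM Ω ℂ ℂ μ 2 S f‖ₑ ^ 2 := by
    intro f
    rw [enorm_Lp_two_sq]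
    refine lintegral_congr_ae ?_
    filter_upwards [LpToLpRestrictCLM_coeFn ℂ S f] with x hx
    rw [hx]
  simp only [h]
  exact ((ENNReal.continuous_pow 2).comp
    (continuous_enorm.comp (LpToLpRestrictCLM Ω ℂ ℂ μ 2 S).continuous)).tendsto u₀ |>.comp hu

/-- Equality of the distributions of two densities `|u|²` and `|v|²` passes to limits in `L²`. -/
theorem lintegral_weight_eq_of_tendsto {Ω κ : Type*} [MeasurableSpace Ω] {μ : Measure Ω}
    {F : Filter κ} [F.NeBot] {u v : κ → Lp ℂ 2 μ} {u₀ v₀ : Lp ℂ 2 μ}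
    (hu : Filter.Tendsto u F (nhds u₀)) (hv : Filter.Tendsto v F (nhds v₀)) {π σ : Ω → ℝ}
    (hπ : Measurable π) (hσ : Measurable σ)
    (h : ∀ (i : κ) (m : ℝ → ℝ≥0∞), Measurable m →
      ∫⁻ x, m (π x) * ‖u i x‖ₑ ^ 2 ∂μ = ∫⁻ x, m (σ x) * ‖v i x‖ₑ ^ 2 ∂μ)
    {m : ℝ → ℝ≥0∞} (hm : Measurable m) :
    ∫⁻ x, m (π x) * ‖u₀ x‖ₑ ^ 2 ∂μ = ∫⁻ x, m (σ x) * ‖v₀ x‖ₑ ^ 2 ∂μ := by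
  have hset : ∀ (τ : Ω → ℝ), Measurable τ → ∀ (f : Lp ℂ 2 μ) (S : Set ℝ), MeasurableSet S →
      ∫⁻ x in τ ⁻¹' S, ‖f x‖ₑ ^ 2 ∂μ = ∫⁻ x, S.indicator 1 (τ x) * ‖f x‖ₑ ^ 2 ∂μ := by
    intro τ hτ f S hS
    rw [← lintegral_indicator (hτ hS)]
    refine lintegral_congr fun x => ?_
    by_cases hx : τ x ∈ S <;> simp [Set.indicator, hx]
  -- The weight may be unbounded, so its integral need not be continuous in `L²`. Masses of sets
  -- are, which identifies the two image measures and hence the integrals of every weight.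
  have heq : (μ.withDensity fun x => ‖u₀ x‖ₑ ^ 2).map π
      = (μ.withDensity fun x => ‖v₀ x‖ₑ ^ 2).map σ := by
    ext S hS
    rw [Measure.map_apply hπ hS, Measure.map_apply hσ hS, withDensity_apply _ (hπ hS),
      withDensity_apply _ (hσ hS)]
    refine tendsto_nhds_unique (tendsto_setLIntegral_enorm_sq hu _) ?_
    refine (tendsto_setLIntegral_enorm_sq hv _).congr fun i => ?_
    rw [hset π hπ _ S hS, hset σ hσ _ S hS, h i _ (measurable_one.indicator hS)]
  have hint : ∀ (τ : Ω → ℝ), Measurable τ → ∀ f : Lp ℂ 2 μ,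
      ∫⁻ x, m (τ x) * ‖f x‖ₑ ^ 2 ∂μ = ∫⁻ t, m t ∂((μ.withDensity fun x => ‖f x‖ₑ ^ 2).map τ) := by
    intro τ hτ f
    rw [lintegral_map hm hτ]
    refine Eq.trans ?_ (lintegral_withDensity_eq_lintegral_mul _ (measurable_enorm_Lp_sq f)
      (hm.comp hτ)).symm
    refine lintegral_congr fun x => ?_
    simp [mul_comm]
  rw [hint π hπ, hint σ hσ, heq]

theorem lintegral_enorm_sq_sum_ambiguity {ι : Type*} (F : Finset ι) (c : ι → ℂ) (f : ι → L2R) :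
    ∫⁻ p, ‖∑ j ∈ F, c j * ambiguity (f j) (f j) p‖ₑ ^ 2
      = ∫⁻ p, ‖∑ j ∈ F, c j * correlation (f j) (f j) p‖ₑ ^ 2 := by
  simpa using lintegral_weight_ambiguity (m := 1) measurable_one F c f

theorem memLp_ambiguity (f : L2R) : MemLp (ambiguity f f) 2 volume := by
  refine memLp_two_of_lintegral_enorm_sq_ne_top
    (stronglyMeasurable_ambiguity f f).aestronglyMeasurable ?_
  have h := lintegral_enorm_sq_sum_ambiguity {()} (fun _ => 1) fun _ => f
  simp only [Finset.sum_singleton, one_mul] at h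
  rw [h, lintegral_enorm_correlation_sq]
  exact ENNReal.mul_ne_top (ENNReal.pow_ne_top enorm_ne_top) (ENNReal.pow_ne_top enorm_ne_top)

/-- `ambiguity f f` as an element of `L²`. -/
noncomputable def ambiguityLp (f : L2R) : L2R2 := (memLp_ambiguity f).toLp _

theorem ambiguityLp_ae_eq (f : L2R) : ambiguityLp f =ᵐ[volume] ambiguity f f :=
  (memLp_ambiguity f).coeFn_toLp

theorem Lp_coeFn_sum_smul {Ω ι : Type*} [MeasurableSpace Ω] {μ : Measure Ω} (F : Finset ι)
    (c : ι → ℂ) {f : ι → Lp ℂ 2 μ} {g : ι → Ω → ℂ} (h : ∀ i, f i =ᵐ[μ] g i) :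
    (∑ j ∈ F, c j • f j : Lp ℂ 2 μ) =ᵐ[μ] fun x => ∑ j ∈ F, c j * g j x := by
  classical
  induction F using Finset.induction_on with
  | empty =>
    filter_upwards [Lp.coeFn_zero ℂ 2 μ] with x hx
    exact hx
  | insert i F hi ih =>
    rw [Finset.sum_insert hi]
    filter_upwards [Lp.coeFn_add (c i • f i) (∑ j ∈ F, c j • f j), Lp.coeFn_smul (c i) (f i), h i,
      ih] with x h1 h2 h3 h4
    rw [h1, Pi.add_apply, h2, Pi.smul_apply, h3, h4, Finset.sum_insert hi, smul_eq_mul]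

theorem norm_sum_ambiguityLp {ι : Type*} (F : Finset ι) (c : ι → ℂ) (f : ι → L2R) :
    ‖∑ j ∈ F, c j • ambiguityLp (f j)‖ = ‖∑ j ∈ F, c j • correlationLp (f j) (f j)‖ := by
  have h : ‖∑ j ∈ F, c j • ambiguityLp (f j)‖ₑ ^ 2
      = ‖∑ j ∈ F, c j • correlationLp (f j) (f j)‖ₑ ^ 2 := by
    rw [enorm_Lp_two_sq, enorm_Lp_two_sq, lintegral_congr_ae
      ((Lp_coeFn_sum_smul F c fun j => ambiguityLp_ae_eq (f j)).mono fun p hp => by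
        show ‖_‖ₑ ^ 2 = _
        rw [hp]), lintegral_enorm_sq_sum_ambiguity]
    refine lintegral_congr_ae ?_
    filter_upwards [Lp_coeFn_sum_smul F c fun j => correlationLp_ae_eq (f j) (f j)] with p hp
    rw [hp]
  rw [← ofReal_norm, ← ofReal_norm, ← ENNReal.ofReal_pow (norm_nonneg _),
    ← ENNReal.ofReal_pow (norm_nonneg _), ENNReal.ofReal_eq_ofReal_iff (by positivity)
    (by positivity)] at h
  exact (sq_eq_sq₀ (norm_nonneg _) (norm_nonneg _)).1 h

/-- Polarisation of the norm identity for finite sums; it carries orthonormality from the kernels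
over to the Fourier-Wigner functions. -/
theorem inner_ambiguityLp (f g : L2R) :
    ⟪ambiguityLp f, ambiguityLp g⟫_ℂ = ⟪correlationLp f f, correlationLp g g⟫_ℂ := by
  have h : ∀ c : ℂ, ‖ambiguityLp f + c • ambiguityLp g‖
      = ‖correlationLp f f + c • correlationLp g g‖ := fun c => by
    simpa [Fin.sum_univ_two] using norm_sum_ambiguityLp Finset.univ ![1, c] ![f, g]
  have h1 := h 1
  have h2 := h (-1)
  have h3 := h Complex.I
  have h4 := h (-Complex.I)
  simp only [one_smul, neg_smul, ← sub_eq_add_neg] at h1 h2 h3 h4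
  rw [inner_eq_sum_norm_sq_div_four, inner_eq_sum_norm_sq_div_four, h1, h2]
  simp only [RCLike.I_to_complex, h3, h4]

variable {ι : Type*}

theorem ambiguityLp_orthonormal (b : HilbertBasis ι ℂ L2R) :
    Orthonormal ℂ fun j : ι => ambiguityLp (b j) := by
  classical
  have h := orthonormal_iff_ite.1 (correlationLp_diag_orthonormal b)
  rw [orthonormal_iff_ite]
  intro i j
  rw [inner_ambiguityLp, h]

theorem lintegral_weight_snd_ambiguity_hasSum {f : ι → L2R} {c : ι → ℂ} {u a : L2R2}
    (hu : HasSum (fun j => c j • ambiguityLp (f j)) u)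
    (ha : HasSum (fun j => c j • correlationLp (f j) (f j)) a) {m : ℝ → ℝ≥0∞} (hm : Measurable m) :
    ∫⁻ p : ℝ × ℝ, m p.2 * ‖u p‖ₑ ^ 2 = ∫⁻ p : ℝ × ℝ, m p.2 * ‖a p‖ₑ ^ 2 := by
  refine lintegral_weight_eq_of_tendsto hu ha measurable_snd measurable_snd (fun F m hm => ?_) hm
  rw [lintegral_congr_ae ((Lp_coeFn_sum_smul F c fun j => ambiguityLp_ae_eq (f j)).mono
      fun p hp => by
        show m p.2 * ‖_‖ₑ ^ 2 = _
        rw [hp]), lintegral_weight_ambiguity hm]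
  refine lintegral_congr_ae ?_
  filter_upwards [Lp_coeFn_sum_smul F c fun j => correlationLp_ae_eq (f j) (f j)] with p hp
  rw [hp]

theorem lintegral_weight_fst_ambiguity_hasSum {f : ι → L2R} {c : ι → ℂ} {u a : L2R2}
    (hu : HasSum (fun j => c j • ambiguityLp (f j)) u)
    (ha : HasSum (fun j => c j • correlationLp (𝓕 (f j)) (𝓕 (f j))) a) {m : ℝ → ℝ≥0∞}
    (hm : Measurable m) :
    ∫⁻ p : ℝ × ℝ, m p.1 * ‖u p‖ₑ ^ 2 = ∫⁻ p : ℝ × ℝ, m p.2 * ‖a p‖ₑ ^ 2 := by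
  refine lintegral_weight_eq_of_tendsto hu ha measurable_fst measurable_snd (fun F m hm => ?_) hm
  rw [lintegral_congr_ae ((Lp_coeFn_sum_smul F c fun j => ambiguityLp_ae_eq (f j)).mono
      fun p hp => by
        show m p.1 * ‖_‖ₑ ^ 2 = _
        rw [hp]), ← lintegral_weight_correlation_fourier hm]
  refine lintegral_congr_ae ?_
  filter_upwards [Lp_coeFn_sum_smul F c fun j => correlationLp_ae_eq (𝓕 (f j)) (𝓕 (f j))] with p hp
  rw [hp]

/-- The Fourier-Wigner function of a positive operator `A` with eigenbasis `b` and
square-summable eigenvalues `l`, and its second moments. -/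
theorem exists_hasSum_ambiguityLp {ℏ : ℝ} (hℏ : ℏ ≠ 0) (b : HilbertBasis ι ℂ L2R)
    {A : L2R →L[ℂ] L2R} (hA : ∀ x y, ⟪A x, y⟫_ℂ = ⟪x, A y⟫_ℂ) {l : ι → ℝ}
    (hl : ∀ i, A (b i) = (l i : ℂ) • b i) (hs : ∑' i, ‖l i‖ₑ ^ 2 = 1) :
    ∃ u : L2R2, HasSum (fun j => (l j : ℂ) • ambiguityLp (b j)) u ∧ ‖u‖ₑ ^ 2 = 1 ∧
      (∀ B, IsCommutator positionOp A B →
        ∫⁻ p : ℝ × ℝ, ‖p.2‖ₑ ^ 2 * ‖u p‖ₑ ^ 2 ≤ opTrace (ContinuousLinearMap.adjoint B ∘L B)) ∧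
      ∀ B, IsCommutator (momentumOp ℏ) A B →
        ENNReal.ofReal ((2 * Real.pi * ℏ) ^ 2) * ∫⁻ p : ℝ × ℝ, ‖p.1‖ₑ ^ 2 * ‖u p‖ₑ ^ 2
          ≤ opTrace (ContinuousLinearMap.adjoint B ∘L B) := by
  have he : ∀ i, ‖(l i : ℂ)‖ₑ = ‖l i‖ₑ := fun i => by
    rw [← ofReal_norm, Complex.norm_real, ofReal_norm]
  have hsum : Summable fun i => ‖(l i : ℂ)‖ ^ 2 := by
    rw [← tsum_enorm_sq_ne_top_iff]
    simp only [he, hs]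
    exact ENNReal.one_ne_top
  obtain ⟨u, hu⟩ := (ambiguityLp_orthonormal b).summable_smul hsum
  obtain ⟨a, ha⟩ := (correlationLp_diag_orthonormal b).summable_smul hsum
  obtain ⟨a', ha'⟩ := (correlationLp_diag_orthonormal b.fourier).summable_smul hsum
  simp only [HilbertBasis.fourier_apply] at ha'
  have hm : Measurable fun t : ℝ => ‖t‖ₑ ^ 2 := by fun_prop
  refine ⟨u, hu, ?_, fun B hB => ?_, fun B hB => ?_⟩
  · rw [(ambiguityLp_orthonormal b).enorm_sq_of_hasSum hu]
    simp only [he, hs]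
  · rw [lintegral_weight_snd_ambiguity_hasSum hu ha hm]
    exact lintegral_sq_mul_kernel_le b hA hl ha hB
  · rw [lintegral_weight_fst_ambiguity_hasSum hu ha' hm]
    exact lintegral_sq_mul_kernel_fourier_le hℏ b hA hl ha' hB

end PhaseSpace

/-! ### Second moments control sums of powers of the eigenvalues. -/

section MainInequality

theorem schattenNorm_eq {H : Type*} [NormedAddCommGroup H] [InnerProductSpace ℂ H]
    [CompleteSpace H] {ι : Type*} (b : HilbertBasis ι ℂ H) {ρ : H →L[ℂ] H} (hρ : 0 ≤ ρ) {l : ι → ℝ}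
    (hl0 : ∀ i, 0 ≤ l i) (hl : ∀ i, ρ (b i) = ((l i ^ 2 : ℝ) : ℂ) • b i) {p : ℝ} (hp : 0 ≤ p) :
    schattenNorm p ρ = (∑' i, ENNReal.ofReal (l i ^ (2 * p))) ^ (1 / p) := by
  rw [schattenNorm, CFC.abs_of_nonneg ρ hρ]
  congr 1
  have h0 : 0 ≤ ρ ^ p := CFC.rpow_nonneg
  have hadj : ContinuousLinearMap.adjoint (CFC.sqrt (ρ ^ p)) = CFC.sqrt (ρ ^ p) :=
    (IsSelfAdjoint.of_nonneg (CFC.sqrt_nonneg (ρ ^ p))).adjoint_eq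
  have h1 := opTrace_adjoint_comp_eq_tsum_apply b (CFC.sqrt (ρ ^ p))
  rw [hadj, show CFC.sqrt (ρ ^ p) ∘L CFC.sqrt (ρ ^ p) = ρ ^ p from
    CFC.sqrt_mul_sqrt_self (ρ ^ p) h0] at h1
  rw [h1]
  refine tsum_congr fun i => ?_
  rw [CFC.sqrt_eq_rpow, rpow_apply_of_eigenvector h0 (rpow_apply_of_eigenvector hρ (hl i) hp)
    (by norm_num), ← ofReal_norm, norm_smul, b.orthonormal.1 i, mul_one, Complex.norm_real,
    ← ENNReal.ofReal_pow (norm_nonneg _), Real.norm_eq_abs, sq_abs]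
  congr 1
  have h2 : (l i ^ 2) ^ p = l i ^ (2 * p) := by
    rw [← Real.rpow_natCast, ← Real.rpow_mul (hl0 i)]
    norm_num
  have h3 : 0 ≤ l i ^ (2 * p) := Real.rpow_nonneg (hl0 i) _
  rw [h2, ← Real.sqrt_eq_rpow, Real.sq_sqrt h3]

/-- Strict positivity allows division by the moments when choosing the weight, and excludes products
`0 · ∞`. -/
theorem lintegral_sq_mul_enorm_sq_pos {π : ℝ × ℝ → ℝ} (hπ : Measurable π)
    (hπ0 : ∀ᵐ p, π p ≠ 0) {u : L2R2} (hu : ‖u‖ₑ ^ 2 = 1) :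
    0 < ∫⁻ p : ℝ × ℝ, ‖π p‖ₑ ^ 2 * ‖u p‖ₑ ^ 2 := by
  refine pos_iff_ne_zero.2 fun h => ?_
  have hm : Measurable fun p => ‖π p‖ₑ ^ 2 * ‖u p‖ₑ ^ 2 :=
    (hπ.enorm.pow_const 2).mul (measurable_enorm_Lp_sq u)
  rw [lintegral_eq_zero_iff hm] at h
  have h0 : ∫⁻ p, ‖u p‖ₑ ^ 2 = 0 := by
    rw [lintegral_eq_zero_iff (measurable_enorm_Lp_sq u)]
    filter_upwards [h, hπ0] with p hp hp0
    simpa [hp0] using hp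
  rw [← enorm_Lp_two_sq, hu] at h0
  exact one_ne_zero h0

theorem lintegral_enorm_sq_mul_weight {u : L2R2} (hu : ‖u‖ₑ ^ 2 = 1) {a b g₁ g₂ : ℝ}
    (hg₁ : 0 ≤ g₁) (hg₂ : 0 ≤ g₂)
    (h₁ : ∫⁻ p : ℝ × ℝ, ‖p.1‖ₑ ^ 2 * ‖u p‖ₑ ^ 2 = ENNReal.ofReal g₁)
    (h₂ : ∫⁻ p : ℝ × ℝ, ‖p.2‖ₑ ^ 2 * ‖u p‖ₑ ^ 2 = ENNReal.ofReal g₂) :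
    ∫⁻ p : ℝ × ℝ, ENNReal.ofReal (1 + ((a * p.1) ^ 2 + (b * p.2) ^ 2)) * ‖u p‖ₑ ^ 2
      = ENNReal.ofReal (1 + (a ^ 2 * g₁ + b ^ 2 * g₂)) := by
  have hu' := measurable_enorm_Lp_sq u
  have hm1 : Measurable fun p : ℝ × ℝ => ‖p.1‖ₑ ^ 2 * ‖u p‖ₑ ^ 2 :=
    (measurable_fst.enorm.pow_const 2).mul hu'
  have hm2 : Measurable fun p : ℝ × ℝ => ‖p.2‖ₑ ^ 2 * ‖u p‖ₑ ^ 2 :=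
    (measurable_snd.enorm.pow_const 2).mul hu'
  have h : ∀ p : ℝ × ℝ, ENNReal.ofReal (1 + ((a * p.1) ^ 2 + (b * p.2) ^ 2)) * ‖u p‖ₑ ^ 2
      = ‖u p‖ₑ ^ 2 + (ENNReal.ofReal (a ^ 2) * (‖p.1‖ₑ ^ 2 * ‖u p‖ₑ ^ 2)
        + ENNReal.ofReal (b ^ 2) * (‖p.2‖ₑ ^ 2 * ‖u p‖ₑ ^ 2)) := fun p => by
    have e : ∀ t : ℝ, ‖t‖ₑ ^ 2 = ENNReal.ofReal (t ^ 2) := fun t => by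
      rw [← ofReal_norm, ← ENNReal.ofReal_pow (norm_nonneg _), Real.norm_eq_abs, sq_abs]
    rw [e, e, ENNReal.ofReal_add zero_le_one (by positivity),
      ENNReal.ofReal_add (by positivity) (by positivity), mul_pow, mul_pow,
      ENNReal.ofReal_mul (by positivity), ENNReal.ofReal_mul (by positivity), ENNReal.ofReal_one]
    ring
  simp only [h]
  rw [lintegral_add_left hu', lintegral_add_left (hm1.const_mul _), lintegral_const_mul _ hm1,
    lintegral_const_mul _ hm2, h₁, h₂, ← enorm_Lp_two_sq, hu,
    ENNReal.ofReal_add zero_le_one (by positivity),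
    ENNReal.ofReal_add (by positivity) (by positivity), ENNReal.ofReal_mul (by positivity),
    ENNReal.ofReal_mul (by positivity), ENNReal.ofReal_one]

/-- Cauchy-Schwarz with a weight. -/
theorem enorm_inner_sq_le_lintegral_weight {Ω : Type*} [MeasurableSpace Ω] {μ : Measure Ω}
    (f u : Lp ℂ 2 μ) {w : Ω → ℝ} (hw : Measurable w) (hw0 : ∀ x, 0 < w x) :
    ‖⟪f, u⟫_ℂ‖ₑ ^ 2 ≤ (∫⁻ x, ENNReal.ofReal (w x)⁻¹ * ‖f x‖ₑ ^ 2 ∂μ) *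
      ∫⁻ x, ENNReal.ofReal (w x) * ‖u x‖ₑ ^ 2 ∂μ := by
  have e : ∀ {t : ℝ} (z : ℂ), 0 ≤ t →
      (ENNReal.ofReal √t * ‖z‖ₑ) ^ (2 : ℝ) = ENNReal.ofReal t * ‖z‖ₑ ^ 2 := fun z ht => by
    rw [ENNReal.rpow_two, mul_pow, ← ENNReal.ofReal_pow (Real.sqrt_nonneg _), Real.sq_sqrt ht]
  have hf : Measurable fun x => ENNReal.ofReal √(w x)⁻¹ * ‖f x‖ₑ :=
    hw.inv.sqrt.ennreal_ofReal.mul (Lp.stronglyMeasurable f).enorm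
  have hu : Measurable fun x => ENNReal.ofReal √(w x) * ‖u x‖ₑ :=
    hw.sqrt.ennreal_ofReal.mul (Lp.stronglyMeasurable u).enorm
  have h1 := ENNReal.lintegral_mul_le_Lp_mul_Lq μ Real.HolderConjugate.two_two hf.aemeasurable
    hu.aemeasurable
  simp only [e _ (hw0 _).le, e _ (inv_nonneg.2 (hw0 _).le)] at h1
  have h2 : ‖⟪f, u⟫_ℂ‖ₑ ≤ ∫⁻ x, ((fun x => ENNReal.ofReal √(w x)⁻¹ * ‖f x‖ₑ) *
      fun x => ENNReal.ofReal √(w x) * ‖u x‖ₑ) x ∂μ := by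
    rw [inner_Lp_two_eq_integral]
    refine (enorm_integral_le_lintegral_enorm _).trans_eq (lintegral_congr fun x => ?_)
    rw [enorm_mul, RCLike.enorm_conj, Pi.mul_apply, mul_mul_mul_comm,
      ← ENNReal.ofReal_mul (Real.sqrt_nonneg _), ← Real.sqrt_mul (inv_nonneg.2 (hw0 x).le),
      inv_mul_cancel₀ (hw0 x).ne', Real.sqrt_one, ENNReal.ofReal_one, one_mul]
  refine (pow_le_pow_left' (h2.trans h1) 2).trans_eq ?_
  rw [mul_pow, ← ENNReal.rpow_two, ← ENNReal.rpow_two, ← ENNReal.rpow_mul, ← ENNReal.rpow_mul]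
  norm_num

variable {ι : Type*}

theorem lintegral_weight_inv_ambiguity_le (b : HilbertBasis ι ℂ L2R) {F : Finset ι} {c : ι → ℝ}
    (hc : ∀ j ∈ F, 0 < c j) {s α β : ℝ} (hs0 : 0 < s) (hs1 : s < 1) (hα : 0 < α) (hβ : 0 < β) :
    ∫⁻ p : ℝ × ℝ, ENNReal.ofReal (1 + ((α * p.1) ^ 2 + (β * p.2) ^ 2))⁻¹ *
        ‖∑ j ∈ F, (c j : ℂ) * ambiguity (b j) (b j) p‖ₑ ^ 2
      ≤ ENNReal.ofReal ((Real.pi / (α * β * (s⁻¹ - 1))) ^ s *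
        (∑ j ∈ F, c j ^ (2 / (1 + s))) ^ (1 + s)) := by
  set w : ℝ × ℝ → ℝ := fun p => 1 + ((α * p.1) ^ 2 + (β * p.2) ^ 2) with hw
  have hw1 : ∀ p, 1 ≤ w p := fun p => le_add_of_nonneg_right (by positivity)
  have hw0 : ∀ p, 0 < w p := fun p => zero_lt_one.trans_le (hw1 p)
  have hwm : Measurable w := by fun_prop
  -- Chosen so that `e^{sL} = 1/w`, while `e^L = w^{-1/s}` is integrable on the plane since `1/s >
  -- 1`.
  set L : ℝ × ℝ → ℝ := fun p => -s⁻¹ * Real.log (w p) with hL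
  have hexp : ∀ p, Real.exp (L p) = w p ^ (-s⁻¹) := fun p => by
    rw [Real.rpow_def_of_pos (hw0 p), mul_comm]
  have hexps : ∀ p, Real.exp (s * L p) = (w p)⁻¹ := fun p => by
    have e : s * L p = -Real.log (w p) := by
      simp only [hL]
      field_simp
    rw [e, Real.exp_neg, Real.exp_log (hw0 p)]
  have hq : 1 < s⁻¹ := (one_lt_inv₀ hs0).2 hs1
  have hLm : Measurable L := (Real.measurable_log.comp hwm).const_mul _
  have hI := lintegral_one_add_weighted_sq_rpow hq hα hβ
  have hLi : Integrable (fun p => Real.exp (L p)) := by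
    refine ⟨hLm.exp.aestronglyMeasurable, ?_⟩
    rw [hasFiniteIntegral_iff_ofReal (ae_of_all _ fun p => (Real.exp_pos _).le)]
    simp only [hexp]
    exact hI ▸ ENNReal.ofReal_lt_top
  have hIr : ∫ p, Real.exp (L p) = Real.pi / (α * β * (s⁻¹ - 1)) := by
    rw [integral_eq_lintegral_of_nonneg_ae (ae_of_all _ fun p => (Real.exp_pos _).le) hLi.1]
    simp only [hexp]
    rw [hI, ENNReal.toReal_ofReal]
    have : 0 < s⁻¹ - 1 := sub_pos.2 hq
    positivity
  have hF : ∀ d : ι → ℂ, ∫⁻ p, ‖∑ j ∈ F, d j * ambiguity (b j) (b j) p‖ₑ ^ 2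
      = ∑ j ∈ F, ‖d j‖ₑ ^ 2 := fun d => by
    rw [lintegral_congr_ae (g := fun p => ‖(∑ j ∈ F, d j • ambiguityLp (b j) : L2R2) p‖ₑ ^ 2)
      ((Lp_coeFn_sum_smul F d fun j => ambiguityLp_ae_eq (b j)).mono fun p hp => by
        simp only [hp]), ← enorm_Lp_two_sq, (ambiguityLp_orthonormal b).enorm_sq_sum]
  have hm := integral_sq_mul_exp_le_of_orthonormal (F := F)
    (fun j => (stronglyMeasurable_ambiguity (b j) (b j)).aestronglyMeasurable) (fun j p => by
      simpa [b.orthonormal.1 j] using norm_ambiguity_le (b j) (b j) p) hF hLm (fun p => by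
      have := Real.log_nonneg (hw1 p)
      have := inv_pos.2 hs0
      rw [hL]
      nlinarith [mul_nonneg this.le (Real.log_nonneg (hw1 p))]) hLi hs0 hs1 hc
  rw [hIr] at hm
  refine le_trans (le_of_eq ?_) (ENNReal.ofReal_le_ofReal hm)
  have hsm : StronglyMeasurable fun p => ∑ j ∈ F, (c j : ℂ) * ambiguity (b j) (b j) p :=
    Finset.stronglyMeasurable_fun_sum _ fun j _ => (stronglyMeasurable_ambiguity _ _).const_mul _
  rw [ofReal_integral_eq_lintegral_ofReal]
  · refine lintegral_congr fun p => ?_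
    rw [hexps, mul_comm, ENNReal.ofReal_mul (by positivity), ENNReal.ofReal_pow (norm_nonneg _),
      ofReal_norm]
  · have h1 : MemLp (fun p => ∑ j ∈ F, (c j : ℂ) * ambiguity (b j) (b j) p) 2 volume :=
      memLp_finsetSum _ fun j _ => (memLp_ambiguity _).const_mul _
    refine (h1.integrable_norm_pow two_ne_zero).mul_bdd (c := 1)
      (hLm.const_mul s).exp.aestronglyMeasurable (ae_of_all _ fun p => ?_)
    rw [hexps, Real.norm_of_nonneg (inv_nonneg.2 (hw0 p).le)]
    exact inv_le_one_of_one_le₀ (hw1 p)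
  · exact ae_of_all _ fun p => by positivity

theorem sum_rpow_le_of_second_moments (b : HilbertBasis ι ℂ L2R) {l : ι → ℝ} {u : L2R2}
    (hu : HasSum (fun j => (l j : ℂ) • ambiguityLp (b j)) u) (hu1 : ‖u‖ₑ ^ 2 = 1) {g₁ g₂ : ℝ}
    (hg₁ : 0 < g₁) (hg₂ : 0 < g₂)
    (h₁ : ∫⁻ p : ℝ × ℝ, ‖p.1‖ₑ ^ 2 * ‖u p‖ₑ ^ 2 = ENNReal.ofReal g₁)
    (h₂ : ∫⁻ p : ℝ × ℝ, ‖p.2‖ₑ ^ 2 * ‖u p‖ₑ ^ 2 = ENNReal.ofReal g₂)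
    {s : ℝ} (hs0 : 0 < s) (hs1 : s < 1) (F : Finset ι) (hl : ∀ j ∈ F, 0 < l j) :
    (∑ j ∈ F, l j ^ (2 / (1 - s))) ^ ((1 - s) / s)
      ≤ (1 - s) ^ (-(1 / s)) * (2 * Real.pi * √(g₁ * g₂)) := by
  have hs : 0 < 1 - s := sub_pos.2 hs1
  rcases F.eq_empty_or_nonempty with rfl | hF
  · rw [Finset.sum_empty, Real.zero_rpow (by positivity)]
    positivity
  set S := ∑ j ∈ F, l j ^ (2 / (1 - s)) with hS
  have hS0 : 0 < S := Finset.sum_pos (fun j hj => Real.rpow_pos_of_pos (hl j hj) _) hF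
  -- The dual exponent: `c_j^{2/(1+s)}` and `c_j l_j` both equal `l_j^{2/(1-s)}`, so the same sum
  -- `S` occurs on both sides of Cauchy-Schwarz.
  set c : ι → ℝ := fun j => l j ^ ((1 + s) / (1 - s)) with hc
  have hc0 : ∀ j ∈ F, 0 < c j := fun j hj => Real.rpow_pos_of_pos (hl j hj) _
  have hcr : ∑ j ∈ F, c j ^ (2 / (1 + s)) = S := by
    refine Finset.sum_congr rfl fun j hj => ?_
    rw [hc, ← Real.rpow_mul (hl j hj).le]
    congr 1
    field_simp
  have hcl : ∑ j ∈ F, c j * l j = S := by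
    refine Finset.sum_congr rfl fun j hj => ?_
    rw [hc]
    dsimp only
    rw [← Real.rpow_add_one (hl j hj).ne']
    congr 1
    field_simp
    ring
  -- Both moments are normalised to `α² g₁ = β² g₂ = κ`. This `κ` minimises `κ^{-s} (1 + 2κ)`, the
  -- part of the bound that depends on it; then `∫ w |u|² = 1 + 2κ = 1/(1-s)`.
  set κ := s / (2 * (1 - s)) with hκ
  have hκ0 : 0 < κ := by positivity
  set α := √(κ / g₁) with hα
  set β := √(κ / g₂) with hβ
  have hα0 : 0 < α := Real.sqrt_pos.2 (by positivity)
  have hβ0 : 0 < β := Real.sqrt_pos.2 (by positivity)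
  have hα2 : α ^ 2 * g₁ = κ := by
    rw [hα, Real.sq_sqrt (by positivity), div_mul_cancel₀ _ hg₁.ne']
  have hβ2 : β ^ 2 * g₂ = κ := by
    rw [hβ, Real.sq_sqrt (by positivity), div_mul_cancel₀ _ hg₂.ne']
  have hαβ : Real.pi / (α * β * (s⁻¹ - 1)) = 2 * Real.pi * √(g₁ * g₂) := by
    have e1 : α * β = κ / √(g₁ * g₂) := by
      rw [hα, hβ, ← Real.sqrt_mul (by positivity), div_mul_div_comm, Real.sqrt_div (by positivity),
        Real.sqrt_mul_self hκ0.le]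
    have e2 : κ * (s⁻¹ - 1) = 1 / 2 := by
      rw [hκ]
      field_simp
    have e3 : 0 < √(g₁ * g₂) := Real.sqrt_pos.2 (by positivity)
    rw [e1, div_mul_eq_mul_div, e2]
    field_simp
  set T := 2 * Real.pi * √(g₁ * g₂) with hT
  have hT0 : 0 ≤ T := by positivity
  have hinner : ⟪∑ j ∈ F, (c j : ℂ) • ambiguityLp (b j), u⟫_ℂ = (S : ℂ) := by
    classical
    have h1 : ∀ j, ⟪ambiguityLp (b j), u⟫_ℂ = l j := fun j => by
      have h2 := hu.mapL (innerSL ℂ (ambiguityLp (b j)))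
      simp only [innerSL_apply_apply, inner_smul_right,
        orthonormal_iff_ite.1 (ambiguityLp_orthonormal b)] at h2
      refine h2.unique ?_
      refine (hasSum_ite_eq j (l j : ℂ)).congr_fun fun k => ?_
      by_cases h : k = j
      · simp [h]
      · simp [h, Ne.symm h]
    rw [sum_inner, ← hcl]
    push_cast
    refine Finset.sum_congr rfl fun j _ => ?_
    rw [inner_smul_left, Complex.conj_ofReal, h1]
  set w : ℝ × ℝ → ℝ := fun p => 1 + ((α * p.1) ^ 2 + (β * p.2) ^ 2) with hw
  have hCS := enorm_inner_sq_le_lintegral_weight (∑ j ∈ F, (c j : ℂ) • ambiguityLp (b j)) u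
    (w := w) (by fun_prop) fun p => by positivity
  have hQ := lintegral_weight_inv_ambiguity_le b hc0 hs0 hs1 hα0 hβ0
  rw [hcr, hαβ] at hQ
  have hQ' : ∫⁻ p, ENNReal.ofReal (w p)⁻¹ *
      ‖(∑ j ∈ F, (c j : ℂ) • ambiguityLp (b j) : L2R2) p‖ₑ ^ 2
      ≤ ENNReal.ofReal (T ^ s * S ^ (1 + s)) := by
    refine le_trans (le_of_eq (lintegral_congr_ae ?_)) hQ
    filter_upwards [Lp_coeFn_sum_smul F (fun j => (c j : ℂ)) fun j => ambiguityLp_ae_eq (b j)]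
      with p hp
    rw [hp]
  have hW : 1 + (α ^ 2 * g₁ + β ^ 2 * g₂) = (1 - s)⁻¹ := by
    rw [hα2, hβ2, hκ]
    field_simp
    ring
  rw [lintegral_enorm_sq_mul_weight hu1 hg₁.le hg₂.le h₁ h₂, hW, hinner] at hCS
  have hmain := hCS.trans (mul_le_mul_left hQ' _)
  rw [← ENNReal.ofReal_mul (by positivity), ← ofReal_norm, Complex.norm_real,
    Real.norm_of_nonneg hS0.le, ← ENNReal.ofReal_pow hS0.le,
    ENNReal.ofReal_le_ofReal_iff (by positivity)] at hmain
  -- Cauchy-Schwarz reads `S² ≤ T^s S^{1+s} / (1-s)`; the finite positive power `S^{1+s}` cancels.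
  have hS1 : S ^ (1 - s) ≤ T ^ s * (1 - s)⁻¹ := by
    have e : S ^ 2 = S ^ (1 - s) * S ^ (1 + s) := by
      rw [← Real.rpow_add hS0, ← Real.rpow_natCast]
      congr 1
      push_cast
      ring
    rw [e] at hmain
    refine le_of_mul_le_mul_right (hmain.trans_eq ?_) (Real.rpow_pos_of_pos hS0 (1 + s))
    ring
  have h := Real.rpow_le_rpow (by positivity) hS1 (show 0 ≤ 1 / s by positivity)
  rw [← Real.rpow_mul hS0.le, Real.mul_rpow (by positivity) (by positivity), ← Real.rpow_mul hT0,
    mul_one_div_cancel hs0.ne', Real.rpow_one, mul_one_div, ← Real.rpow_neg_eq_inv_rpow] at h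
  linarith

end MainInequality

/-! ### The uncertainty relation for the skew information. -/

section Uncertainty

theorem ae_fst_ne_zero : ∀ᵐ p : ℝ × ℝ, p.1 ≠ 0 :=
  Measure.quasiMeasurePreserving_fst.ae (Measure.ae_ne volume (0 : ℝ))

theorem ae_snd_ne_zero : ∀ᵐ p : ℝ × ℝ, p.2 ≠ 0 :=
  Measure.quasiMeasurePreserving_snd.ae (Measure.ae_ne volume (0 : ℝ))

/-- The trace is the supremum of its finite partial sums, and vanishing eigenvalues can be dropped
from them. -/
theorem schattenNorm_rpow_le {ι : Type*} (b : HilbertBasis ι ℂ L2R) {ρ : L2R →L[ℂ] L2R}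
    (hρ : 0 ≤ ρ) {l : ι → ℝ} (hl0 : ∀ i, 0 ≤ l i)
    (hl : ∀ i, ρ (b i) = ((l i ^ 2 : ℝ) : ℂ) • b i) {s K : ℝ} (hs0 : 0 < s) (hs1 : s < 1)
    (h : ∀ F : Finset ι, (∀ j ∈ F, 0 < l j) →
      (∑ j ∈ F, l j ^ (2 / (1 - s))) ^ ((1 - s) / s) ≤ K) :
    schattenNorm (1 / (1 - s)) ρ ^ (1 / s) ≤ ENNReal.ofReal K := by
  have hs : 0 < 1 - s := sub_pos.2 hs1
  rw [schattenNorm_eq b hρ hl0 hl (by positivity), ← ENNReal.rpow_mul, one_div_one_div,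
    mul_one_div, mul_one_div, ← ENNReal.le_rpow_inv_iff (by positivity), ENNReal.tsum_eq_iSup_sum]
  refine iSup_le fun F => ?_
  classical
  rw [← Finset.sum_filter_of_ne (p := fun j => 0 < l j) fun j _ hj => ?_,
    ENNReal.le_rpow_inv_iff (by positivity), ← ENNReal.ofReal_sum_of_nonneg fun j _ =>
      Real.rpow_nonneg (hl0 j) _, ENNReal.ofReal_rpow_of_nonneg
      (Finset.sum_nonneg fun j _ => Real.rpow_nonneg (hl0 j) _) (by positivity)]
  · exact ENNReal.ofReal_le_ofReal (h _ fun j hj => (Finset.mem_filter.1 hj).2)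
  · refine (hl0 j).lt_of_ne' fun h0 => hj ?_
    rw [h0, Real.zero_rpow (by positivity), ENNReal.ofReal_zero]

theorem schattenNorm_le_skewInformation {ℏ : ℝ} (hℏ : 0 < ℏ) {ρ : L2R →L[ℂ] L2R}
    (hρ : IsDensityOperator ρ) {s : ℝ} (hs0 : 0 < s) (hs1 : s < 1) :
    ENNReal.ofReal (ℏ / (8 * Real.pi * sobolevConst s ^ (2 / s))) *
        schattenNorm (1 / (1 - s)) ρ ^ (1 / s)
      ≤ (skewInformation positionOp ρ * skewInformation (momentumOp ℏ) ρ) ^ (1 / 2 : ℝ) := by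
  obtain ⟨ι, b, l, hl0, hl1, hρb, hlb⟩ := hρ.exists_eigenbasis
  obtain ⟨u, hu, hu1, hx, hp⟩ := exists_hasSum_ambiguityLp hℏ.ne' b (inner_sqrt_apply ρ) hlb hl1
  set G₁ := ∫⁻ p : ℝ × ℝ, ‖p.1‖ₑ ^ 2 * ‖u p‖ₑ ^ 2 with hG₁
  set G₂ := ∫⁻ p : ℝ × ℝ, ‖p.2‖ₑ ^ 2 * ‖u p‖ₑ ^ 2 with hG₂
  have hG₁0 : 0 < G₁ := lintegral_sq_mul_enorm_sq_pos measurable_fst ae_fst_ne_zero hu1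
  have hG₂0 : 0 < G₂ := lintegral_sq_mul_enorm_sq_pos measurable_snd ae_snd_ne_zero hu1
  set k := ENNReal.ofReal ((2 * Real.pi * ℏ) ^ 2) with hk
  have hk0 : 0 < k := ENNReal.ofReal_pos.2 (by positivity)
  have hIx : 2⁻¹ * G₂ ≤ skewInformation positionOp ρ :=
    le_iInf₂ fun B hB => mul_le_mul_right (hx B hB) _
  have hIp : 2⁻¹ * (k * G₁) ≤ skewInformation (momentumOp ℏ) ρ :=
    le_iInf₂ fun B hB => mul_le_mul_right (hp B hB) _
  refine le_trans ?_ (ENNReal.rpow_le_rpow (mul_le_mul' hIx hIp) (by norm_num))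
  -- If one moment is infinite, positivity of the other makes the product infinite.
  by_cases h1 : G₁ = ⊤
  · rw [h1, ENNReal.mul_top hk0.ne', ENNReal.mul_top (by simp),
      ENNReal.mul_top (mul_ne_zero (by simp) hG₂0.ne'), ENNReal.top_rpow_of_pos (by norm_num)]
    exact le_top
  by_cases h2 : G₂ = ⊤
  · rw [h2, ENNReal.mul_top (by simp), ENNReal.top_mul
      (mul_ne_zero (by simp) (mul_ne_zero hk0.ne' hG₁0.ne')), ENNReal.top_rpow_of_pos (by norm_num)]
    exact le_top
  set g₁ := G₁.toReal with hg₁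
  set g₂ := G₂.toReal with hg₂
  have e1 : G₁ = ENNReal.ofReal g₁ := (ENNReal.ofReal_toReal h1).symm
  have e2 : G₂ = ENNReal.ofReal g₂ := (ENNReal.ofReal_toReal h2).symm
  have hg₁0 : 0 < g₁ := ENNReal.toReal_pos hG₁0.ne' h1
  have hg₂0 : 0 < g₂ := ENNReal.toReal_pos hG₂0.ne' h2
  have hs : 0 < 1 - s := sub_pos.2 hs1
  have hN := schattenNorm_rpow_le b ((ContinuousLinearMap.nonneg_iff_isPositive ρ).2 hρ.isPositive)
    hl0 hρb hs0 hs1 (K := (1 - s) ^ (-(1 / s)) * (2 * Real.pi * √(g₁ * g₂)))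
    fun F hF => sum_rpow_le_of_second_moments b hu hu1 hg₁0 hg₂0 e1 e2 hs0 hs1 F hF
  refine (mul_le_mul_right hN _).trans ?_
  have hC := rpow_neg_inv_le_sobolevConst hs0 hs1
  have hpos : 0 < (1 - s) ^ (-(1 / s)) := Real.rpow_pos_of_pos hs _
  set D := sobolevConst s ^ (2 / s) with hD
  have hD0 : 0 < D := by
    by_contra hneg
    have := mul_nonpos_of_nonneg_of_nonpos (show 0 ≤ 4 * Real.pi by positivity) (not_lt.1 hneg)
    linarith
  have e3 : (2⁻¹ * G₂ * (2⁻¹ * (k * G₁)) : ℝ≥0∞) ^ (1 / 2 : ℝ)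
      = ENNReal.ofReal (Real.pi * ℏ * √(g₁ * g₂)) := by
    have e4 : (2⁻¹ : ℝ≥0∞) = ENNReal.ofReal 2⁻¹ := by
      rw [ENNReal.ofReal_inv_of_pos two_pos, ENNReal.ofReal_ofNat]
    rw [e1, e2, hk, e4, ← ENNReal.ofReal_mul (by positivity), ← ENNReal.ofReal_mul (by positivity),
      ← ENNReal.ofReal_mul (by positivity), ← ENNReal.ofReal_mul (by positivity),
      ENNReal.ofReal_rpow_of_nonneg (by positivity) (by norm_num), ← Real.sqrt_eq_rpow]
    congr 1
    rw [show 2⁻¹ * g₂ * (2⁻¹ * ((2 * Real.pi * ℏ) ^ 2 * g₁)) = (Real.pi * ℏ) ^ 2 * (g₁ * g₂) by ring,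
      Real.sqrt_mul (by positivity), Real.sqrt_sq (by positivity)]
  rw [e3, ← ENNReal.ofReal_mul (by positivity)]
  refine ENNReal.ofReal_le_ofReal ?_
  rw [div_mul_eq_mul_div, div_le_iff₀ (by positivity)]
  have h3 := mul_le_mul_of_nonneg_right hC (show 0 ≤ ℏ * (2 * Real.pi * √(g₁ * g₂)) by positivity)
  nlinarith

end Uncertainty

theorem theorem2 (ℏ : ℝ) (hℏ : 0 < ℏ) (ρ : L2R →L[ℂ] L2R) (hρ : IsDensityOperator ρ)
    (p p' : ℝ) (hp : 1 < p) (hp' : 1 / p + 1 / p' = 1) :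
    ENNReal.ofReal (ℏ / (8 * Real.pi * sobolevConst (1 / p') ^ (2 * p'))) *
        schattenNorm p ρ ^ p'
      ≤ (skewInformation positionOp ρ * skewInformation (momentumOp ℏ) ρ) ^ (1 / 2 : ℝ) ∧
    (skewInformation positionOp ρ * skewInformation (momentumOp ℏ) ρ) ^ (1 / 2 : ℝ)
      ≤ 4⁻¹ * (sldInformation positionOp ρ * sldInformation (momentumOp ℏ) ρ) ^ (1 / 2 : ℝ) := by
  have hp0 : 0 < p := zero_lt_one.trans hp
  have hs : 1 / p' = 1 - 1 / p := by linarith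
  have h1p : 1 / p < 1 := (div_lt_one hp0).2 hp
  have h0p : 0 < 1 / p := by positivity
  constructor
  -- With `s = 1/p'` one has `1/(1-s) = p`, `1/s = p'` and `2/s = 2p'`.
  · have h := schattenNorm_le_skewInformation hℏ hρ (s := 1 / p') (by linarith) (by linarith)
    have e : 1 - 1 / p' = 1 / p := by linarith
    rwa [e, one_div_one_div, one_div_one_div, div_div_eq_mul_div, div_one] at h
  · have hx := skewInformation_le_sldInformation extendsAdjoint_positionOp hρ
    have hm := skewInformation_le_sldInformation (extendsAdjoint_momentumOp hℏ.ne') hρ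
    refine (ENNReal.rpow_le_rpow (mul_le_mul' hx hm) (by norm_num)).trans_eq ?_
    rw [mul_mul_mul_comm, ENNReal.mul_rpow_of_nonneg _ _ (by norm_num), ← sq, ← ENNReal.rpow_two,
      ← ENNReal.rpow_mul]
    norm_num
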